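/- **Theorem 3.1 (central limit theorem for random moments).** For an interval $E\subseteq\mathbb R$ let $\mathcal P(E)$ be the set of Borel probability measures on $E$ with finite moments of all orders, $m_j(\mu)=\int x^j\,d\mu$, and $\mathcal M_n(E)=\{(m_1(\mu),\dots,m_n(\mu)):\mu\in\mathcal P(E)\}$. Let $E$ be one of $[a,b]$ (with $a<b$), $\mathbb R_+=[0,\infty)$, $\mathbb R$. For $(m_1,\dots,m_n)\in\operatorname{Int}\mathcal M_n(E)$ let $m_j^-\le m_j^+$ be the infimum and the supremum of the possible values of the $j$-th moment of measures in $\mathcal P(E)$ whose first $j-1$ moments are $m_1,\dots,m_{j-1}$, and define coordinates $(y_1,\dots,y_n)$ by * $E=[a,b]$: $y_j=p_j=\dfrac{m_j-m_j^-}{m_j^+-m_j^-}$; * $E=\mathbb R_+$: $y_j=z_j=\dfrac{m_j-m_j^-}{m_{j-1}-m_{j-1}^-}$, where $m_0=1$, $m_0^-=0$; * $E=\mathbb R$: $(y_1,y_2,y_3,\dots)=(\alpha_1,\beta_1,\alpha_2,\beta_2,\dots)$, the coefficients in the recurrence $P_{j+1}(x)=(x-\alpha_{j+1})P_j(x)-\beta_jP_{j-1}(x)$,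 $P_0=1$, $P_1(x)=x-\alpha_1$, of the monic orthogonal polynomials with respect to the moments $m_1,m_2,\dots$ Let $\varphi_n^E:(y_1,\dots,y_n)\mapsto(m_1,\dots,m_n)$ be the inverse map, from $(0,1)^n$, $(0,\infty)^n$, or the set of $(\alpha_1,\beta_1,\alpha_2,\dots)$ with $\alpha_j\in\mathbb R$, $\beta_j>0$, respectively, onto $\operatorname{Int}\mathcal M_n(E)$. Let $V_1,V_2$ be real functions such that * $E=[a,b]$: $V_1,V_2$ are continuous on $[0,1]$ and $C^2$ on $(0,1)$; put $W_i(p)=V_i(p)-\log(p(1-p))$ on $(0,1)$; * $E=\mathbb R_+$: $V_1,V_2$ are continuous on $[0,\infty)$ and $C^2$ on $(0,\infty)$, and for some $\varepsilon>0$, $V_i(z)/\log z\ge 2+\varepsilon$ for all large $z$; put $W_i(z)=V_i(z)-\log z$ on $(0,\infty)$; * $E=\mathbb R$: $V_1\in C^2(\mathbb R)$, $V_2$ is continuous on $[0,\infty)$ and $C^2$ on $(0,\infty)$, and for some $\varepsilon>0$, $V_1(\alpha)/\log|\alpha|\ge1+\varepsilon$ and $V_2(\beta)/\log\beta\ge3+\varepsilon$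 for all large $|\alpha|$, $\beta$; put $W_1(\alpha)=V_1(\alpha)$ on $\mathbb R$ and $W_2(\beta)=V_2(\beta)-\log\beta$ on $(0,\infty)$. Assume that $W_1$ and $W_2$ have unique minimizers $y_1^*$ and $y_2^*$ on these open sets, and that $W_i''(y_i^*)\neq0$ for $i=1,2$. Then for each $n\ge1$ a probability measure on $\mathcal M_n(E)$, carried by its interior, is defined by the Lebesgue density $$\frac1{Z_n}\exp\Big[-n\sum_{1\le j\le n,\ j\text{ odd}}V_1(y_j)-n\sum_{1\le j\le n,\ j\text{ even}}V_2(y_j)\Big].$$ Let $m^{(n)}=(m_1^{(n)},\dots,m_n^{(n)})$ be a random vector with this law. Let $m_j^*$ be the $j$-th moment of the following probability measure $\mu\in\mathcal P(E)$, where $(t)_+=\max(t,0)$: * $E=[a,b]$, with $p_i=y_i^*$, $q_i=1-p_i$, $l_\pm=a+(b-a)(\sqrt{p_1q_2}\pm\sqrt{p_2q_1})^2$: $$\mu(dx)=\frac{\sqrt{(x-l_-)(l_+-x)}}{2\pi p_2(x-a)(b-x)}1_{[l_-,l_+]}(x)\,dx+\Big(1-\frac{p_1}{p_2}\Big)_+\delta_a+\Big(\frac{p_1+p_2-1}{p_2}\Big)_+\delta_b;$$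 * $E=\mathbb R_+$, with $z_i=y_i^*$, $l_\pm=(\sqrt{z_1}\pm\sqrt{z_2})^2$ (Marchenko–Pastur): $$\mu(dx)=\Big(1-\frac{z_1}{z_2}\Big)_+\delta_0+\frac{\sqrt{(x-l_-)(l_+-x)}}{2\pi z_2x}1_{[l_-,l_+]}(x)\,dx;$$ * $E=\mathbb R$, with $\alpha=y_1^*$, $\beta=y_2^*$, $l_\pm=\alpha\pm2\sqrt\beta$ (semicircle): $$\mu(dx)=\frac1{2\pi\beta}\sqrt{(x-l_-)(l_+-x)}\,1_{[l_-,l_+]}(x)\,dx.$$ Then for every $k\ge1$ the map $\varphi_k^E$ is differentiable at $\vec y^*=(y_1^*,y_2^*,y_1^*,\dots)\in\mathbb R^k$ and, as $n\to\infty$, $$\sqrt n\,\big((m_1^{(n)},\dots,m_k^{(n)})-(m_1^*,\dots,m_k^*)\big)\xrightarrow{d}\mathcal N(0,\Sigma_k),$$ $$\Sigma_k=D\varphi_k^E(\vec y^*)\,\operatorname{diag}\big(W_1''(y_1^*),W_2''(y_2^*),W_1''(y_1^*),\dots\big)^{-1}\,D\varphi_k^E(\vec y^*)^t,$$ where the diagonal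 matrix has size $k\times k$, it is invertible, $\Sigma_k$ is positive semidefinite, and $(D\varphi_k^E)_{i,j}=\partial m_i/\partial y_j$. In the case $E=\mathbb R_+$ and $y_1^*=y_2^*=z$, moreover, for $1\le i,j\le k$, $$\big(D\varphi_k^{\mathbb R_+}(\vec y^*)\big)_{i,j}=z^{i-1}\left(\binom{2i}{i-j}-\binom{2i}{i-j-1}\right),$$ with $\binom nr=0$ for $r<0$. -/

import Mathlib

open MeasureTheory ProbabilityTheory Filter Topology Set
open scoped Polynomial

noncomputable section

/-! # Moment spaces -/

/-- `𝒫(E)`: Borel probability measures carried by `E ⊆ ℝ` with finite moments of all orders. -/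
def momentMeasures (E : Set ℝ) : Set (Measure ℝ) :=
  {μ | IsProbabilityMeasure μ ∧ μ Eᶜ = 0 ∧ ∀ j : ℕ, Integrable (fun x : ℝ => x ^ j) μ}

/-- The `j`-th moment `m_j(μ) = ∫ x ^ j dμ(x)`. -/
def rawMoment (μ : Measure ℝ) (j : ℕ) : ℝ := ∫ x, x ^ j ∂μ

/-- `ℳ_n(E) = {(m_1(μ), …, m_n(μ)) : μ ∈ 𝒫(E)}`. The entry with index `i : Fin n` is the moment of
order `i + 1`; the same shift of indices is used for all vectors below. -/
def momentSpace (E : Set ℝ) (n : ℕ) : Set (Fin n → ℝ) :=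
  {m | ∃ μ ∈ momentMeasures E, ∀ i : Fin n, m i = rawMoment μ (i + 1)}

/-- The possible values of the next moment of order `i + 1`, among the measures in `𝒫(E)` whose
moments of order `1, …, i` are the first `i` entries of `m`. -/
def momentSection (E : Set ℝ) {n : ℕ} (m : Fin n → ℝ) (i : Fin n) : Set ℝ :=
  {x | ∃ μ ∈ momentMeasures E, (∀ l : Fin n, l < i → rawMoment μ (l + 1) = m l) ∧
    rawMoment μ (i + 1) = x}

/-- The lower end point `m_{i+1}^-` of the section of possible values. -/
def lowerMoment (E : Set ℝ) {n : ℕ} (m : Fin n → ℝ) (i : Fin n) : ℝ := sInf (momentSection E m i)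

/-- The upper end point `m_{i+1}^+` of the section of possible values. -/
def upperMoment (E : Set ℝ) {n : ℕ} (m : Fin n → ℝ) (i : Fin n) : ℝ := sSup (momentSection E m i)

/-! # Coordinates on the moment spaces -/

/-- Canonical moments on `[a, b]`: `p_j = (m_j - m_j^-) / (m_j^+ - m_j^-)`. -/
def intervalCoord (a b : ℝ) {n : ℕ} (m : Fin n → ℝ) (i : Fin n) : ℝ :=
  (m i - lowerMoment (Icc a b) m i) /
    (upperMoment (Icc a b) m i - lowerMoment (Icc a b) m i)

/-- Canonical moments on `[0, ∞)`: `z_j = (m_j - m_j^-) / (m_{j-1} - m_{j-1}^-)`, where `m_0 = 1`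
and `m_0^- = 0`. -/
def halfLineCoord {n : ℕ} (m : Fin n → ℝ) (i : Fin n) : ℝ :=
  (m i - lowerMoment (Ici 0) m i) /
    (if h : (i : ℕ) = 0 then 1 else
      m ⟨i - 1, by omega⟩ - lowerMoment (Ici 0) m ⟨i - 1, by omega⟩)

/-- Integration of a polynomial against a measure with moments `1, m_1, …, m_n`: the linear
functional with `1 ↦ 1` and `X ^ j ↦ m_j`. (Orders beyond `n` are sent to `0`; only polynomials of
degree at most `n` are integrated in the coordinates below.) -/
def momentFunctional {n : ℕ} (m : Fin n → ℝ) (q : ℝ[X]) : ℝ :=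
  q.sum fun j c => c * (if j = 0 then 1 else if h : j - 1 < n then m ⟨j - 1, h⟩ else 0)

/-- The monic orthogonal polynomials of the functional `L`, by their three-term recurrence
`P_{j+1} = (X - α_{j+1}) P_j - β_j P_{j-1}`, `P_0 = 1`, `P_1 = X - α_1`, in which
`α_{j+1} = L(X P_j²) / L(P_j²)` and `β_j = L(P_j²) / L(P_{j-1}²)` are the only values that make
`P_{j+1}` orthogonal to `P_j` and `P_{j-1}` (and then to all polynomials of degree at most `j`). -/
def orthoPoly (L : ℝ[X] → ℝ) : ℕ → ℝ[X]
  | 0 => 1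
  | 1 => Polynomial.X - Polynomial.C (L Polynomial.X / L 1)
  | j + 2 =>
      (Polynomial.X - Polynomial.C
        (L (Polynomial.X * orthoPoly L (j + 1) ^ 2) / L (orthoPoly L (j + 1) ^ 2))) *
          orthoPoly L (j + 1) -
        Polynomial.C (L (orthoPoly L (j + 1) ^ 2) / L (orthoPoly L j ^ 2)) * orthoPoly L j

/-- The recurrence coefficient `α_{j+1}`. -/
def recAlpha (L : ℝ[X] → ℝ) (j : ℕ) : ℝ :=
  L (Polynomial.X * orthoPoly L j ^ 2) / L (orthoPoly L j ^ 2)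

/-- The recurrence coefficient `β_{j+1}`. -/
def recBeta (L : ℝ[X] → ℝ) (j : ℕ) : ℝ :=
  L (orthoPoly L (j + 1) ^ 2) / L (orthoPoly L j ^ 2)

/-- Coordinates on the moment space of `ℝ`: the vector `(α_1, β_1, α_2, β_2, …)` of the first `n`
recurrence coefficients. -/
def lineCoord {n : ℕ} (m : Fin n → ℝ) (i : Fin n) : ℝ :=
  if Even (i : ℕ) then recAlpha (momentFunctional m) (i / 2)
  else recBeta (momentFunctional m) (i / 2)

/-! # The three limiting measures -/

/-- Free binomial (Kesten-McKay) distribution on `[a, b]` with parameters `p₁`, `p₂`. -/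
def freeBinomial (a b p₁ p₂ : ℝ) : Measure ℝ :=
  let lo := a + (b - a) * (√(p₁ * (1 - p₂)) - √(p₂ * (1 - p₁))) ^ 2
  let hi := a + (b - a) * (√(p₁ * (1 - p₂)) + √(p₂ * (1 - p₁))) ^ 2
  (volume.restrict (Icc lo hi)).withDensity (fun x =>
      ENNReal.ofReal (√((x - lo) * (hi - x)) / (2 * Real.pi * p₂ * (x - a) * (b - x)))) +
    ENNReal.ofReal (1 - p₁ / p₂) • Measure.dirac a +
    ENNReal.ofReal ((p₁ + p₂ - 1) / p₂) • Measure.dirac b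

/-- Marchenko-Pastur distribution with parameters `z₁`, `z₂`. -/
def marchenkoPastur (z₁ z₂ : ℝ) : Measure ℝ :=
  let lo := (√z₁ - √z₂) ^ 2
  let hi := (√z₁ + √z₂) ^ 2
  ENNReal.ofReal (1 - z₁ / z₂) • Measure.dirac 0 +
    (volume.restrict (Icc lo hi)).withDensity (fun x =>
      ENNReal.ofReal (1 / (2 * Real.pi * z₂) * (√((x - lo) * (hi - x)) / x)))

/-- Semicircle distribution with mean `α` and variance `β`. -/
def semicircle (α β : ℝ) : Measure ℝ :=
  let lo := α - 2 * √β
  let hi := α + 2 * √β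
  (volume.restrict (Icc lo hi)).withDensity (fun x =>
    ENNReal.ofReal (1 / (2 * Real.pi * β) * √((x - lo) * (hi - x))))

/-! # The three settings -/

/-- The three cases `E = [a, b]` with `a < b`, `E = [0, ∞)` and `E = ℝ`. -/
inductive MomentDomain where
  | interval (a b : ℝ) (hab : a < b) : MomentDomain
  | halfLine : MomentDomain
  | line : MomentDomain

namespace MomentDomain

/-- The set `E`. -/
def carrier : MomentDomain → Set ℝ
  | interval a b _ => Icc a b
  | halfLine => Ici 0
  | line => univ

/-- The coordinates `(y_1, …, y_n)` of a moment vector: canonical moments or recurrence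
coefficients. -/
def coord : MomentDomain → {n : ℕ} → (Fin n → ℝ) → Fin n → ℝ
  | interval a b _, _, m => intervalCoord a b m
  | halfLine, _, m => halfLineCoord m
  | line, _, m => lineCoord m

/-- The map `φ_n^E` from coordinates to moments, inverse to the coordinate map on the interior of
the moment space. -/
def phi (E : MomentDomain) (n : ℕ) : (Fin n → ℝ) → (Fin n → ℝ) :=
  Function.invFunOn E.coord (interior (momentSpace E.carrier n))

/-- The open range of the coordinates of odd order `y_1, y_3, …`. -/
def range₁ : MomentDomain → Set ℝ
  | interval _ _ _ => Ioo 0 1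
  | halfLine => Ioi 0
  | line => univ

/-- The open range of the coordinates of even order `y_2, y_4, …`. -/
def range₂ : MomentDomain → Set ℝ
  | interval _ _ _ => Ioo 0 1
  | halfLine => Ioi 0
  | line => Ioi 0

/-- The regularity and growth assumptions on the potentials `V₁`, `V₂`. -/
def Admissible (V₁ V₂ : ℝ → ℝ) : MomentDomain → Prop
  | interval _ _ _ =>
      (ContinuousOn V₁ (Icc 0 1) ∧ ContDiffOn ℝ 2 V₁ (Ioo 0 1)) ∧
      (ContinuousOn V₂ (Icc 0 1) ∧ ContDiffOn ℝ 2 V₂ (Ioo 0 1))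
  | halfLine =>
      (ContinuousOn V₁ (Ici 0) ∧ ContDiffOn ℝ 2 V₁ (Ioi 0)) ∧
      (ContinuousOn V₂ (Ici 0) ∧ ContDiffOn ℝ 2 V₂ (Ioi 0)) ∧
      ∃ ε : ℝ, 0 < ε ∧ ∃ R : ℝ, ∀ z ≥ R,
        2 + ε ≤ V₁ z / Real.log z ∧ 2 + ε ≤ V₂ z / Real.log z
  | line =>
      ContDiff ℝ 2 V₁ ∧
      (ContinuousOn V₂ (Ici 0) ∧ ContDiffOn ℝ 2 V₂ (Ioi 0)) ∧
      ∃ ε : ℝ, 0 < ε ∧ ∃ R : ℝ, (∀ α : ℝ, R ≤ |α| → 1 + ε ≤ V₁ α / Real.log |α|) ∧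
        ∀ β ≥ R, 3 + ε ≤ V₂ β / Real.log β

/-- The function `W₁` belonging to the potential `V`. -/
def W₁ (V : ℝ → ℝ) : MomentDomain → ℝ → ℝ
  | interval _ _ _ => fun p => V p - Real.log (p * (1 - p))
  | halfLine => fun z => V z - Real.log z
  | line => V

/-- The function `W₂` belonging to the potential `V`. -/
def W₂ (V : ℝ → ℝ) : MomentDomain → ℝ → ℝ
  | interval _ _ _ => fun p => V p - Real.log (p * (1 - p))
  | halfLine => fun z => V z - Real.log z
  | line => fun β => V β - Real.log β

/-- The probability measure `ℙ_{n,E,V₁,V₂}`: it is carried by the interior of the moment space,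
with Lebesgue density `Z⁻¹ exp(-n ∑_{j odd} V₁(y_j) - n ∑_{j even} V₂(y_j))`. -/
def momentLaw (E : MomentDomain) (V₁ V₂ : ℝ → ℝ) (n : ℕ) : Measure (Fin n → ℝ) :=
  let ν : Measure (Fin n → ℝ) :=
    (volume.restrict (interior (momentSpace E.carrier n))).withDensity fun m =>
      ENNReal.ofReal (Real.exp
        (-(n : ℝ) * ∑ i : Fin n, if Even (i : ℕ) then V₁ (E.coord m i) else V₂ (E.coord m i)))
  (ν univ)⁻¹ • ν

/-- The measure whose moments are the limiting moments `m_j^*`. -/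
def limitMeasure (y₁ y₂ : ℝ) : MomentDomain → Measure ℝ
  | interval a b _ => freeBinomial a b y₁ y₂
  | halfLine => marchenkoPastur y₁ y₂
  | line => semicircle y₁ y₂

end MomentDomain

/-! # Notions used in the central limit theorem -/

/-- `y` is the unique minimizer of `W` on `D`. -/
def IsUniqueMinimizerOn (W : ℝ → ℝ) (D : Set ℝ) (y : ℝ) : Prop :=
  y ∈ D ∧ ∀ x ∈ D, x ≠ y → W y < W x

/-- The vector `(c₁, c₂, c₁, c₂, …)` of length `k`. -/
def alternating (k : ℕ) (c₁ c₂ : ℝ) : Fin k → ℝ := fun i => if Even (i : ℕ) then c₁ else c₂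

/-- The Jacobian matrix `(∂f_i / ∂y_j)_{i,j}` of `f` at `y`. -/
def jacobian {k : ℕ} (f : (Fin k → ℝ) → (Fin k → ℝ)) (y : Fin k → ℝ) : Matrix (Fin k) (Fin k) ℝ :=
  LinearMap.toMatrix' (fderiv ℝ f y).toLinearMap

/-- `√n ((m_1, …, m_k) - (c_1, …, c_k))` for a vector `m` of length `n ≥ k`. (For `n < k` the
missing entries are set to `0`, which is immaterial as `n → ∞`.) -/
def scaledDeviation (k : ℕ) (c : ℕ → ℝ) {n : ℕ} (m : Fin n → ℝ) : EuclideanSpace ℝ (Fin k) :=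
  WithLp.toLp 2 fun i : Fin k =>
    if h : (i : ℕ) < n then √(n : ℝ) * (m ⟨i, h⟩ - c (i + 1)) else 0

/-- The binomial coefficient `n` over `r` for an integer `r`, equal to `0` when `r < 0`. -/
def binomInt (n : ℕ) (r : ℤ) : ℝ := if 0 ≤ r then (n.choose r.toNat : ℝ) else 0

end

/-! All three cases rest on one combinatorial object. Expanding `X ^ n` in monic orthogonal
polynomials produces `catalanMatrix`, whose column 0 lists the moments as sums over lattice paths
weighted by the recurrence coefficients. A measure on the half-line is the image under squaring of a
symmetric measure on the line, with diagonal coefficients 0 and off-diagonal coefficients `z_l`; on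
an interval, after an affine map to `[0, 1]`, one has `z_l = (1 - p_{l-1}) p_l`. So the moments are
polynomials in the coordinates. Counting from 0, the moment of order `i + 1` depends on `y_0, …,
y_i` only, and is affine in `y_i` with slope a constant times `∏_{l < i} w_l(y_l)`, where the weight
`w` is `x (1 - x)`, `x`, or alternately `1` and `x` (`MomentDomain.moment_congr_and_sub`).

Gauss quadrature with the Jacobi matrix realizes every point of the open box of coordinates by a
measure (`exists_momentMeasures_eq`). Conversely, positivity of `L (q²)`, and on the interval also
of `L ((1 - X) q²)`, keeps the next coordinate in the closed range (`exists_moment_eq`). Hence the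
extremal moments are the values of the affine function at the ends of the range, the coordinates
defined in the statement invert the polynomial map (`coord_eq`), the interior of the moment space is
the image of the open box (`interior_momentSpace`), and `phi` is the polynomial map there.

The Jacobian is triangular with determinant a constant times `∏ w_l(y_l) ^ (n - 1 - l)`, so the law
of the moments is the image of a product measure (`Admissible.momentLaw_eq`). The factor of `y_l`
has density proportional to `exp(-n V) w ^ (n - 1 - l) = exp(-n W) w ^ (-(l + 1))` with `W = V - log
w`: an exponent with a nondegenerate minimum and an amplitude free of `n`. Laplace's method gives
`√n (y_l - y_l*) → N(0, 1 / W''(y_l*))` (`LaplaceData.tendsto_map`). Independence makes the first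
`k` coordinates converge jointly, and the delta method carries this through the polynomial map to
the first `k` moments.

It remains to see that the moments at the coordinates `(y₁, y₂, y₁, …)` are those of the stated
measures. Contracting pairs of steps makes the recurrence coefficients constant, up to the first
diagonal one on the interval. Accordingly `x μ(dx)` on the half-line and `x (1 - x) μ(dx)` on `[0,
1]` are multiples of semicircle laws, whose moments follow from orthogonality of Chebyshev
polynomials. The lowest moments, including the atoms, come from an explicit integral. The half-line
Jacobian at a constant point is a derivative of weighted Dyck path counts, which are ballot numbers.
-/

noncomputable section

/-! # Jacobi parameters and moment functionals -/

/-- The coefficient of `P_j` in the expansion of `X ^ n` in the monic orthogonal polynomials with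
recurrence coefficients `a`, `b`. -/
def catalanMatrix (a b : ℕ → ℝ) : ℕ → ℕ → ℝ
  | 0, j => if j = 0 then 1 else 0
  | n + 1, 0 => a 0 * catalanMatrix a b n 0 + b 0 * catalanMatrix a b n 1
  | n + 1, j + 1 => catalanMatrix a b n j + a (j + 1) * catalanMatrix a b n (j + 1) +
      b (j + 1) * catalanMatrix a b n (j + 2)

/-- The monic polynomials with recurrence coefficients `a`, `b`. -/
def jacobiPoly (a b : ℕ → ℝ) : ℕ → ℝ[X]
  | 0 => 1
  | 1 => Polynomial.X - Polynomial.C (a 0)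
  | j + 2 => (Polynomial.X - Polynomial.C (a (j + 1))) * jacobiPoly a b (j + 1) -
      Polynomial.C (b j) * jacobiPoly a b j

/-- The linear functional on polynomials with moment sequence `m`. -/
def functionalOfMoments (m : ℕ → ℝ) : ℝ[X] →ₗ[ℝ] ℝ :=
  Polynomial.lsum fun n => m n • LinearMap.id

@[simp] lemma functionalOfMoments_X_pow (m : ℕ → ℝ) (n : ℕ) :
    functionalOfMoments m (Polynomial.X ^ n) = m n := by
  rw [functionalOfMoments, Polynomial.lsum_apply, Polynomial.X_pow_eq_monomial,
    Polynomial.sum_monomial_index] <;> simp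

section Jacobi

variable {a b : ℕ → ℝ}

lemma catalanMatrix_of_lt {n j : ℕ} (h : n < j) : catalanMatrix a b n j = 0 := by
  induction n generalizing j with
  | zero => simp [catalanMatrix, Nat.pos_iff_ne_zero.1 h]
  | succ n ih =>
    obtain ⟨j, rfl⟩ : ∃ k, j = k + 1 := ⟨j - 1, by omega⟩
    simp [catalanMatrix, ih (show n < j by omega), ih (show n < j + 1 by omega),
      ih (show n < j + 2 by omega)]

@[simp] lemma catalanMatrix_self (n : ℕ) : catalanMatrix a b n n = 1 := by
  induction n with
  | zero => simp [catalanMatrix]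
  | succ n ih => simp [catalanMatrix, ih, catalanMatrix_of_lt]

lemma monic_jacobiPoly_and_natDegree (a b : ℕ → ℝ) (j : ℕ) :
    (jacobiPoly a b j).Monic ∧ (jacobiPoly a b j).natDegree = j := by
  induction j using Nat.twoStepInduction with
  | zero => simp [jacobiPoly]
  | one => exact ⟨Polynomial.monic_X_sub_C _, Polynomial.natDegree_X_sub_C _⟩
  | more j h0 h1 =>
    have hm : ((Polynomial.X - Polynomial.C (a (j + 1))) * jacobiPoly a b (j + 1)).Monic :=
      (Polynomial.monic_X_sub_C _).mul h1.1
    have hd : ((Polynomial.X - Polynomial.C (a (j + 1))) * jacobiPoly a b (j + 1)).natDegree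
        = j + 2 := by
      rw [(Polynomial.monic_X_sub_C _).natDegree_mul h1.1, h1.2, Polynomial.natDegree_X_sub_C]
      omega
    have hlt : (Polynomial.C (b j) * jacobiPoly a b j).natDegree <
        ((Polynomial.X - Polynomial.C (a (j + 1))) * jacobiPoly a b (j + 1)).natDegree := by
      rw [hd]
      exact (Polynomial.natDegree_C_mul_le _ _).trans_lt (by omega)
    exact ⟨hm.sub_of_left (Polynomial.degree_lt_degree hlt), by
      rw [jacobiPoly, Polynomial.natDegree_sub_eq_left_of_natDegree_lt hlt, hd]⟩

lemma monic_jacobiPoly (a b : ℕ → ℝ) (j : ℕ) : (jacobiPoly a b j).Monic :=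
  (monic_jacobiPoly_and_natDegree a b j).1

@[simp] lemma natDegree_jacobiPoly (a b : ℕ → ℝ) (j : ℕ) : (jacobiPoly a b j).natDegree = j :=
  (monic_jacobiPoly_and_natDegree a b j).2

lemma coeff_jacobiPoly_self (a b : ℕ → ℝ) (j : ℕ) : (jacobiPoly a b j).coeff j = 1 := by
  have := (monic_jacobiPoly a b j).coeff_natDegree
  rwa [natDegree_jacobiPoly] at this

lemma jacobiPoly_congr {a' b' : ℕ → ℝ} {j : ℕ} (ha : ∀ l < j, a l = a' l)
    (hb : ∀ l, l + 1 < j → b l = b' l) : jacobiPoly a b j = jacobiPoly a' b' j := by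
  induction j using Nat.twoStepInduction with
  | zero => rfl
  | one => simp [jacobiPoly, ha]
  | more j h0 h1 =>
    rw [jacobiPoly, jacobiPoly, h0 (fun l hl => ha l (by omega)) (fun l hl => hb l (by omega)),
      h1 (fun l hl => ha l (by omega)) (fun l hl => hb l (by omega)), ha (j + 1) (by omega),
      hb j (by omega)]

lemma map_C_mul (L : ℝ[X] →ₗ[ℝ] ℝ) (c : ℝ) (q : ℝ[X]) : L (Polynomial.C c * q) = c * L q := by
  rw [← Polynomial.smul_eq_C_mul, map_smul, smul_eq_mul]

/-- The three-term recurrence lowers `j` at the price of raising `m`, and the columns of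
`catalanMatrix`, multiplied by the products of `b`, satisfy the same relation; so column 0
determines all values. The degree `m + j` never grows in this reduction, hence moments up to `N`
suffice. -/
lemma map_X_pow_mul_jacobiPoly {L : ℝ[X] →ₗ[ℝ] ℝ} {N : ℕ}
    (hL : ∀ m ≤ N, L (Polynomial.X ^ m) = catalanMatrix a b m 0) {j m : ℕ} (h : m + j ≤ N) :
    L (Polynomial.X ^ m * jacobiPoly a b j) =
      (∏ l ∈ Finset.range j, b l) * catalanMatrix a b m j := by
  induction j using Nat.twoStepInduction generalizing m with
  | zero => simp [jacobiPoly, hL m (by omega)]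
  | one =>
    have e : Polynomial.X ^ m * jacobiPoly a b 1 =
        Polynomial.X ^ (m + 1) - Polynomial.C (a 0) * Polynomial.X ^ m := by
      rw [jacobiPoly]; ring
    rw [e, map_sub, map_C_mul, hL _ h, hL _ (by omega)]
    simp [catalanMatrix]
  | more j h0 h1 =>
    have e : Polynomial.X ^ m * jacobiPoly a b (j + 2) =
        Polynomial.X ^ (m + 1) * jacobiPoly a b (j + 1) -
          Polynomial.C (a (j + 1)) * (Polynomial.X ^ m * jacobiPoly a b (j + 1)) -
          Polynomial.C (b j) * (Polynomial.X ^ m * jacobiPoly a b j) := by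
      rw [jacobiPoly]; ring
    rw [e, map_sub, map_sub, map_C_mul, map_C_mul, h1 (by omega), h1 (by omega), h0 (by omega)]
    simp only [catalanMatrix, Finset.prod_range_succ]
    ring

/-- This is orthogonality: `catalanMatrix` vanishes above the diagonal, so only the coefficient of
`X ^ j` in `q` contributes. -/
lemma map_mul_jacobiPoly {L : ℝ[X] →ₗ[ℝ] ℝ} {N : ℕ}
    (hL : ∀ m ≤ N, L (Polynomial.X ^ m) = catalanMatrix a b m 0) {j : ℕ} {q : ℝ[X]}
    (hq : q.natDegree ≤ j) (h : q.natDegree + j ≤ N) :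
    L (q * jacobiPoly a b j) = q.coeff j * ∏ l ∈ Finset.range j, b l := by
  conv_lhs => rw [q.as_sum_range_C_mul_X_pow, Finset.sum_mul, map_sum]
  have : ∀ m ∈ Finset.range (q.natDegree + 1),
      L (Polynomial.C (q.coeff m) * Polynomial.X ^ m * jacobiPoly a b j) =
        if m = j then q.coeff j * ∏ l ∈ Finset.range j, b l else 0 := by
    intro m hm
    have hm' := Finset.mem_range.1 hm
    rw [mul_assoc, map_C_mul, map_X_pow_mul_jacobiPoly hL (by omega)]
    split_ifs with hmj
    · subst hmj; simp
    · rw [catalanMatrix_of_lt (by omega)]; ring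
  rw [Finset.sum_congr rfl this, Finset.sum_ite_eq']
  split_ifs with hj
  · rfl
  · rw [Polynomial.coeff_eq_zero_of_natDegree_lt (by simpa using hj), zero_mul]

lemma map_jacobiPoly_sq {L : ℝ[X] →ₗ[ℝ] ℝ} {N : ℕ}
    (hL : ∀ m ≤ N, L (Polynomial.X ^ m) = catalanMatrix a b m 0) {j : ℕ} (h : 2 * j ≤ N) :
    L (jacobiPoly a b j ^ 2) = ∏ l ∈ Finset.range j, b l := by
  rw [sq, map_mul_jacobiPoly hL (by simp) (by simp; omega), coeff_jacobiPoly_self, one_mul]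

lemma map_jacobiPoly_mul_succ {L : ℝ[X] →ₗ[ℝ] ℝ} {N : ℕ}
    (hL : ∀ m ≤ N, L (Polynomial.X ^ m) = catalanMatrix a b m 0) {j : ℕ} (h : 2 * j + 1 ≤ N) :
    L (jacobiPoly a b j * jacobiPoly a b (j + 1)) = 0 := by
  rw [map_mul_jacobiPoly hL (by simp) (by simp; omega),
    Polynomial.coeff_eq_zero_of_natDegree_lt (by simp), zero_mul]

lemma map_X_mul_jacobiPoly_sq {L : ℝ[X] →ₗ[ℝ] ℝ} {N : ℕ}
    (hL : ∀ m ≤ N, L (Polynomial.X ^ m) = catalanMatrix a b m 0) {j : ℕ} (h : 2 * j + 1 ≤ N) :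
    L (Polynomial.X * jacobiPoly a b j ^ 2) = a j * ∏ l ∈ Finset.range j, b l := by
  cases j with
  | zero =>
    have := hL 1 h
    rw [pow_one] at this
    simp [jacobiPoly, this, catalanMatrix]
  | succ j =>
    -- The recurrence for `X P_{j+1}`; the terms with the neighbours `P_{j+2}` and `P_j` are killed
    -- by orthogonality.
    have e : Polynomial.X * jacobiPoly a b (j + 1) ^ 2 =
        jacobiPoly a b (j + 1) * jacobiPoly a b (j + 2) +
          Polynomial.C (a (j + 1)) * jacobiPoly a b (j + 1) ^ 2 +
          Polynomial.C (b j) * (jacobiPoly a b j * jacobiPoly a b (j + 1)) := by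
      rw [jacobiPoly]; ring
    rw [e, map_add, map_add, map_C_mul, map_C_mul, map_jacobiPoly_mul_succ hL (by omega),
      map_jacobiPoly_mul_succ hL (by omega), map_jacobiPoly_sq hL (by omega)]
    ring

/-- Functionals with the same moments up to order `N` differ on monic polynomials of degree
`N + 1` only by their moments of order `N + 1`. -/
lemma map_sub_map_of_monic {L L' : ℝ[X] →ₗ[ℝ] ℝ} {N : ℕ}
    (h : ∀ m ≤ N, L (Polynomial.X ^ m) = L' (Polynomial.X ^ m)) {q : ℝ[X]} (hq : q.Monic)
    (hd : q.natDegree = N + 1) :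
    L q - L' q = L (Polynomial.X ^ (N + 1)) - L' (Polynomial.X ^ (N + 1)) := by
  have e := hq.as_sum
  rw [hd] at e
  rw [e, map_add, map_add, map_sum, map_sum]
  have : ∀ m ∈ Finset.range (N + 1), L (Polynomial.C (q.coeff m) * Polynomial.X ^ m) =
      L' (Polynomial.C (q.coeff m) * Polynomial.X ^ m) := by
    intro m hm
    rw [map_C_mul, map_C_mul, h m (by have := Finset.mem_range.1 hm; omega)]
  rw [Finset.sum_congr rfl this]
  ring

/-- Compare `L` with the functional whose moments are all given by `catalanMatrix`. Since `X P_j²`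
is monic of degree `2j + 1`, the two functionals differ on it exactly as on `X ^ (2j + 1)`. The even
case uses `P_{j+1}²` in the same way. -/
lemma map_X_pow_sub_catalanMatrix_odd {L : ℝ[X] →ₗ[ℝ] ℝ} {j : ℕ}
    (hL : ∀ m ≤ 2 * j, L (Polynomial.X ^ m) = catalanMatrix a b m 0) :
    L (Polynomial.X ^ (2 * j + 1)) - catalanMatrix a b (2 * j + 1) 0 =
      L (Polynomial.X * jacobiPoly a b j ^ 2) - a j * ∏ l ∈ Finset.range j, b l := by
  set L' := functionalOfMoments fun n => catalanMatrix a b n 0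
  have hL' : ∀ m, L' (Polynomial.X ^ m) = catalanMatrix a b m 0 := fun m => by simp [L']
  have hm := monic_jacobiPoly a b j
  rw [← map_X_mul_jacobiPoly_sq (N := 2 * j + 1) (L := L') (fun m _ => hL' m) le_rfl, ← hL',
    map_sub_map_of_monic (fun m hm => (hL m hm).trans (hL' m).symm)
      (Polynomial.monic_X.mul (hm.pow 2))]
  rw [Polynomial.natDegree_X_mul (hm.pow 2).ne_zero, hm.natDegree_pow, natDegree_jacobiPoly]

lemma map_X_pow_sub_catalanMatrix_even {L : ℝ[X] →ₗ[ℝ] ℝ} {j : ℕ}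
    (hL : ∀ m ≤ 2 * j + 1, L (Polynomial.X ^ m) = catalanMatrix a b m 0) :
    L (Polynomial.X ^ (2 * j + 2)) - catalanMatrix a b (2 * j + 2) 0 =
      L (jacobiPoly a b (j + 1) ^ 2) - ∏ l ∈ Finset.range (j + 1), b l := by
  set L' := functionalOfMoments fun n => catalanMatrix a b n 0
  have hL' : ∀ m, L' (Polynomial.X ^ m) = catalanMatrix a b m 0 := fun m => by simp [L']
  have hm := monic_jacobiPoly a b (j + 1)
  rw [← map_jacobiPoly_sq (N := 2 * (j + 1)) (L := L') (fun m _ => hL' m) le_rfl, ← hL',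
    map_sub_map_of_monic (fun m hm => (hL m hm).trans (hL' m).symm) (hm.pow 2)]
  rw [hm.natDegree_pow, natDegree_jacobiPoly]; ring

end Jacobi

/-! # Moments in terms of the interleaved recurrence coefficients -/

/-- The moments of order `m` with recurrence coefficients `(α_1, β_1, α_2, β_2, …) = y`. -/
def lineMoment (y : ℕ → ℝ) (m : ℕ) : ℝ :=
  catalanMatrix (fun j => y (2 * j)) (fun j => y (2 * j + 1)) m 0

/-- The monic orthogonal polynomials with recurrence coefficients `(α_1, β_1, α_2, β_2, …) = y`. -/
def linePoly (y : ℕ → ℝ) (j : ℕ) : ℝ[X] :=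
  jacobiPoly (fun j => y (2 * j)) (fun j => y (2 * j + 1)) j

/-- The squared norm of `P_j`. -/
def lineNorm (y : ℕ → ℝ) (j : ℕ) : ℝ := ∏ l ∈ Finset.range j, y (2 * l + 1)

lemma lineNorm_congr {y y' : ℕ → ℝ} {j : ℕ} (h : ∀ l < 2 * j, y' l = y l) :
    lineNorm y' j = lineNorm y j :=
  Finset.prod_congr rfl fun l hl => h _ (by have := Finset.mem_range.1 hl; omega)

lemma linePoly_congr {y y' : ℕ → ℝ} {j : ℕ} (h : ∀ l, l + 1 < 2 * j → y' l = y l) :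
    linePoly y' j = linePoly y j :=
  jacobiPoly_congr (fun l hl => h _ (by omega)) (fun l hl => h _ (by omega))

/-- The moment of order `i + 1` is an affine function of the `i`-th coordinate. -/
lemma lineMoment_congr_and_sub {y y' : ℕ → ℝ} {i : ℕ} (h : ∀ l < i, y' l = y l) :
    (∀ m ≤ i, lineMoment y' m = lineMoment y m) ∧
    lineMoment y' (i + 1) - lineMoment y (i + 1) = lineNorm y (i / 2) * (y' i - y i) := by
  -- The comparison polynomial involves only coordinates below `i`, so it is the same for `y` and
  -- `y'`; under the functional of `y'` it takes the value `y' i` times the common norm. The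
  -- equality of the lower moments is a hypothesis here because its own proof, by induction, calls
  -- this step.
  have step : ∀ i, (∀ l < i, y' l = y l) → (∀ m ≤ i, lineMoment y' m = lineMoment y m) →
      lineMoment y' (i + 1) - lineMoment y (i + 1) = lineNorm y (i / 2) * (y' i - y i) := by
    intro i h hm
    set L := functionalOfMoments (lineMoment y')
    have hL : ∀ m, L (Polynomial.X ^ m) = lineMoment y' m := fun m => by simp [L]
    have hL' : ∀ m ≤ i, L (Polynomial.X ^ m) = lineMoment y m :=
      fun m hmi => (hL m).trans (hm m hmi)
    rcases Nat.even_or_odd' i with ⟨j, rfl | rfl⟩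
    · have h1 := map_X_pow_sub_catalanMatrix_odd hL'
      have h2 := map_X_mul_jacobiPoly_sq (N := 2 * j + 1) (fun m _ => hL m) le_rfl
      have h3 := linePoly_congr (j := j) fun l hl => h l (by omega)
      have h4 := lineNorm_congr (j := j) fun l hl => h l (by omega)
      have e : 2 * j / 2 = j := by omega
      simp only [lineNorm, linePoly] at h3 h4
      rw [h3, h4] at h2
      rw [h2] at h1
      rw [← hL, lineMoment, h1, e, lineNorm]
      ring
    · have h1 := map_X_pow_sub_catalanMatrix_even hL'
      have h2 := map_jacobiPoly_sq (N := 2 * (j + 1)) (fun m _ => hL m) le_rfl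
      have h3 := linePoly_congr (j := j + 1) fun l hl => h l (by omega)
      have h4 := lineNorm_congr (j := j) fun l hl => h l (by omega)
      have e : (2 * j + 1) / 2 = j := by omega
      simp only [lineNorm, linePoly] at h3 h4
      rw [h3, Finset.prod_range_succ, h4] at h2
      rw [h2, Finset.prod_range_succ] at h1
      rw [← hL, lineMoment, h1, e, lineNorm]
      ring
  have key : ∀ m ≤ i, lineMoment y' m = lineMoment y m := by
    induction i with
    | zero => intro m hm; obtain rfl : m = 0 := by omega
              simp [lineMoment, catalanMatrix]
    | succ i ih =>
      have ih' := ih fun l hl => h l (by omega)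
      intro m hm
      rcases hm.lt_or_eq with hm | rfl
      · exact ih' m (by omega)
      · have := step i (fun l hl => h l (by omega)) ih'
        rw [h i (by omega), sub_self, mul_zero] at this
        linarith
  exact ⟨key, step i h key⟩

/-! # Existence of measures with given recurrence coefficients -/

/-- The symmetric Jacobi matrix of size `N`. -/
def jacobiMatrix (a b : ℕ → ℝ) (N : ℕ) : Matrix (Fin N) (Fin N) ℝ := fun i j =>
  (if (j : ℕ) = i then a i else 0) + (if (j : ℕ) = i + 1 then √(b i) else 0) +
    if (i : ℕ) = j + 1 then √(b j) else 0

lemma isHermitian_jacobiMatrix (a b : ℕ → ℝ) (N : ℕ) : (jacobiMatrix a b N).IsHermitian := by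
  ext i j
  simp only [Matrix.conjTranspose_apply, jacobiMatrix, star_trivial]
  rcases eq_or_ne (i : ℕ) j with h | h
  · rw [h]
  · rw [if_neg h, if_neg h.symm]; ring

/-- Vectors are written as sequences vanishing at index `N`, so the truncated last row needs no case
of its own. -/
lemma jacobiMatrix_mulVec (a b : ℕ → ℝ) {N : ℕ} (u : ℕ → ℝ) (hu : u N = 0) (i : Fin N) :
    (jacobiMatrix a b N).mulVec (fun j => u j) i =
      a i * u i + √(b i) * u (i + 1) + if (i : ℕ) = 0 then 0 else √(b (i - 1)) * u (i - 1) := by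
  rw [Matrix.mulVec, dotProduct]
  simp only [jacobiMatrix]
  rw [Fin.sum_univ_eq_sum_range (fun j : ℕ => ((if j = (i : ℕ) then a i else 0) +
    (if j = (i : ℕ) + 1 then √(b i) else 0) + if (i : ℕ) = j + 1 then √(b j) else 0) * u j) N]
  simp only [add_mul, Finset.sum_add_distrib, ite_mul, zero_mul]
  rw [Finset.sum_ite_eq', Finset.sum_ite_eq', if_pos (Finset.mem_range.2 i.2)]
  congr 1
  · congr 1
    split_ifs with h
    · rfl
    · have : (i : ℕ) + 1 = N := by have := i.2; simp at h; omega
      rw [this, hu, mul_zero]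
  · split_ifs with h
    · exact Finset.sum_eq_zero fun j _ => by rw [if_neg (by omega)]
    · rw [Finset.sum_eq_single ((i : ℕ) - 1)]
      · rw [if_pos (by omega)]
      · intro j _ hj; rw [if_neg (by omega)]
      · intro hj; exact absurd (Finset.mem_range.2 (by omega)) hj

/-- Rescaling by the square roots of the squared norms turns the monic recurrence into the symmetric
one. For `m < N` the paths of length `m` from level 0 do not feel the truncation. -/
lemma jacobiMatrix_pow_mulVec (a : ℕ → ℝ) {b : ℕ → ℝ} (hb : ∀ j, 0 ≤ b j) {N m : ℕ} (hm : m < N) :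
    (jacobiMatrix a b N ^ m).mulVec (fun j => if (j : ℕ) = 0 then 1 else 0) =
      fun j : Fin N => catalanMatrix a b m j * √(∏ l ∈ Finset.range j, b l) := by
  induction m with
  | zero =>
    ext j
    rcases eq_or_ne (j : ℕ) 0 with h | h <;> simp [catalanMatrix, h]
  | succ m ih =>
    rw [pow_succ', ← Matrix.mulVec_mulVec, ih (by omega)]
    ext i
    rw [jacobiMatrix_mulVec a b
      (fun j => catalanMatrix a b m j * √(∏ l ∈ Finset.range j, b l))
      (by simp [catalanMatrix_of_lt (show m < N by omega)])]
    have hs : ∀ j, √(∏ l ∈ Finset.range (j + 1), b l) =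
        √(∏ l ∈ Finset.range j, b l) * √(b j) := fun j => by
      rw [Finset.prod_range_succ, Real.sqrt_mul (Finset.prod_nonneg fun l _ => hb l)]
    have hq : ∀ j, √(b j) * √(b j) = b j := fun j => Real.mul_self_sqrt (hb j)
    rcases h : (i : ℕ) with _ | j
    · simp only [catalanMatrix, hs, if_true, Finset.range_zero, Finset.prod_empty, Real.sqrt_one]
      linear_combination (catalanMatrix a b m 1) * hq 0
    · simp only [catalanMatrix, hs, Nat.add_sub_cancel]
      rw [if_neg (by omega)]
      linear_combination (√(∏ l ∈ Finset.range j, b l) * √(b j) * catalanMatrix a b m (j + 2)) *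
        hq (j + 1)

/-- The quadratic form of the Jacobi matrix of size `N + 1`. -/
lemma dotProduct_jacobiMatrix_mulVec (a b : ℕ → ℝ) {N : ℕ} (u : ℕ → ℝ) (hu : u (N + 1) = 0) :
    dotProduct (fun j : Fin (N + 1) => u j)
        ((jacobiMatrix a b (N + 1)).mulVec (fun j => u j)) =
      ∑ j ∈ Finset.range (N + 1), a j * u j ^ 2 +
        2 * ∑ j ∈ Finset.range N, √(b j) * u j * u (j + 1) := by
  rw [dotProduct]
  simp_rw [jacobiMatrix_mulVec a b u hu]
  rw [Fin.sum_univ_eq_sum_range (fun j : ℕ => u j * (a j * u j + √(b j) * u (j + 1) +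
    if j = 0 then 0 else √(b (j - 1)) * u (j - 1))) (N + 1)]
  simp only [mul_add, Finset.sum_add_distrib]
  have h1 : ∑ j ∈ Finset.range (N + 1), u j * (√(b j) * u (j + 1)) =
      ∑ j ∈ Finset.range N, √(b j) * u j * u (j + 1) := by
    rw [Finset.sum_range_succ, hu, mul_zero, mul_zero, add_zero]
    exact Finset.sum_congr rfl fun j _ => by ring
  have h2 : ∑ j ∈ Finset.range (N + 1),
      u j * (if j = 0 then 0 else √(b (j - 1)) * u (j - 1)) =
      ∑ j ∈ Finset.range N, √(b j) * u j * u (j + 1) := by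
    rw [Finset.sum_range_succ']
    simp only [if_true, mul_zero, add_zero, Nat.add_sub_cancel, Nat.add_eq_zero_iff, one_ne_zero,
      and_false, if_false]
    exact Finset.sum_congr rfl fun j _ => by ring
  rw [h1, h2, two_mul, add_assoc]
  congr 1
  exact Finset.sum_congr rfl fun j _ => by ring

/-- Gauss quadrature: the moments with nonnegative `b` are, up to a given order, those of a finitely
supported measure on eigenvalues of the Jacobi matrix. -/
lemma exists_quadrature (a : ℕ → ℝ) {b : ℕ → ℝ} (hb : ∀ j, 0 ≤ b j) (N : ℕ) :
    ∃ w x : Fin (N + 1) → ℝ, (∀ i, 0 ≤ w i) ∧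
      (∀ m ≤ N, ∑ i, w i * x i ^ m = catalanMatrix a b m 0) ∧
      ∀ i, ∃ u : ℕ → ℝ, ∑ j ∈ Finset.range (N + 1), u j ^ 2 = 1 ∧
        x i = ∑ j ∈ Finset.range (N + 1), a j * u j ^ 2 +
          2 * ∑ j ∈ Finset.range N, √(b j) * u j * u (j + 1) := by
  set J := jacobiMatrix a b (N + 1)
  have hJ : J.IsHermitian := isHermitian_jacobiMatrix a b (N + 1)
  set e : EuclideanSpace ℝ (Fin (N + 1)) := EuclideanSpace.single 0 1
  have hpow : ∀ (m : ℕ) (i), (J ^ m).mulVec (hJ.eigenvectorBasis i) =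
      hJ.eigenvalues i ^ m • (hJ.eigenvectorBasis i : Fin (N + 1) → ℝ) := by
    intro m i
    induction m with
    | zero => simp
    | succ m ih =>
      rw [pow_succ, ← Matrix.mulVec_mulVec, hJ.mulVec_eigenvectorBasis, Matrix.mulVec_smul, ih,
        smul_smul, pow_succ']
  have hexp : ∀ v : EuclideanSpace ℝ (Fin (N + 1)),
      v = ∑ i, inner ℝ (hJ.eigenvectorBasis i) v • hJ.eigenvectorBasis i := fun v =>
    (hJ.eigenvectorBasis.sum_repr' v).symm
  -- The spectral measure of `J` at the first basis vector: the nodes are the eigenvalues, the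
  -- weights are the squared first entries of the unit eigenvectors, and the moments are the corner
  -- entries of the powers of `J`.
  refine ⟨fun i => (hJ.eigenvectorBasis i 0) ^ 2, hJ.eigenvalues, fun i => sq_nonneg _, ?_, ?_⟩
  · intro m hm
    have h1 := jacobiMatrix_pow_mulVec a hb (Nat.lt_succ_of_le hm)
    have h2 : (fun j : Fin (N + 1) => if (j : ℕ) = 0 then (1 : ℝ) else 0) =
        ∑ i, hJ.eigenvectorBasis i 0 • (hJ.eigenvectorBasis i : Fin (N + 1) → ℝ) := by
      have h3 := congrArg (WithLp.ofLp) (hexp e)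
      rw [WithLp.ofLp_sum] at h3
      convert h3 using 1
      · ext j
        by_cases hj : (j : ℕ) = 0
        · have : j = 0 := Fin.ext hj
          simp [e, this]
        · have : j ≠ 0 := fun h => hj (by simp [h])
          simp [e, this, hj]
      · refine Finset.sum_congr rfl fun i _ => ?_
        rw [WithLp.ofLp_smul]
        congr 1
        simp [e, EuclideanSpace.inner_single_right]
    rw [h2, Matrix.mulVec_sum] at h1
    have h4 := congrFun h1 0
    simp only [Matrix.mulVec_smul] at h4
    simp_rw [show ∀ i, (jacobiMatrix a b (N + 1) ^ m).mulVec (hJ.eigenvectorBasis i) =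
      hJ.eigenvalues i ^ m • (hJ.eigenvectorBasis i : Fin (N + 1) → ℝ) from hpow m] at h4
    simp only [Finset.sum_apply, Pi.smul_apply, smul_eq_mul, Fin.val_zero, Finset.range_zero,
      Finset.prod_empty, Real.sqrt_one, mul_one] at h4
    rw [← h4]
    exact Finset.sum_congr rfl fun i _ => by ring
  · intro i
    set v := hJ.eigenvectorBasis i
    -- An eigenvalue is the value of the quadratic form at its unit eigenvector, extended here by
    -- zero beyond the matrix.
    let u : ℕ → ℝ := fun j => if h : j < N + 1 then v ⟨j, h⟩ else 0
    have huv : (v : Fin (N + 1) → ℝ) = fun j : Fin (N + 1) => u j := by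
      ext j; simp only [u, dif_pos j.2, Fin.eta]
    have hn : ∑ j ∈ Finset.range (N + 1), u j ^ 2 = 1 := by
      rw [← Fin.sum_univ_eq_sum_range (fun j => u j ^ 2) (N + 1)]
      have h5 : ‖v‖ = 1 := hJ.eigenvectorBasis.orthonormal.1 i
      have h6 := EuclideanSpace.norm_sq_eq v
      rw [h5, huv] at h6
      simpa using h6.symm
    refine ⟨u, hn, ?_⟩
    rw [← dotProduct_jacobiMatrix_mulVec a b u (by simp [u])]
    have h7 := hpow 1 i
    rw [pow_one, pow_one] at h7
    change J.mulVec v = _ • (v : Fin (N + 1) → ℝ) at h7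
    rw [huv] at h7
    rw [h7, dotProduct_smul, dotProduct]
    have : ∑ j : Fin (N + 1), u j * u j = 1 := by
      rw [Fin.sum_univ_eq_sum_range (fun j => u j * u j) (N + 1), ← hn]
      exact Finset.sum_congr rfl fun j _ => by ring
    rw [this, smul_eq_mul, mul_one]

/-- A finitely supported measure with given nonnegative weights of total mass one. -/
lemma exists_momentMeasures_of_quadrature {ι : Type*} [Fintype ι] {E : Set ℝ}
    (hE : MeasurableSet E) {w x : ι → ℝ} (hw : ∀ i, 0 ≤ w i) (hw1 : ∑ i, w i = 1)
    (hx : ∀ i, x i ∈ E) :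
    ∃ μ ∈ momentMeasures E, ∀ m, rawMoment μ m = ∑ i, w i * x i ^ m := by
  set μ : Measure ℝ := ∑ i, ENNReal.ofReal (w i) • Measure.dirac (x i)
  have hint : ∀ (m : ℕ) (i : ι),
      Integrable (fun t : ℝ => t ^ m) (ENNReal.ofReal (w i) • Measure.dirac (x i)) := by
    intro m i
    exact (integrable_dirac (by simp)).smul_measure ENNReal.ofReal_ne_top
  refine ⟨μ, ⟨⟨?_⟩, ?_, fun m => ?_⟩, fun m => ?_⟩
  · simp only [μ, Measure.coe_finsetSum, Finset.sum_apply, Measure.smul_apply, measure_univ,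
      smul_eq_mul, mul_one]
    rw [← ENNReal.ofReal_sum_of_nonneg fun i _ => hw i, hw1, ENNReal.ofReal_one]
  · simp only [μ, Measure.coe_finsetSum, Finset.sum_apply, Measure.smul_apply, smul_eq_mul]
    refine Finset.sum_eq_zero fun i _ => ?_
    rw [Measure.dirac_apply' _ hE.compl]
    simp [hx i]
  · exact integrable_finsetSum_measure.2 fun i _ => hint m i
  · rw [rawMoment, integral_finsetSum_measure fun i _ => hint m i]
    refine Finset.sum_congr rfl fun i _ => ?_
    rw [integral_smul_measure, integral_dirac, ENNReal.toReal_ofReal (hw i), smul_eq_mul]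

/-! # The moments as functions of the coordinates -/

/-- The parameters `(0, z_1, 0, z_2, …)` of the symmetric measure on the line whose image under the
square has the coordinates `z` on the half-line. -/
def halfLineParam (z : ℕ → ℝ) (l : ℕ) : ℝ := if Even l then 0 else z (l / 2)

/-- The moment of order `m` with half-line coordinates `z`. -/
def halfLineMoment (z : ℕ → ℝ) (m : ℕ) : ℝ := lineMoment (halfLineParam z) (2 * m)

/-- The factor `q_{l-1} = 1 - p_{l-1}`, with `q_0 = 1`. -/
def chainCompl (p : ℕ → ℝ) (l : ℕ) : ℝ := if l = 0 then 1 else 1 - p (l - 1)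

@[simp] lemma chainCompl_succ (p : ℕ → ℝ) (l : ℕ) : chainCompl p (l + 1) = 1 - p l := by
  simp [chainCompl]

/-- The half-line coordinates `q_{l-1} p_l` of the canonical moments `p`. -/
def chainParam (p : ℕ → ℝ) (l : ℕ) : ℝ := chainCompl p l * p l

/-- The moments of the image under `x ↦ a + c x` of a measure with moments `f`. -/
def binomialTransform (a c : ℝ) (f : ℕ → ℝ) (m : ℕ) : ℝ :=
  ∑ k ∈ Finset.range (m + 1), (m.choose k : ℝ) * a ^ (m - k) * c ^ k * f k

namespace MomentDomain

/-- The moment of order `m` as a function of the sequence of coordinates. -/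
def moment : MomentDomain → (ℕ → ℝ) → ℕ → ℝ
  | interval a b _, y => binomialTransform a (b - a) (halfLineMoment (chainParam y))
  | halfLine, y => halfLineMoment y
  | line, y => lineMoment y

/-- The factor contributed by the coordinate `y_l` to the Jacobian determinant. -/
def weight : MomentDomain → ℕ → ℝ → ℝ
  | interval _ _ _, _, x => x * (1 - x)
  | halfLine, _, x => x
  | line, l, x => if Even l then 1 else x

/-- The constant factor of `∂m_{i+1} / ∂y_{i+1}`. -/
def scale : MomentDomain → ℕ → ℝ
  | interval a b _, i => (b - a) ^ (i + 1)
  | halfLine, _ => 1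
  | line, _ => 1

/-- The open range of the coordinate with index `l`. -/
def range (E : MomentDomain) (l : ℕ) : Set ℝ := if Even l then E.range₁ else E.range₂

end MomentDomain

lemma halfLineParam_congr {z z' : ℕ → ℝ} {i : ℕ} (h : ∀ l < i, z' l = z l) :
    ∀ l < 2 * i + 1, halfLineParam z' l = halfLineParam z l := by
  intro l hl
  by_cases he : Even l
  · simp [halfLineParam, he]
  · simp only [halfLineParam, if_neg he]
    exact h _ (by rw [Nat.not_even_iff_odd] at he; obtain ⟨k, rfl⟩ := he; omega)

lemma halfLineParam_odd (z : ℕ → ℝ) (l : ℕ) : halfLineParam z (2 * l + 1) = z l := by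
  have : (2 * l + 1) / 2 = l := by omega
  simp [halfLineParam, this]

lemma halfLineParam_even (z : ℕ → ℝ) (l : ℕ) : halfLineParam z (2 * l) = 0 := by
  simp [halfLineParam]

lemma halfLineParam_update (z : ℕ → ℝ) (i : ℕ) (t : ℝ) :
    Function.update (halfLineParam z) (2 * i + 1) t = halfLineParam (Function.update z i t) := by
  ext l
  rcases Nat.even_or_odd' l with ⟨k, rfl | rfl⟩
  · rw [Function.update_of_ne (by omega), halfLineParam_even, halfLineParam_even]
  · rw [halfLineParam_odd]
    rcases eq_or_ne k i with rfl | hk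
    · simp
    · rw [Function.update_of_ne (by omega), Function.update_of_ne hk, halfLineParam_odd]

lemma lineNorm_halfLineParam (z : ℕ → ℝ) (i : ℕ) :
    lineNorm (halfLineParam z) i = ∏ l ∈ Finset.range i, z l := by
  simp [lineNorm, halfLineParam_odd]

/-- The coordinate `z_i` sits at index `2i + 1` of the symmetric parameters, so this is the
statement on the line at that index. -/
lemma halfLineMoment_congr_and_sub {z z' : ℕ → ℝ} {i : ℕ} (h : ∀ l < i, z' l = z l) :
    (∀ m ≤ i, halfLineMoment z' m = halfLineMoment z m) ∧
    halfLineMoment z' (i + 1) - halfLineMoment z (i + 1) =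
      (∏ l ∈ Finset.range i, z l) * (z' i - z i) := by
  obtain ⟨h1, h2⟩ := lineMoment_congr_and_sub (halfLineParam_congr h)
  refine ⟨fun m hm => h1 _ (by omega), ?_⟩
  rw [show (2 * i + 1) / 2 = i by omega, halfLineParam_odd, halfLineParam_odd,
    lineNorm_halfLineParam] at h2
  exact h2

lemma halfLineMoment_congr {z z' : ℕ → ℝ} {m : ℕ} (h : ∀ l < m, z' l = z l) :
    halfLineMoment z' m = halfLineMoment z m :=
  (halfLineMoment_congr_and_sub h).1 m le_rfl

lemma chainParam_congr {p p' : ℕ → ℝ} {i : ℕ} (h : ∀ l < i, p' l = p l) :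
    ∀ l < i, chainParam p' l = chainParam p l := by
  intro l hl
  rw [chainParam, chainParam, chainCompl, chainCompl, h l hl, h (l - 1) (by omega)]

lemma chainCompl_congr {p p' : ℕ → ℝ} {i : ℕ} (h : ∀ l < i, p' l = p l) :
    chainCompl p' i = chainCompl p i := by
  rw [chainCompl, chainCompl]
  split_ifs with hi
  · rfl
  · rw [h (i - 1) (by omega)]

/-- A shift of the factors `1 - p_l` by one place. The slope in `p_i` is the slope in `z_i` times
the factor `q_{i-1} = chainCompl p i`, and this identity turns it into the product of the weights `p
(1 - p)`. -/
lemma prod_chainParam_mul_chainCompl (p : ℕ → ℝ) (i : ℕ) :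
    (∏ l ∈ Finset.range i, chainParam p l) * chainCompl p i =
      ∏ l ∈ Finset.range i, p l * (1 - p l) := by
  induction i with
  | zero => simp [chainCompl]
  | succ i ih =>
    rw [Finset.prod_range_succ, Finset.prod_range_succ, ← ih, chainParam, chainCompl_succ]
    ring

lemma binomialTransform_sub_of_eq {a c : ℝ} {f g : ℕ → ℝ} {i : ℕ} (h : ∀ m < i, f m = g m) :
    binomialTransform a c f i - binomialTransform a c g i = c ^ i * (f i - g i) := by
  rw [binomialTransform, binomialTransform, Finset.sum_range_succ, Finset.sum_range_succ,
    Finset.sum_congr rfl fun k hk => by rw [h k (Finset.mem_range.1 hk)]]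
  simp
  ring

lemma binomialTransform_injOn {a c : ℝ} (hc : c ≠ 0) {f g : ℕ → ℝ} {i : ℕ}
    (h : ∀ m ≤ i, binomialTransform a c f m = binomialTransform a c g m) :
    ∀ m ≤ i, f m = g m := by
  intro m
  induction m using Nat.strong_induction_on with
  | _ m ih =>
    intro hm
    have h1 := binomialTransform_sub_of_eq (a := a) (c := c) fun k hk => ih k hk (by omega)
    rw [h m hm, sub_self] at h1
    have h2 := (mul_eq_zero.1 h1.symm).resolve_left (pow_ne_zero _ hc)
    linarith

/-- With zero diagonal every step of a path changes the level by one, so time and level have the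
same parity. -/
lemma catalanMatrix_zero_of_odd {b : ℕ → ℝ} {n j : ℕ} (h : Odd (n + j)) :
    catalanMatrix (fun _ => 0) b n j = 0 := by
  induction n generalizing j with
  | zero =>
    have : j ≠ 0 := by rintro rfl; simp at h
    simp [catalanMatrix, this]
  | succ n ih =>
    cases j with
    | zero => simp [catalanMatrix, ih (show Odd (n + 1) by simpa using h)]
    | succ j =>
      have h1 : Odd (n + j) := by
        rw [Nat.odd_iff] at h ⊢; omega
      have h2 : Odd (n + (j + 2)) := by
        rw [Nat.odd_iff] at h ⊢; omega
      simp [catalanMatrix, ih h1, ih h2]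

lemma lineMoment_halfLineParam (z : ℕ → ℝ) (m : ℕ) :
    lineMoment (halfLineParam z) m = catalanMatrix (fun _ => 0) z m 0 := by
  simp [lineMoment, halfLineParam_even, halfLineParam_odd]

lemma lineMoment_halfLineParam_odd (z : ℕ → ℝ) {m : ℕ} (h : Odd m) :
    lineMoment (halfLineParam z) m = 0 := by
  rw [lineMoment_halfLineParam, catalanMatrix_zero_of_odd (by simpa using h)]

lemma MomentDomain.moment_zero (E : MomentDomain) (y : ℕ → ℝ) : E.moment y 0 = 1 := by
  cases E <;> simp [MomentDomain.moment, binomialTransform, halfLineMoment, lineMoment,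
    catalanMatrix]

/-- The moments are triangular functions of the coordinates. -/
lemma MomentDomain.moment_congr_and_sub (E : MomentDomain) {y y' : ℕ → ℝ} {i : ℕ}
    (h : ∀ l < i, y' l = y l) :
    (∀ m ≤ i, E.moment y' m = E.moment y m) ∧
    E.moment y' (i + 1) - E.moment y (i + 1) =
      E.scale i * (∏ l ∈ Finset.range i, E.weight l (y l)) * (y' i - y i) := by
  cases E with
  | interval a b hab =>
    obtain ⟨h1, h2⟩ := halfLineMoment_congr_and_sub (chainParam_congr h)
    constructor
    · intro m hm
      simp only [moment, binomialTransform]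
      refine Finset.sum_congr rfl fun k hk => ?_
      rw [h1 k (by have := Finset.mem_range.1 hk; omega)]
    · simp only [moment, scale, weight]
      rw [binomialTransform_sub_of_eq fun m hm => h1 m (by omega), h2,
        ← prod_chainParam_mul_chainCompl, chainParam, chainParam, chainCompl_congr h]
      ring
  | halfLine => simpa [moment, scale, weight] using halfLineMoment_congr_and_sub h
  | line =>
    obtain ⟨h1, h2⟩ := lineMoment_congr_and_sub h
    refine ⟨h1, ?_⟩
    simp only [moment, scale, weight, one_mul, h2]
    congr 1
    -- Only the odd indices carry a nontrivial weight, so the full product of weights reduces to the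
    -- product of the `β`'s.
    clear h h1 h2
    induction i with
    | zero => simp [lineNorm]
    | succ i ih =>
      rw [Finset.prod_range_succ, ← ih]
      rcases Nat.even_or_odd' i with ⟨k, rfl | rfl⟩
      · rw [show (2 * k + 1) / 2 = k by omega, show 2 * k / 2 = k by omega]; simp
      · rw [show (2 * k + 1 + 1) / 2 = k + 1 by omega, show (2 * k + 1) / 2 = k by omega, lineNorm,
          Finset.prod_range_succ]
        simp [lineNorm]

lemma MomentDomain.moment_congr (E : MomentDomain) {y y' : ℕ → ℝ} {m : ℕ}
    (h : ∀ l < m, y' l = y l) : E.moment y' m = E.moment y m :=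
  (E.moment_congr_and_sub h).1 m le_rfl

/-! # Positivity and the range of the next moment -/

/-- The next moment is affine in the coordinate `y_i` with positive slope, so a suitable `t` always
exists. For odd `i` it is a quotient of squared norms: `t = L (P_{j+1}²) / ‖P_j‖²`, which positivity
of `L` makes nonnegative. -/
lemma exists_lineMoment_eq {L : ℝ[X] →ₗ[ℝ] ℝ} (hpos : ∀ q, 0 ≤ L (q ^ 2)) {y : ℕ → ℝ} {i : ℕ}
    (hy : ∀ l < i, Odd l → 0 < y l) (hL : ∀ m ≤ i, L (Polynomial.X ^ m) = lineMoment y m) :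
    ∃ t, (Odd i → 0 ≤ t) ∧
      L (Polynomial.X ^ (i + 1)) = lineMoment (Function.update y i t) (i + 1) := by
  have hB : 0 < lineNorm y (i / 2) := Finset.prod_pos fun l hl =>
    hy _ (by have := Finset.mem_range.1 hl; omega) (by simp)
  refine ⟨y i + (L (Polynomial.X ^ (i + 1)) - lineMoment y (i + 1)) / lineNorm y (i / 2), ?_, ?_⟩
  · rintro ⟨j, rfl⟩
    have h1 := map_X_pow_sub_catalanMatrix_even hL
    change L (Polynomial.X ^ (2 * j + 1 + 1)) - lineMoment y (2 * j + 1 + 1) = _ at h1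
    rw [show (2 * j + 1) / 2 = j by omega] at hB ⊢
    rw [h1, Finset.prod_range_succ, sub_div]
    change 0 ≤ y (2 * j + 1) + (_ / _ - lineNorm y j * _ / lineNorm y j)
    rw [mul_div_cancel_left₀ _ hB.ne']
    have := div_nonneg (hpos (jacobiPoly (fun j => y (2 * j)) (fun j => y (2 * j + 1)) (j + 1)))
      hB.le
    linarith
  · have h2 := (lineMoment_congr_and_sub (y := y) (y' := Function.update y i (y i +
      (L (Polynomial.X ^ (i + 1)) - lineMoment y (i + 1)) / lineNorm y (i / 2))) (i := i)
      fun l hl => Function.update_of_ne hl.ne _ _).2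
    rw [Function.update_self, add_sub_cancel_left, mul_div_cancel₀ _ hB.ne'] at h2
    linarith

/-- Integration of polynomials against a measure with finite moments. -/
lemma functionalOfMoments_rawMoment {E : Set ℝ} {μ : Measure ℝ} (hμ : μ ∈ momentMeasures E)
    (q : ℝ[X]) : Integrable (fun x => q.eval x) μ ∧
      functionalOfMoments (rawMoment μ) q = ∫ x, q.eval x ∂μ := by
  induction q using Polynomial.induction_on' with
  | add p q hp hq =>
    simp only [Polynomial.eval_add, map_add]
    exact ⟨hp.1.add hq.1, by rw [integral_add hp.1 hq.1, hp.2, hq.2]⟩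
  | monomial n c =>
    rw [← Polynomial.C_mul_X_pow_eq_monomial]
    simp only [Polynomial.eval_mul, Polynomial.eval_C, Polynomial.eval_pow, Polynomial.eval_X]
    exact ⟨(hμ.2.2 n).const_mul c, by
      rw [map_C_mul, functionalOfMoments_X_pow, integral_const_mul, rawMoment]⟩

/-- The moments of the symmetric square root of a measure on the half-line. -/
def symmetricMoment (μ : Measure ℝ) (n : ℕ) : ℝ := if Even n then rawMoment μ (n / 2) else 0

/-- The symmetrized sequence is that of `±√x` with a fair random sign: odd powers cancel, and even
powers of `√x` return the moments of `μ`. -/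
lemma functionalOfMoments_symmetricMoment {μ : Measure ℝ} (hμ : μ ∈ momentMeasures (Ici 0))
    (q : ℝ[X]) : Integrable (fun x => (q.eval (√x) + q.eval (-√x)) / 2) μ ∧
      functionalOfMoments (symmetricMoment μ) q = ∫ x, (q.eval (√x) + q.eval (-√x)) / 2 ∂μ := by
  have hae : ∀ᵐ x ∂μ, 0 ≤ x := hμ.2.1
  induction q using Polynomial.induction_on' with
  | add p q hp hq =>
    have e : ∀ x : ℝ, ((p + q).eval (√x) + (p + q).eval (-√x)) / 2 =
        (p.eval (√x) + p.eval (-√x)) / 2 + (q.eval (√x) + q.eval (-√x)) / 2 := fun x => by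
      simp only [Polynomial.eval_add]; ring
    simp only [e, map_add]
    exact ⟨hp.1.add hq.1, by rw [integral_add hp.1 hq.1, hp.2, hq.2]⟩
  | monomial n c =>
    rw [← Polynomial.C_mul_X_pow_eq_monomial, map_C_mul, functionalOfMoments_X_pow]
    simp only [Polynomial.eval_mul, Polynomial.eval_C, Polynomial.eval_pow, Polynomial.eval_X]
    rcases Nat.even_or_odd' n with ⟨k, rfl | rfl⟩
    · have e : (fun x : ℝ => c * x ^ k) =ᵐ[μ]
          fun x => (c * √x ^ (2 * k) + c * (-√x) ^ (2 * k)) / 2 := by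
        filter_upwards [hae] with x hx
        rw [pow_mul, pow_mul, neg_sq, Real.sq_sqrt hx]; ring
      refine ⟨((hμ.2.2 k).const_mul c).congr e, ?_⟩
      rw [← integral_congr_ae e, integral_const_mul]
      simp [symmetricMoment, rawMoment]
    · have e : ∀ x : ℝ, (c * √x ^ (2 * k + 1) + c * (-√x) ^ (2 * k + 1)) / 2 = 0 := fun x => by
        rw [Odd.neg_pow (by simp)]; ring
      simp only [e]
      simp [symmetricMoment]

/-- Apply the statement on the line to the law of `±√x`. Its diagonal coefficients are 0, and the
free coordinate has odd index `2i + 1`, which is where positivity gives `0 ≤ t`. -/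
lemma exists_halfLineMoment_eq {μ : Measure ℝ} (hμ : μ ∈ momentMeasures (Ici 0)) {z : ℕ → ℝ}
    {i : ℕ} (hz : ∀ l < i, 0 < z l) (h : ∀ m ≤ i, rawMoment μ m = halfLineMoment z m) :
    ∃ t, 0 ≤ t ∧ rawMoment μ (i + 1) = halfLineMoment (Function.update z i t) (i + 1) := by
  set L := functionalOfMoments (symmetricMoment μ)
  have hpos : ∀ q, 0 ≤ L (q ^ 2) := fun q => by
    rw [(functionalOfMoments_symmetricMoment hμ _).2]
    refine integral_nonneg fun x => ?_
    simp only [Polynomial.eval_pow, Pi.zero_apply]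
    positivity
  have hL : ∀ m ≤ 2 * i + 1, L (Polynomial.X ^ m) = lineMoment (halfLineParam z) m := by
    intro m hm
    rw [functionalOfMoments_X_pow]
    rcases Nat.even_or_odd' m with ⟨k, rfl | rfl⟩
    · simp only [symmetricMoment, even_two_mul, if_true, Nat.mul_div_cancel_left k two_pos]
      exact h k (by omega)
    · rw [lineMoment_halfLineParam_odd _ (by simp)]
      simp [symmetricMoment]
  obtain ⟨t, ht, h1⟩ := exists_lineMoment_eq hpos (y := halfLineParam z) (i := 2 * i + 1)
    (by rintro l hl ⟨k, rfl⟩; rw [halfLineParam_odd]; exact hz k (by omega)) hL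
  refine ⟨t, ht (by simp), ?_⟩
  rw [halfLineParam_update] at h1
  rw [halfLineMoment, show 2 * (i + 1) = 2 * i + 1 + 1 by ring, ← h1, functionalOfMoments_X_pow,
    symmetricMoment, if_pos ⟨i + 1, by ring⟩]
  congr 1
  omega

/-! ### The upper bound for canonical moments -/

/-- The polynomials which are extremal for `L ((1 - X) q²)`. -/
def chainPoly (p : ℕ → ℝ) : ℕ → ℝ[X]
  | 0 => 1
  | j + 1 => jacobiPoly (fun _ => 0) (chainParam p) (j + 1) + Polynomial.C (p j) * chainPoly p j

lemma natDegree_chainPoly_le_and_coeff (p : ℕ → ℝ) (j : ℕ) :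
    (chainPoly p j).natDegree ≤ j ∧ (chainPoly p j).coeff j = 1 := by
  induction j with
  | zero => simp [chainPoly]
  | succ j ih =>
    refine ⟨?_, ?_⟩
    · refine (Polynomial.natDegree_add_le _ _).trans (max_le (by simp) ?_)
      exact (Polynomial.natDegree_C_mul_le _ _).trans (ih.1.trans (by omega))
    · rw [chainPoly, Polynomial.coeff_add, coeff_jacobiPoly_self, Polynomial.coeff_C_mul,
        Polynomial.coeff_eq_zero_of_natDegree_lt (ih.1.trans_lt (by omega)), mul_zero, add_zero]

/-- Write `Q_j` for `chainPoly p j` and expand `Q_{j+1} = P_{j+1} + p_j Q_j`. By orthogonality `L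
(Q_j P_{j+1}) = 0` and `L (X Q_j P_{j+1}) = L (P_{j+1}²)`, so the value is `(1 - 2 p_j) L
(P_{j+1}²)` plus `p_j²` times the previous value; the latter product is `p_j L (P_{j+1}²)`. The sign
of the result thus detects whether `p_j ≤ 1`. -/
lemma map_one_sub_X_mul_chainPoly_sq {p : ℕ → ℝ} {L : ℝ[X] →ₗ[ℝ] ℝ} {N : ℕ}
    (hL : ∀ m ≤ N, L (Polynomial.X ^ m) = catalanMatrix (fun _ => 0) (chainParam p) m 0) {j : ℕ}
    (h : 2 * j + 1 ≤ N) :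
    L ((1 - Polynomial.X) * chainPoly p j ^ 2) =
      chainCompl p j * ∏ l ∈ Finset.range j, chainParam p l := by
  induction j with
  | zero =>
    have h0 := hL 0 (by omega)
    have h1 := hL 1 h
    rw [pow_zero] at h0
    rw [pow_one] at h1
    simp [chainPoly, h0, h1, catalanMatrix, chainCompl]
  | succ j ih =>
    have ih := ih (by omega)
    obtain ⟨hd, hc⟩ := natDegree_chainPoly_le_and_coeff p j
    have hdX : (Polynomial.X * chainPoly p j).natDegree ≤ j + 1 :=
      (Polynomial.natDegree_mul_le).trans (by rw [Polynomial.natDegree_X]; omega)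
    set P := jacobiPoly (fun _ => 0) (chainParam p) (j + 1) with hP
    have e : (1 - Polynomial.X) * chainPoly p (j + 1) ^ 2 =
        P ^ 2 - Polynomial.X * P ^ 2 + Polynomial.C (2 * p j) * (chainPoly p j * P) -
          Polynomial.C (2 * p j) * (Polynomial.X * chainPoly p j * P) +
          Polynomial.C (p j ^ 2) * ((1 - Polynomial.X) * chainPoly p j ^ 2) := by
      rw [chainPoly, Polynomial.C_mul, Polynomial.C_pow, show (Polynomial.C (2 : ℝ)) = 2 from rfl]
      ring
    rw [e, map_add, map_sub, map_add, map_sub, map_C_mul, map_C_mul, map_C_mul, ih,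
      map_jacobiPoly_sq hL (by omega), map_X_mul_jacobiPoly_sq hL (by omega), hP,
      map_mul_jacobiPoly hL (by omega) (by omega), map_mul_jacobiPoly hL hdX (by omega),
      Polynomial.coeff_X_mul, hc, Polynomial.coeff_eq_zero_of_natDegree_lt (by omega),
      Finset.prod_range_succ, chainParam, chainCompl_succ]
    ring

lemma momentMeasures_mono {E E' : Set ℝ} (h : E ⊆ E') : momentMeasures E ⊆ momentMeasures E' :=
  fun _ hμ => ⟨hμ.1, measure_mono_null (compl_subset_compl.2 h) hμ.2.1, hμ.2.2⟩

/-- The half-line case gives the next `z_i ≥ 0`, hence `p_i = z_i / q_{i-1} ≥ 0`. For `p_i ≤ 1`, the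
symmetrized measure lives on `[-1, 1]`, where `(1 - X) Q_{i+1}²` is nonnegative, and its integral is
`1 - p_i` times a product of positive parameters. -/
lemma exists_halfLineMoment_chainParam_eq {μ : Measure ℝ} (hμ : μ ∈ momentMeasures (Icc 0 1))
    {p : ℕ → ℝ} {i : ℕ} (hp : ∀ l < i, p l ∈ Ioo 0 1)
    (h : ∀ m ≤ i, rawMoment μ m = halfLineMoment (chainParam p) m) :
    ∃ t ∈ Icc (0 : ℝ) 1,
      rawMoment μ (i + 1) = halfLineMoment (chainParam (Function.update p i t)) (i + 1) := by
  have hμ' : μ ∈ momentMeasures (Ici 0) := momentMeasures_mono Icc_subset_Ici_self hμ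
  have hc : ∀ l ≤ i, 0 < chainCompl p l := by
    intro l hl
    rw [chainCompl]
    split_ifs with h0
    · exact one_pos
    · linarith [(hp (l - 1) (by omega)).2]
  have hz : ∀ l < i, 0 < chainParam p l := fun l hl => mul_pos (hc l hl.le) (hp l hl).1
  obtain ⟨t, ht0, ht⟩ := exists_halfLineMoment_eq hμ' hz h
  set p' := Function.update p i (t / chainCompl p i) with hp'
  have hagree : ∀ l < i, p' l = p l := fun l hl => Function.update_of_ne hl.ne _ _
  have hpi : p' i = t / chainCompl p i := by simp [p']
  have hzi : chainParam p' i = t := by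
    rw [chainParam, chainCompl_congr hagree, hpi, mul_div_cancel₀ _ (hc i le_rfl).ne']
  have hmom : rawMoment μ (i + 1) = halfLineMoment (chainParam p') (i + 1) := by
    rw [ht]
    refine halfLineMoment_congr fun l hl => ?_
    rcases (Nat.lt_succ_iff.1 hl).lt_or_eq with hl | rfl
    · rw [Function.update_of_ne hl.ne, chainParam_congr hagree l hl]
    · rw [Function.update_self, hzi]
  refine ⟨t / chainCompl p i, ⟨div_nonneg ht0 (hc i le_rfl).le, ?_⟩, hmom⟩
  -- If `t = 0` the product of parameters below vanishes and yields no information, but the bound is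
  -- then trivial.
  rcases ht0.eq_or_lt with rfl | htpos
  · simp
  have hall : ∀ m ≤ i + 1, rawMoment μ m = halfLineMoment (chainParam p') m := by
    intro m hm
    rcases hm.lt_or_eq with hm | rfl
    · rw [h m (by omega)]
      exact halfLineMoment_congr fun l hl => (chainParam_congr hagree l (by omega)).symm
    · exact hmom
  set L := functionalOfMoments (symmetricMoment μ)
  -- The moment of order `2(i + 1) + 1`, one beyond the known data, is available because odd moments
  -- of a symmetric measure vanish.
  have hL : ∀ m ≤ 2 * (i + 1) + 1,
      L (Polynomial.X ^ m) = catalanMatrix (fun _ => 0) (chainParam p') m 0 := by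
    intro m hm
    rw [functionalOfMoments_X_pow, ← lineMoment_halfLineParam]
    rcases Nat.even_or_odd' m with ⟨k, rfl | rfl⟩
    · simp only [symmetricMoment, even_two_mul, if_true, Nat.mul_div_cancel_left k two_pos]
      exact hall k (by omega)
    · rw [lineMoment_halfLineParam_odd _ (by simp)]
      simp [symmetricMoment]
  have hform := map_one_sub_X_mul_chainPoly_sq hL le_rfl
  have hnonneg : 0 ≤ L ((1 - Polynomial.X) * chainPoly p' (i + 1) ^ 2) := by
    rw [(functionalOfMoments_symmetricMoment hμ' _).2]
    have hae : ∀ᵐ x ∂μ, x ∈ Icc (0 : ℝ) 1 := hμ.2.1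
    refine integral_nonneg_of_ae ?_
    filter_upwards [hae] with x hx
    have h1 : √x ≤ 1 := Real.sqrt_le_one.2 hx.2
    simp only [Polynomial.eval_mul, Polynomial.eval_sub, Polynomial.eval_one, Polynomial.eval_X,
      Polynomial.eval_pow, Pi.zero_apply]
    have h2 : 0 ≤ 1 - √x := by linarith
    have h3 : 0 ≤ 1 - -√x := by linarith [Real.sqrt_nonneg x]
    positivity
  rw [hform] at hnonneg
  have hprod : 0 < ∏ l ∈ Finset.range (i + 1), chainParam p' l := by
    refine Finset.prod_pos fun l hl => ?_
    rcases (Nat.lt_succ_iff.1 (Finset.mem_range.1 hl)).lt_or_eq with hl | rfl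
    · rw [chainParam_congr hagree l hl]; exact hz l hl
    · rw [hzi]; exact htpos
  have := nonneg_of_mul_nonneg_left hnonneg hprod
  rw [chainCompl_succ, hpi] at this
  linarith

/-! # Affine images of measures -/

lemma map_affine_mem_momentMeasures {E E' : Set ℝ} (hE' : MeasurableSet E') {a c : ℝ}
    (hmaps : ∀ x ∈ E, a + c * x ∈ E') {μ : Measure ℝ} (hμ : μ ∈ momentMeasures E) :
    μ.map (fun x => a + c * x) ∈ momentMeasures E' ∧
      ∀ m, rawMoment (μ.map fun x => a + c * x) m = binomialTransform a c (rawMoment μ) m := by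
  have hf : Measurable fun x : ℝ => a + c * x := by fun_prop
  have := hμ.1
  have hpow : ∀ m x, (a + c * x) ^ m =
      ∑ k ∈ Finset.range (m + 1), ((m.choose k : ℝ) * a ^ (m - k) * c ^ k) * x ^ k := by
    intro m x
    rw [add_comm, add_pow]
    exact Finset.sum_congr rfl fun k _ => by rw [mul_pow]; ring
  have hint : ∀ m k, Integrable
      (fun x : ℝ => ((m.choose k : ℝ) * a ^ (m - k) * c ^ k) * x ^ k) μ :=
    fun m k => (hμ.2.2 k).const_mul _
  refine ⟨⟨Measure.isProbabilityMeasure_map hf.aemeasurable, ?_, fun j => ?_⟩, fun m => ?_⟩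
  · rw [Measure.map_apply hf hE'.compl]
    exact measure_mono_null (fun x hx hxE => hx (hmaps x hxE)) hμ.2.1
  · rw [integrable_map_measure (by fun_prop) hf.aemeasurable]
    refine (integrable_finsetSum (Finset.range (j + 1)) fun k _ => hint j k).congr ?_
    exact ae_of_all _ fun x => (hpow j x).symm
  · rw [rawMoment, integral_map hf.aemeasurable (by fun_prop)]
    simp_rw [hpow]
    rw [integral_finsetSum _ fun k _ => hint m k, binomialTransform]
    exact Finset.sum_congr rfl fun k _ => by rw [integral_const_mul, rawMoment]

lemma exists_momentMeasures_Icc_eq {a b : ℝ} (hab : a < b) {μ : Measure ℝ}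
    (hμ : μ ∈ momentMeasures (Icc a b)) :
    ∃ μ' ∈ momentMeasures (Icc 0 1),
      ∀ m, rawMoment μ m = binomialTransform a (b - a) (rawMoment μ') m := by
  have hc : 0 < b - a := sub_pos.2 hab
  have h1 := (map_affine_mem_momentMeasures (E' := Icc 0 1) (a := -a / (b - a))
    (c := (b - a)⁻¹) measurableSet_Icc (fun x hx => by
      have e : -a / (b - a) + (b - a)⁻¹ * x = (x - a) / (b - a) := by field_simp; ring
      rw [e]
      exact ⟨div_nonneg (by linarith [hx.1]) hc.le, (div_le_one hc).2 (by linarith [hx.2])⟩) hμ).1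
  refine ⟨_, h1, fun m => ?_⟩
  rw [← (map_affine_mem_momentMeasures (E' := univ) MeasurableSet.univ (fun _ _ => mem_univ _)
    h1).2 m, Measure.map_map (by fun_prop) (by fun_prop)]
  have : (fun x => a + (b - a) * x) ∘ (fun x => -a / (b - a) + (b - a)⁻¹ * x) = id := by
    ext x; simp only [Function.comp_apply, id]; field_simp; ring
  rw [this, Measure.map_id]

/-! ### Coordinate ranges and the measures that realize them -/

namespace MomentDomain

lemma range_interval {a b : ℝ} {hab : a < b} (l : ℕ) : (interval a b hab).range l = Ioo 0 1 := by
  simp [range, range₁, range₂]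

lemma range_halfLine (l : ℕ) : halfLine.range l = Ioi 0 := by
  simp [range, range₁, range₂]

lemma range_line (l : ℕ) : line.range l = if Even l then univ else Ioi 0 := rfl

lemma isOpen_range (E : MomentDomain) (l : ℕ) : IsOpen (E.range l) := by
  cases E
  · rw [range_interval]; exact isOpen_Ioo
  · rw [range_halfLine]; exact isOpen_Ioi
  · rw [range_line]; split_ifs; exacts [isOpen_univ, isOpen_Ioi]

/-- Positivity arguments locate coordinates only in the closed range; for interior moment vectors
this identity upgrades that to the open range. -/
lemma interior_closure_range (E : MomentDomain) (l : ℕ) :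
    interior (closure (E.range l)) = E.range l := by
  cases E
  · rw [range_interval, closure_Ioo (by norm_num), interior_Icc]
  · rw [range_halfLine, closure_Ioi, interior_Ici]
  · rw [range_line]; split_ifs <;> simp

lemma range_nonempty (E : MomentDomain) (l : ℕ) : (E.range l).Nonempty := by
  cases E
  · rw [range_interval]; exact ⟨1 / 2, by norm_num⟩
  · rw [range_halfLine]; exact ⟨1, by simp⟩
  · rw [range_line]; split_ifs <;> exact ⟨1, by simp⟩

lemma weight_pos (E : MomentDomain) {l : ℕ} {x : ℝ} (hx : x ∈ E.range l) : 0 < E.weight l x := by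
  cases E
  · rw [range_interval] at hx
    exact mul_pos hx.1 (by linarith [hx.2])
  · rw [range_halfLine] at hx; exact hx
  · rw [range_line] at hx
    rw [weight]
    split_ifs at hx ⊢
    exacts [one_pos, hx]

lemma scale_pos (E : MomentDomain) (i : ℕ) : 0 < E.scale i := by
  cases E with
  | interval a b hab => exact pow_pos (sub_pos.2 hab) _
  | halfLine => exact one_pos
  | line => exact one_pos

lemma chainCompl_pos {p : ℕ → ℝ} (hp : ∀ l, p l ∈ Ioo 0 1) (l : ℕ) : 0 < chainCompl p l := by
  cases l with
  | zero => simp [chainCompl]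
  | succ l => rw [chainCompl_succ]; linarith [(hp l).2]

/-- The quadratic form of a Jacobi matrix with chain sequence is bounded by one. -/
lemma chainCompl_mul_sq_le {p : ℕ → ℝ} (hp : ∀ l, p l ∈ Ioo 0 1) (u : ℕ → ℝ) {s : ℝ}
    (hs : s ^ 2 = 1) (M : ℕ) :
    chainCompl p M * u M ^ 2 ≤ ∑ j ∈ Finset.range (M + 1), u j ^ 2 +
      2 * s * ∑ j ∈ Finset.range M, √(chainParam p j) * u j * u (j + 1) := by
  induction M with
  | zero => simp [chainCompl]
  | succ M ih =>
    rw [Finset.sum_range_succ,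
      Finset.sum_range_succ (fun j => √(chainParam p j) * u j * u (j + 1)), chainCompl_succ]
    have hq := chainCompl_pos hp M
    have h1 : √(chainParam p M) = √(chainCompl p M) * √(p M) := Real.sqrt_mul hq.le _
    have h2 := Real.sq_sqrt hq.le
    have h3 := Real.sq_sqrt (hp M).1.le
    -- Completing the square: the new cross term is absorbed by `chainCompl p M * u M ^ 2` from the
    -- induction hypothesis together with `p M * u (M + 1) ^ 2`, and `(1 - p M) * u (M + 1) ^ 2` is
    -- left over.
    have h4 : √(chainCompl p M) ^ 2 * u M ^ 2 * s ^ 2 +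
        2 * s * (√(chainCompl p M) * √(p M) * u M * u (M + 1)) + √(p M) ^ 2 * u (M + 1) ^ 2 =
        (√(chainCompl p M) * u M * s + √(p M) * u (M + 1)) ^ 2 := by ring
    have h5 := sq_nonneg (√(chainCompl p M) * u M * s + √(p M) * u (M + 1))
    rw [← h4, h2, h3, hs] at h5
    rw [h1]
    linarith

/-- Every sequence of coordinates in the open range is attained, up to any given order. -/
lemma exists_momentMeasures_eq (E : MomentDomain) {y : ℕ → ℝ} (hy : ∀ l, y l ∈ E.range l) (n : ℕ) :
    ∃ μ ∈ momentMeasures E.carrier, ∀ m ≤ n, rawMoment μ m = E.moment y m := by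
  cases E with
  | interval a b hab =>
    simp only [range_interval] at hy
    have hz : ∀ l, 0 ≤ chainParam y l := fun l => (mul_pos (chainCompl_pos hy l) (hy l).1).le
    -- Quadrature for the symmetric measure, whose nodes are then squared; hence the order `2 * n`.
    obtain ⟨w, x, hw, hm, hx⟩ := exists_quadrature (fun _ => 0) hz (2 * n)
    obtain ⟨μ, hμ, hμm⟩ := exists_momentMeasures_of_quadrature (E := Icc 0 1) measurableSet_Icc hw
      (by simpa [catalanMatrix] using hm 0 (by omega)) (x := fun i => x i ^ 2) (fun i => by
        obtain ⟨u, hu, hxu⟩ := hx i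
        -- The two signs of `s` confine the value of the quadratic form, which is the node, to `[-1,
        -- 1]`.
        have h1 := chainCompl_mul_sq_le hy u (s := 1) (by norm_num) (2 * n)
        have h2 := chainCompl_mul_sq_le hy u (s := -1) (by norm_num) (2 * n)
        have h3 := mul_nonneg (chainCompl_pos hy (2 * n)).le (sq_nonneg (u (2 * n)))
        rw [hu] at h1 h2
        simp only [zero_mul, Finset.sum_const_zero, zero_add] at hxu
        refine ⟨sq_nonneg _, ?_⟩
        rw [sq_le_one_iff_abs_le_one, abs_le]
        constructor <;> linarith)
    have key : ∀ m ≤ n, rawMoment μ m = halfLineMoment (chainParam y) m := by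
      intro m hmn
      rw [hμm, halfLineMoment, lineMoment_halfLineParam, ← hm (2 * m) (by omega)]
      exact Finset.sum_congr rfl fun i _ => by rw [pow_mul]
    obtain ⟨h1, h2⟩ := map_affine_mem_momentMeasures (E' := Icc a b) (a := a) (c := b - a)
      measurableSet_Icc (fun x hx => ⟨by nlinarith [hx.1], by nlinarith [hx.2]⟩) hμ
    refine ⟨_, h1, fun m hmn => ?_⟩
    rw [h2, moment, binomialTransform, binomialTransform]
    exact Finset.sum_congr rfl fun k hk => by
      rw [key k (by have := Finset.mem_range.1 hk; omega)]
  | halfLine =>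
    simp only [range_halfLine, mem_Ioi] at hy
    obtain ⟨w, x, hw, hm, -⟩ := exists_quadrature (fun _ => 0) (fun l => (hy l).le) (2 * n)
    obtain ⟨μ, hμ, hμm⟩ := exists_momentMeasures_of_quadrature (E := Ici 0) measurableSet_Ici hw
      (by simpa [catalanMatrix] using hm 0 (by omega)) (x := fun i => x i ^ 2)
      (fun i => mem_Ici.2 (sq_nonneg _))
    refine ⟨μ, hμ, fun m hmn => ?_⟩
    rw [hμm, moment, halfLineMoment, lineMoment_halfLineParam, ← hm (2 * m) (by omega)]
    exact Finset.sum_congr rfl fun i _ => by rw [pow_mul]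
  | line =>
    obtain ⟨w, x, hw, hm, -⟩ := exists_quadrature (fun j => y (2 * j))
      (b := fun j => y (2 * j + 1)) (fun l => by
        have := hy (2 * l + 1)
        rw [range_line, if_neg (by simp)] at this
        exact (mem_Ioi.1 this).le) n
    obtain ⟨μ, hμ, hμm⟩ := exists_momentMeasures_of_quadrature (E := univ) MeasurableSet.univ hw
      (by simpa [catalanMatrix] using hm 0 (by omega)) (x := x) (fun i => mem_univ _)
    exact ⟨μ, hμ, fun m hmn => by rw [hμm, hm m hmn]; rfl⟩

/-- The possible values of the next moment correspond to coordinates in the closed range. -/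
lemma exists_moment_eq (E : MomentDomain) {μ : Measure ℝ} (hμ : μ ∈ momentMeasures E.carrier)
    {y : ℕ → ℝ} {i : ℕ} (hy : ∀ l < i, y l ∈ E.range l)
    (h : ∀ m ≤ i, rawMoment μ m = E.moment y m) :
    ∃ t ∈ closure (E.range i),
      rawMoment μ (i + 1) = E.moment (Function.update y i t) (i + 1) := by
  cases E with
  | interval a b hab =>
    simp only [range_interval] at hy ⊢
    have hc : b - a ≠ 0 := (sub_pos.2 hab).ne'
    obtain ⟨μ', hμ', hm⟩ := exists_momentMeasures_Icc_eq hab hμ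
    have h' : ∀ m ≤ i, rawMoment μ' m = halfLineMoment (chainParam y) m :=
      binomialTransform_injOn hc fun m hmi => by rw [← hm, h m hmi]; rfl
    obtain ⟨t, ht, h1⟩ := exists_halfLineMoment_chainParam_eq hμ' hy h'
    refine ⟨t, by rwa [closure_Ioo (by norm_num)], ?_⟩
    rw [hm, moment, binomialTransform, binomialTransform]
    refine Finset.sum_congr rfl fun k hk => ?_
    rcases (Nat.lt_succ_iff.1 (Finset.mem_range.1 hk)).lt_or_eq with hk | rfl
    · rw [h' k (by omega)]
      congr 1
      refine halfLineMoment_congr fun l hl => ?_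
      exact (chainParam_congr (i := i) (fun l hl => Function.update_of_ne hl.ne _ _) l
        (by omega)).symm
    · rw [h1]
  | halfLine =>
    simp only [range_halfLine] at hy ⊢
    obtain ⟨t, ht, h1⟩ := exists_halfLineMoment_eq hμ hy h
    exact ⟨t, by rwa [closure_Ioi], h1⟩
  | line =>
    have hL := fun q => (functionalOfMoments_rawMoment hμ q).2
    obtain ⟨t, ht, h1⟩ := exists_lineMoment_eq (L := functionalOfMoments (rawMoment μ)) (y := y)
      (i := i) (fun q => by
        rw [hL]
        exact integral_nonneg fun x => by simp only [Polynomial.eval_pow]; positivity)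
      (fun l hl ho => by
        have := hy l hl
        rwa [range_line, if_neg (by simpa using ho)] at this)
      (fun m hm => by rw [functionalOfMoments_X_pow]; exact h m hm)
    refine ⟨t, ?_, by rwa [functionalOfMoments_X_pow] at h1⟩
    rw [range_line]
    split_ifs with he
    · simp
    · rw [closure_Ioi]; exact ht (by simpa using he)

/-- The derivative of the moment of order `i + 1` with respect to the coordinate `y_i`. -/
def slope (E : MomentDomain) (y : ℕ → ℝ) (i : ℕ) : ℝ :=
  E.scale i * ∏ l ∈ Finset.range i, E.weight l (y l)

lemma slope_pos (E : MomentDomain) {y : ℕ → ℝ} {i : ℕ} (hy : ∀ l < i, y l ∈ E.range l) :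
    0 < E.slope y i :=
  mul_pos (E.scale_pos i) (Finset.prod_pos fun l hl => E.weight_pos (hy l (Finset.mem_range.1 hl)))

lemma moment_update (E : MomentDomain) (y : ℕ → ℝ) (i : ℕ) (s t : ℝ) :
    E.moment (Function.update y i t) (i + 1) =
      E.moment (Function.update y i s) (i + 1) + E.slope y i * (t - s) := by
  have h : ∀ r : ℝ, E.moment (Function.update y i r) (i + 1) - E.moment y (i + 1) =
      E.slope y i * (r - y i) := fun r => by
    have h1 := (E.moment_congr_and_sub (y' := Function.update y i r) (y := y) (i := i)
      fun l hl => Function.update_of_ne hl.ne _ _).2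
    rwa [Function.update_self] at h1
  linarith [h s, h t]

/-! # The coordinates of a moment vector -/

section Coord

variable {n : ℕ} {m : Fin n → ℝ} {y : ℕ → ℝ}

lemma mem_momentSection_of_mem_range (E : MomentDomain) (hy : ∀ l, y l ∈ E.range l)
    (hm : ∀ l, m l = E.moment y (l + 1)) (i : Fin n) {t : ℝ} (ht : t ∈ E.range i) :
    E.moment (Function.update y i t) (i + 1) ∈ momentSection E.carrier m i := by
  obtain ⟨μ, hμ, h⟩ := E.exists_momentMeasures_eq (y := Function.update y i t) (fun l => by
    rcases eq_or_ne l (i : ℕ) with rfl | hl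
    · rwa [Function.update_self]
    · rw [Function.update_of_ne hl]; exact hy l) (i + 1)
  refine ⟨μ, hμ, fun l hl => ?_, h _ le_rfl⟩
  rw [h _ (by have : (l : ℕ) < i := hl; omega), hm l]
  exact E.moment_congr fun k hk => Function.update_of_ne (by have : (l : ℕ) < i := hl; omega) _ _

lemma exists_of_mem_momentSection (E : MomentDomain) (hy : ∀ l, y l ∈ E.range l)
    (hm : ∀ l, m l = E.moment y (l + 1)) {i : Fin n} {x : ℝ}
    (hx : x ∈ momentSection E.carrier m i) :
    ∃ t ∈ closure (E.range i), x = E.moment (Function.update y i t) (i + 1) := by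
  obtain ⟨μ, hμ, h, rfl⟩ := hx
  refine E.exists_moment_eq hμ (fun l _ => hy l) fun k hk => ?_
  rcases k with _ | k
  · have := hμ.1
    simp [rawMoment, moment_zero]
  · rw [h ⟨k, by omega⟩ (by rw [Fin.lt_def]; exact hk), hm]

/-- The possible next moments contain the image of the open coordinate range and lie in the image of
its closure, under the same increasing affine function. Infima therefore correspond, whether or not
they are attained; suprema are treated likewise in `upperMoment_eq`. -/
lemma lowerMoment_eq (E : MomentDomain) (hy : ∀ l, y l ∈ E.range l)
    (hm : ∀ l, m l = E.moment y (l + 1)) {i : Fin n} {s : ℝ} (hs : IsGLB (E.range i) s) :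
    lowerMoment E.carrier m i = E.moment (Function.update y i s) (i + 1) := by
  have hK : 0 < E.slope y i := E.slope_pos fun l _ => hy l
  obtain ⟨t₀, ht₀⟩ := E.range_nonempty i
  refine IsGLB.csInf_eq ⟨?_, ?_⟩ ⟨_, E.mem_momentSection_of_mem_range hy hm i ht₀⟩
  · intro x hx
    obtain ⟨t, ht, rfl⟩ := E.exists_of_mem_momentSection hy hm hx
    have : s ≤ t := by
      have h1 : s ∈ lowerBounds (closure (E.range i)) := by rw [lowerBounds_closure]; exact hs.1
      exact h1 ht
    rw [E.moment_update y i s t]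
    have := mul_nonneg hK.le (sub_nonneg.2 this)
    linarith
  · intro c hc
    have h2 : (c - E.moment (Function.update y i s) (i + 1)) / E.slope y i + s ≤ s := by
      refine hs.2 fun t ht => ?_
      have h3 := hc (E.mem_momentSection_of_mem_range hy hm i ht)
      rw [E.moment_update y i s t] at h3
      have : (c - E.moment (Function.update y i s) (i + 1)) / E.slope y i ≤ t - s := by
        rw [div_le_iff₀ hK]; linarith
      linarith
    have h4 : (c - E.moment (Function.update y i s) (i + 1)) / E.slope y i ≤ 0 := by linarith
    rw [div_le_iff₀ hK] at h4
    linarith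

lemma upperMoment_eq (E : MomentDomain) (hy : ∀ l, y l ∈ E.range l)
    (hm : ∀ l, m l = E.moment y (l + 1)) {i : Fin n} {s : ℝ} (hs : IsLUB (E.range i) s) :
    upperMoment E.carrier m i = E.moment (Function.update y i s) (i + 1) := by
  have hK : 0 < E.slope y i := E.slope_pos fun l _ => hy l
  obtain ⟨t₀, ht₀⟩ := E.range_nonempty i
  refine IsLUB.csSup_eq ⟨?_, ?_⟩ ⟨_, E.mem_momentSection_of_mem_range hy hm i ht₀⟩
  · intro x hx
    obtain ⟨t, ht, rfl⟩ := E.exists_of_mem_momentSection hy hm hx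
    have : t ≤ s := by
      have h1 : s ∈ upperBounds (closure (E.range i)) := by rw [upperBounds_closure]; exact hs.1
      exact h1 ht
    rw [E.moment_update y i s t]
    have := mul_nonneg hK.le (sub_nonneg.2 this)
    linarith
  · intro c hc
    have h2 : s ≤ (c - E.moment (Function.update y i s) (i + 1)) / E.slope y i + s := by
      refine hs.2 fun t ht => ?_
      have h3 := hc (E.mem_momentSection_of_mem_range hy hm i ht)
      rw [E.moment_update y i s t] at h3
      have : t - s ≤ (c - E.moment (Function.update y i s) (i + 1)) / E.slope y i := by
        rw [le_div_iff₀ hK]; linarith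
      linarith
    have h4 : 0 ≤ (c - E.moment (Function.update y i s) (i + 1)) / E.slope y i := by linarith
    rw [le_div_iff₀ hK] at h4
    linarith

/-- As the coordinate runs from 0 to 1 the moment runs affinely from its lower to its upper end
point, so the relative position is the coordinate itself. -/
lemma intervalCoord_eq {a b : ℝ} (hab : a < b) (hy : ∀ l, y l ∈ (interval a b hab).range l)
    (hm : ∀ l, m l = (interval a b hab).moment y (l + 1)) (i : Fin n) :
    intervalCoord a b m i = y i := by
  have h0 := lowerMoment_eq (interval a b hab) hy hm (i := i) (s := 0)
    (by rw [range_interval]; exact isGLB_Ioo (by norm_num))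
  have h1 := upperMoment_eq (interval a b hab) hy hm (i := i) (s := 1)
    (by rw [range_interval]; exact isLUB_Ioo (by norm_num))
  have hK := (interval a b hab).slope_pos (i := i) fun l _ => hy l
  have h2 := (interval a b hab).moment_update y i 0 (y i)
  rw [Function.update_eq_self] at h2
  have h3 := (interval a b hab).moment_update y i 0 1
  simp only [carrier] at h0 h1
  rw [intervalCoord, h0, h1, hm, h2, h3, add_sub_cancel_left, add_sub_cancel_left, sub_zero,
    sub_zero, mul_one, mul_div_cancel_left₀ _ hK.ne']

lemma halfLineCoord_eq (hy : ∀ l, y l ∈ halfLine.range l)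
    (hm : ∀ l, m l = halfLine.moment y (l + 1)) (i : Fin n) : halfLineCoord m i = y i := by
  -- The distance to the lower end point is slope times coordinate, that is `z_0 ⋯ z_j`; the
  -- coordinate is the ratio of two consecutive such products.
  have key : ∀ j : Fin n, m j - lowerMoment (Ici 0) m j = ∏ l ∈ Finset.range (j + 1), y l := by
    intro j
    have h0 := lowerMoment_eq halfLine hy hm (i := j) (s := 0)
      (by rw [range_halfLine]; exact isGLB_Ioi)
    have h2 := halfLine.moment_update y j 0 (y j)
    rw [Function.update_eq_self] at h2
    simp only [carrier] at h0
    rw [h0, hm, h2, Finset.prod_range_succ]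
    simp [slope, scale, weight]
  have hpos : ∀ j : ℕ, ∏ l ∈ Finset.range j, y l ≠ 0 := fun j =>
    (Finset.prod_pos fun l _ => by simpa [range_halfLine] using hy l).ne'
  rw [halfLineCoord, key, Finset.prod_range_succ]
  split_ifs with h
  · simp [h]
  · rw [key]
    simp only [show (i : ℕ) - 1 + 1 = i by omega]
    rw [mul_div_cancel_left₀ _ (hpos i)]

lemma momentFunctional_eq (hm : ∀ l, m l = lineMoment y (l + 1)) {q : ℝ[X]}
    (hq : q.natDegree ≤ n) : momentFunctional m q = functionalOfMoments (lineMoment y) q := by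
  rw [momentFunctional, functionalOfMoments, Polynomial.lsum_apply, Polynomial.sum_def,
    Polynomial.sum_def]
  refine Finset.sum_congr rfl fun j hj => ?_
  have hjn := (Polynomial.le_natDegree_of_mem_supp j hj).trans hq
  simp only [LinearMap.smul_apply, LinearMap.id_apply, smul_eq_mul]
  rw [mul_comm]
  congr 1
  split_ifs with h0 h1
  · subst h0; simp [lineMoment, catalanMatrix]
  · rw [hm]; congr 1; simp only; omega
  · omega

lemma lineNorm_ne_zero (hy : ∀ l, y l ∈ line.range l) (j : ℕ) : lineNorm y j ≠ 0 :=
  (Finset.prod_pos fun l _ => by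
    have := hy (2 * l + 1)
    rwa [range_line, if_neg (by simp)] at this).ne'

lemma momentFunctional_linePoly_sq (hm : ∀ l, m l = lineMoment y (l + 1)) {j : ℕ}
    (h : 2 * j ≤ n) : momentFunctional m (linePoly y j ^ 2) = lineNorm y j := by
  rw [momentFunctional_eq hm]
  · exact map_jacobiPoly_sq (N := 2 * j)
      (fun k _ => functionalOfMoments_X_pow (lineMoment y) k) le_rfl
  · rw [linePoly, (monic_jacobiPoly _ _ j).natDegree_pow, natDegree_jacobiPoly]
    exact h

lemma momentFunctional_X_mul_linePoly_sq (hm : ∀ l, m l = lineMoment y (l + 1)) {j : ℕ}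
    (h : 2 * j + 1 ≤ n) :
    momentFunctional m (Polynomial.X * linePoly y j ^ 2) = y (2 * j) * lineNorm y j := by
  rw [momentFunctional_eq hm]
  · exact map_X_mul_jacobiPoly_sq (N := 2 * j + 1)
      (fun k _ => functionalOfMoments_X_pow (lineMoment y) k) le_rfl
  · rw [linePoly, Polynomial.natDegree_X_mul ((monic_jacobiPoly _ _ j).pow 2).ne_zero,
      (monic_jacobiPoly _ _ j).natDegree_pow, natDegree_jacobiPoly]
    exact h

/-- The highest moment entering `P_j` comes from `L (X P_{j-1}²)`, of order `2j - 1`; this is the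
bound `2 * j ≤ n + 1`, under which the truncated functional is the true one. The nonzero norms allow
the quotients to be read off. -/
lemma orthoPoly_momentFunctional (hy : ∀ l, y l ∈ line.range l)
    (hm : ∀ l, m l = lineMoment y (l + 1)) {j : ℕ} (h : 2 * j ≤ n + 1) :
    orthoPoly (momentFunctional m) j = linePoly y j := by
  induction j using Nat.twoStepInduction with
  | zero => rfl
  | one =>
    have h1 := momentFunctional_X_mul_linePoly_sq hm (j := 0) (by omega)
    have h2 := momentFunctional_linePoly_sq hm (j := 0) (by omega)
    simp only [linePoly, jacobiPoly, one_pow, mul_one, lineNorm, Finset.range_zero,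
      Finset.prod_empty] at h1 h2
    simp [orthoPoly, linePoly, jacobiPoly, h1, h2]
  | more j h0 h1 =>
    have hB := lineNorm_ne_zero hy
    rw [orthoPoly, h0 (by omega), h1 (by omega), momentFunctional_linePoly_sq hm (by omega),
      momentFunctional_linePoly_sq hm (by omega), momentFunctional_X_mul_linePoly_sq hm (by omega),
      mul_div_cancel_right₀ _ (hB _)]
    have : lineNorm y (j + 1) / lineNorm y j = y (2 * j + 1) := by
      rw [lineNorm, Finset.prod_range_succ]
      exact mul_div_cancel_left₀ _ (hB _)
    rw [this]
    rfl

lemma lineCoord_eq (hy : ∀ l, y l ∈ line.range l) (hm : ∀ l, m l = lineMoment y (l + 1))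
    (i : Fin n) : lineCoord m i = y i := by
  have hB := lineNorm_ne_zero hy
  have hi := i.2
  rw [lineCoord]
  split_ifs with he
  · obtain ⟨j, hj⟩ := even_iff_exists_two_mul.1 he
    rw [hj, Nat.mul_div_cancel_left _ two_pos, recAlpha,
      orthoPoly_momentFunctional hy hm (by omega), momentFunctional_linePoly_sq hm (by omega),
      momentFunctional_X_mul_linePoly_sq hm (by omega), mul_div_cancel_right₀ _ (hB _)]
  · obtain ⟨j, hj⟩ := Nat.not_even_iff_odd.1 he
    rw [hj, show (2 * j + 1) / 2 = j by omega, recBeta,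
      orthoPoly_momentFunctional hy hm (by omega), orthoPoly_momentFunctional hy hm (by omega),
      momentFunctional_linePoly_sq hm (by omega), momentFunctional_linePoly_sq hm (by omega),
      lineNorm, Finset.prod_range_succ]
    exact mul_div_cancel_left₀ _ (hB _)

lemma coord_eq (E : MomentDomain) (hy : ∀ l, y l ∈ E.range l)
    (hm : ∀ l, m l = E.moment y (l + 1)) (i : Fin n) : E.coord m i = y i := by
  cases E with
  | interval a b hab => exact intervalCoord_eq hab hy hm i
  | halfLine => exact halfLineCoord_eq hy hm i
  | line => exact lineCoord_eq hy hm i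

end Coord

end MomentDomain

/-! ### The polynomial map from coordinates to moments and the interior of the moment space -/

/-- Extension of a vector by zero to a sequence. -/
def extendZero {n : ℕ} (y : Fin n → ℝ) (l : ℕ) : ℝ := if h : l < n then y ⟨l, h⟩ else 0

@[simp] lemma extendZero_coe {n : ℕ} (y : Fin n → ℝ) (i : Fin n) : extendZero y i = y i := by
  simp [extendZero]

lemma contDiff_extendZero {n : ℕ} (l : ℕ) : ContDiff ℝ ⊤ fun y : Fin n → ℝ => extendZero y l := by
  unfold extendZero
  split_ifs
  · exact contDiff_apply ℝ ℝ _
  · exact contDiff_const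

lemma contDiff_catalanMatrix {X : Type*} [NormedAddCommGroup X] [NormedSpace ℝ X]
    {a b : X → ℕ → ℝ} (ha : ∀ j, ContDiff ℝ ⊤ fun x => a x j)
    (hb : ∀ j, ContDiff ℝ ⊤ fun x => b x j) (n j : ℕ) :
    ContDiff ℝ ⊤ fun x => catalanMatrix (a x) (b x) n j := by
  induction n generalizing j with
  | zero => exact contDiff_const
  | succ n ih =>
    cases j with
    | zero => exact ((ha 0).mul (ih 0)).add ((hb 0).mul (ih 1))
    | succ j => exact ((ih j).add ((ha _).mul (ih _))).add ((hb _).mul (ih _))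

lemma contDiff_halfLineMoment {X : Type*} [NormedAddCommGroup X] [NormedSpace ℝ X]
    {z : X → ℕ → ℝ} (hz : ∀ j, ContDiff ℝ ⊤ fun x => z x j) (m : ℕ) :
    ContDiff ℝ ⊤ fun x => halfLineMoment (z x) m := by
  simp only [halfLineMoment, lineMoment_halfLineParam]
  exact contDiff_catalanMatrix (fun _ => contDiff_const) hz _ _

namespace MomentDomain

/-- The moments of order `1, …, n` as functions of the first `n` coordinates. -/
def momentMap (E : MomentDomain) (n : ℕ) (y : Fin n → ℝ) (i : Fin n) : ℝ :=
  E.moment (extendZero y) (i + 1)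

/-- The open range of the first `n` coordinates. -/
def box (E : MomentDomain) (n : ℕ) : Set (Fin n → ℝ) := Set.pi univ fun i => E.range i

lemma isOpen_box (E : MomentDomain) (n : ℕ) : IsOpen (E.box n) :=
  isOpen_set_pi finite_univ fun i _ => E.isOpen_range i

lemma momentMap_eq (E : MomentDomain) {n : ℕ} {y : Fin n → ℝ} {y' : ℕ → ℝ}
    (h : ∀ i : Fin n, y' i = y i) (i : Fin n) : E.momentMap n y i = E.moment y' (i + 1) :=
  E.moment_congr fun l hl => by
    have := h ⟨l, by omega⟩
    simp only at this
    rw [this]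
    exact extendZero_coe y ⟨l, _⟩

lemma exists_extension (E : MomentDomain) {n : ℕ} {y : Fin n → ℝ} (hy : y ∈ E.box n) :
    ∃ y' : ℕ → ℝ, (∀ l, y' l ∈ E.range l) ∧ ∀ i : Fin n, y' i = y i := by
  choose c hc using E.range_nonempty
  refine ⟨fun l => if h : l < n then y ⟨l, h⟩ else c l, fun l => ?_, fun i => by simp⟩
  dsimp only
  split_ifs with h
  · exact hy ⟨l, h⟩ (mem_univ _)
  · exact hc l

lemma coord_momentMap (E : MomentDomain) {n : ℕ} {y : Fin n → ℝ} (hy : y ∈ E.box n) :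
    E.coord (E.momentMap n y) = y := by
  obtain ⟨y', hy', h⟩ := E.exists_extension hy
  ext i
  rw [E.coord_eq hy' (E.momentMap_eq h), h]

lemma injOn_momentMap (E : MomentDomain) (n : ℕ) : InjOn (E.momentMap n) (E.box n) :=
  fun y hy y' hy' h => by rw [← E.coord_momentMap hy, h, E.coord_momentMap hy']

lemma contDiff_momentMap (E : MomentDomain) (n : ℕ) : ContDiff ℝ ⊤ (E.momentMap n) := by
  refine contDiff_pi.2 fun i => ?_
  have h0 := contDiff_extendZero (n := n)
  cases E with
  | interval a b hab =>
    simp only [momentMap, moment, binomialTransform]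
    refine ContDiff.sum fun k _ => contDiff_const.mul (contDiff_halfLineMoment (fun j => ?_) k)
    simp only [chainParam, chainCompl]
    split_ifs
    · exact contDiff_const.mul (h0 _)
    · exact (contDiff_const.sub (h0 _)).mul (h0 _)
  | halfLine => exact contDiff_halfLineMoment h0 _
  | line => exact contDiff_catalanMatrix (fun j => h0 _) (fun j => h0 _) _ _

lemma hasFDerivAt_momentMap (E : MomentDomain) {n : ℕ} (y : Fin n → ℝ) :
    HasFDerivAt (E.momentMap n) (fderiv ℝ (E.momentMap n) y) y :=
  ((E.contDiff_momentMap n).differentiable (by simp) y).hasFDerivAt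

lemma hasDerivAt_momentMap_update (E : MomentDomain) {n : ℕ} (y : Fin n → ℝ) (i j : Fin n) :
    HasDerivAt (fun t => E.momentMap n (Function.update y j t) i)
      (jacobian (E.momentMap n) y i j) (y j) := by
  have h1 : HasFDerivAt (E.momentMap n) (fderiv ℝ (E.momentMap n) y) (Function.update y j (y j)) := by
    rw [Function.update_eq_self]; exact E.hasFDerivAt_momentMap y
  have h2 := h1.comp_hasDerivAt (y j) (hasDerivAt_update y j (y j))
  have h3 := hasDerivAt_pi.1 h2 i
  have h4 : jacobian (E.momentMap n) y i j =
      fderiv ℝ (E.momentMap n) y (Pi.single j 1) i := by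
    simp [jacobian, LinearMap.toMatrix'_apply]
  rw [h4]
  exact h3

lemma update_extendZero {n : ℕ} (y : Fin n → ℝ) (j : Fin n) (t : ℝ) :
    extendZero (Function.update y j t) = Function.update (extendZero y) j t := by
  ext l
  by_cases h : l < n
  · rcases eq_or_ne l j with rfl | hl
    · simp
    · rw [Function.update_of_ne hl, extendZero, extendZero, dif_pos h, dif_pos h,
        Function.update_of_ne (fun h => hl (by rw [← h]))]
  · rw [Function.update_of_ne (by have := j.2; omega), extendZero, extendZero, dif_neg h, dif_neg h]

lemma jacobian_momentMap_self (E : MomentDomain) {n : ℕ} (y : Fin n → ℝ) (i : Fin n) :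
    jacobian (E.momentMap n) y i i = E.slope (extendZero y) i := by
  refine (E.hasDerivAt_momentMap_update y i i).unique ?_
  have : (fun t => E.momentMap n (Function.update y i t) i) = fun t =>
      E.moment (Function.update (extendZero y) i 0) (i + 1) + E.slope (extendZero y) i * t := by
    ext t
    rw [momentMap, update_extendZero, E.moment_update _ i 0 t, sub_zero]
  rw [this]
  have h := ((hasDerivAt_id (y i)).const_mul (E.slope (extendZero y) i)).const_add
    (E.moment (Function.update (extendZero y) i 0) (i + 1))
  rwa [mul_one] at h

lemma jacobian_momentMap_of_lt (E : MomentDomain) {n : ℕ} (y : Fin n → ℝ) {i j : Fin n}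
    (hij : i < j) : jacobian (E.momentMap n) y i j = 0 := by
  refine (E.hasDerivAt_momentMap_update y i j).unique ?_
  have : (fun t => E.momentMap n (Function.update y j t) i) = fun _ =>
      E.moment (extendZero y) (i + 1) := by
    ext t
    rw [momentMap, update_extendZero]
    exact E.moment_congr fun l hl =>
      Function.update_of_ne (by have : (i : ℕ) < j := hij; omega) _ _
  rw [this]
  exact hasDerivAt_const _ _

/-- No moment involves a coordinate of larger index, so the Jacobian is lower triangular with the
slopes on its diagonal. -/
lemma det_fderiv_momentMap (E : MomentDomain) {n : ℕ} (y : Fin n → ℝ) :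
    (fderiv ℝ (E.momentMap n) y).det = ∏ i : Fin n, E.slope (extendZero y) i := by
  rw [ContinuousLinearMap.det, ← LinearMap.det_toMatrix']
  change (jacobian (E.momentMap n) y).det = _
  rw [Matrix.det_of_isLowerTriangular _ fun i j hij => E.jacobian_momentMap_of_lt y hij]
  exact Finset.prod_congr rfl fun i _ => E.jacobian_momentMap_self y i

lemma slope_extendZero_pos (E : MomentDomain) {n : ℕ} {y : Fin n → ℝ} (hy : y ∈ E.box n)
    (i : Fin n) : 0 < E.slope (extendZero y) i :=
  E.slope_pos fun l hl => by
    have h : l < n := by omega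
    rw [show extendZero y l = y ⟨l, h⟩ from extendZero_coe y ⟨l, h⟩]
    exact hy ⟨l, h⟩ (mem_univ _)

lemma det_fderiv_momentMap_pos (E : MomentDomain) {n : ℕ} {y : Fin n → ℝ} (hy : y ∈ E.box n) :
    0 < (fderiv ℝ (E.momentMap n) y).det := by
  rw [det_fderiv_momentMap]
  exact Finset.prod_pos fun i _ => E.slope_extendZero_pos hy i

/-- On the box the determinant is positive, so the strict derivative is surjective and the map sends
neighbourhoods onto neighbourhoods. -/
lemma isOpen_image_momentMap (E : MomentDomain) (n : ℕ) : IsOpen (E.momentMap n '' E.box n) := by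
  rw [isOpen_iff_mem_nhds]
  rintro _ ⟨y, hy, rfl⟩
  have hs : HasStrictFDerivAt (E.momentMap n) (fderiv ℝ (E.momentMap n) y) y :=
    (E.contDiff_momentMap n).contDiffAt.hasStrictFDerivAt (by simp)
  have hdet : IsUnit (LinearMap.det (fderiv ℝ (E.momentMap n) y).toLinearMap) :=
    isUnit_iff_ne_zero.2 (E.det_fderiv_momentMap_pos hy).ne'
  rw [← hs.map_nhds_eq_of_surj ((LinearMap.isUnit_iff_range_eq_top _).1
    ((LinearMap.isUnit_iff_isUnit_det _).2 hdet))]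
  exact image_mem_map ((E.isOpen_box n).mem_nhds hy)

lemma image_momentMap_subset (E : MomentDomain) (n : ℕ) :
    E.momentMap n '' E.box n ⊆ momentSpace E.carrier n := by
  rintro _ ⟨y, hy, rfl⟩
  obtain ⟨y', hy', h⟩ := E.exists_extension hy
  obtain ⟨μ, hμ, hm⟩ := E.exists_momentMeasures_eq hy' n
  exact ⟨μ, hμ, fun i => by rw [E.momentMap_eq h, hm _ (by omega)]⟩

/-- Coordinates are found one at a time. Moving only entry `i` of `m` within the interior gives a
whole neighbourhood of parameters `t` that belong to measures, each in the closed range by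
`exists_moment_eq`. So the parameter of `m` itself is interior to the closed range, hence in the
open range. -/
lemma exists_coord_of_mem_interior (E : MomentDomain) {n : ℕ} {m : Fin n → ℝ}
    (hm : m ∈ interior (momentSpace E.carrier n)) {i : ℕ} (hi : i ≤ n) :
    ∃ y : ℕ → ℝ, (∀ l < i, y l ∈ E.range l) ∧
      ∀ l : Fin n, (l : ℕ) < i → m l = E.moment y (l + 1) := by
  induction i with
  | zero => exact ⟨0, by simp, by simp⟩
  | succ i ih =>
    obtain ⟨y, hy, hym⟩ := ih (by omega)
    set j : Fin n := ⟨i, hi⟩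
    have hK := E.slope_pos hy
    set c := E.moment (Function.update y i 0) (i + 1) with hc
    have hcK : ∀ t, E.moment (Function.update y i t) (i + 1) = c + E.slope y i * t := fun t => by
      rw [E.moment_update y i 0 t, sub_zero]
    set t₀ := (m j - c) / E.slope y i with ht₀
    have hmj : c + E.slope y i * t₀ = m j := by rw [ht₀, mul_div_cancel₀ _ hK.ne']; ring
    have hmem : t₀ ∈ E.range i := by
      rw [← E.interior_closure_range i]
      refine mem_interior.2 ⟨(fun t => Function.update m j (c + E.slope y i * t)) ⁻¹'
        interior (momentSpace E.carrier n), ?_, isOpen_interior.preimage (by fun_prop), ?_⟩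
      · intro t ht
        obtain ⟨μ, hμ, h⟩ := interior_subset (mem_preimage.1 ht)
        have hmom : ∀ k ≤ i, rawMoment μ k = E.moment y k := by
          intro k hk
          rcases k with _ | k
          · have := hμ.1
            simp [rawMoment, moment_zero]
          · rw [← hym ⟨k, by omega⟩ hk, ← h ⟨k, by omega⟩, Function.update_of_ne]
            intro he
            have := congrArg Fin.val he
            simp only [j] at this
            omega
        obtain ⟨s, hs, hs'⟩ := E.exists_moment_eq hμ hy hmom
        have h1 := h j
        rw [Function.update_self] at h1
        rw [hcK, ← h1] at hs'
        have : t = s := mul_left_cancel₀ hK.ne' (by linarith)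
        rwa [this]
      · simp only [mem_preimage, hmj, Function.update_eq_self]
        exact hm
    refine ⟨Function.update y i t₀, fun l hl => ?_, fun l hl => ?_⟩
    · rcases (Nat.lt_succ_iff.1 hl).lt_or_eq with hl | rfl
      · rw [Function.update_of_ne hl.ne]; exact hy l hl
      · rwa [Function.update_self]
    · rcases (Nat.lt_succ_iff.1 hl).lt_or_eq with hl | hl
      · rw [hym l hl]
        exact (E.moment_congr fun k hk => Function.update_of_ne (by omega) _ _).symm
      · have : l = j := Fin.ext hl
        rw [this, hcK, hmj]

lemma interior_momentSpace (E : MomentDomain) (n : ℕ) :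
    interior (momentSpace E.carrier n) = E.momentMap n '' E.box n := by
  refine Subset.antisymm (fun m hm => ?_)
    (interior_maximal (E.image_momentMap_subset n) (E.isOpen_image_momentMap n))
  obtain ⟨y, hy, h⟩ := E.exists_coord_of_mem_interior hm le_rfl
  refine ⟨fun i => y i, fun i _ => hy i i.2, ?_⟩
  ext i
  rw [E.momentMap_eq (fun _ => rfl), h i i.2]

/-- The inverse chosen in `phi` is forced: every interior point is an image of the box, on which the
coordinates invert the polynomial map. -/
lemma phi_eq_momentMap (E : MomentDomain) {n : ℕ} {y : Fin n → ℝ} (hy : y ∈ E.box n) :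
    E.phi n y = E.momentMap n y := by
  have hex : ∃ m ∈ interior (momentSpace E.carrier n), E.coord m = y :=
    ⟨E.momentMap n y, by rw [interior_momentSpace]; exact mem_image_of_mem _ hy,
      E.coord_momentMap hy⟩
  have h1 := Function.invFunOn_mem hex
  have h2 := Function.invFunOn_eq hex
  rw [interior_momentSpace] at h1 h2
  obtain ⟨y', hy', h⟩ := h1
  rw [← h, E.coord_momentMap hy'] at h2
  rw [phi, interior_momentSpace, ← h, h2]

lemma phi_eventuallyEq (E : MomentDomain) {n : ℕ} {y : Fin n → ℝ} (hy : y ∈ E.box n) :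
    E.phi n =ᶠ[𝓝 y] E.momentMap n :=
  eventuallyEq_of_mem ((E.isOpen_box n).mem_nhds hy) fun _ h => E.phi_eq_momentMap h

end MomentDomain

/-! # Contraction of Stieltjes to Jacobi parameters -/

/-- Two steps of a Dyck path between odd levels form one Motzkin step. Returning to level `2j + 1`
goes through `2j`, with weight `z_{2j}`, or through `2j + 2`, with weight `z_{2j+1}`; descending two
levels costs `z_{2j+1} z_{2j+2}`. -/
lemma catalanMatrix_contraction (z : ℕ → ℝ) (n j : ℕ) :
    catalanMatrix (fun _ => 0) z (2 * n + 1) (2 * j + 1) =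
      catalanMatrix (fun j => z (2 * j) + z (2 * j + 1)) (fun j => z (2 * j + 1) * z (2 * j + 2))
        n j := by
  induction n generalizing j with
  | zero => rcases j with _ | j <;> simp [catalanMatrix, mul_add]
  | succ n ih =>
    have h0 : ∀ m k, catalanMatrix (fun _ => 0) z (m + 1) (k + 1) =
        catalanMatrix (fun _ => 0) z m k + z (k + 1) * catalanMatrix (fun _ => 0) z m (k + 2) := by
      intro m k; simp [catalanMatrix]
    have h1 : ∀ m, catalanMatrix (fun _ => 0) z (m + 1) 0 =
        z 0 * catalanMatrix (fun _ => 0) z m 1 := by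
      intro m; simp [catalanMatrix]
    rw [show 2 * (n + 1) + 1 = 2 * n + 1 + 1 + 1 by ring, h0, h0]
    rcases j with _ | j
    · rw [h1, show (0 : ℕ) + 2 + 1 = 2 * 1 + 1 by ring, show (2 * 0 + 1 : ℕ) = 1 by rfl,
        show (1 : ℕ) = 2 * 0 + 1 by rfl, ih, ih]
      simp only [catalanMatrix]
      ring
    · rw [show 2 * (j + 1) = 2 * j + 1 + 1 by ring, h0, show 2 * j + 1 + 2 = 2 * (j + 1) + 1 by ring,
        show 2 * (j + 1) + 1 + 2 = 2 * (j + 2) + 1 by ring, ih, ih, ih]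
      simp only [catalanMatrix, mul_add]
      ring_nf

lemma halfLineMoment_succ (z : ℕ → ℝ) (n : ℕ) :
    halfLineMoment z (n + 1) = z 0 *
      catalanMatrix (fun j => z (2 * j) + z (2 * j + 1)) (fun j => z (2 * j + 1) * z (2 * j + 2))
        n 0 := by
  rw [halfLineMoment, lineMoment_halfLineParam, ← catalanMatrix_contraction]
  simp [catalanMatrix, mul_add]

/-- The sequence `(c₁, c₂, c₁, c₂, …)`. -/
def alternatingSeq (c₁ c₂ : ℝ) (l : ℕ) : ℝ := if Even l then c₁ else c₂

@[simp] lemma alternatingSeq_even (c₁ c₂ : ℝ) (l : ℕ) : alternatingSeq c₁ c₂ (2 * l) = c₁ := by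
  simp [alternatingSeq]

@[simp] lemma alternatingSeq_odd (c₁ c₂ : ℝ) (l : ℕ) : alternatingSeq c₁ c₂ (2 * l + 1) = c₂ := by
  simp [alternatingSeq]

lemma alternatingSeq_even_add_two (c₁ c₂ : ℝ) (l : ℕ) :
    alternatingSeq c₁ c₂ (2 * l + 2) = c₁ := alternatingSeq_even c₁ c₂ (l + 1)

lemma lineMoment_alternatingSeq (c₁ c₂ : ℝ) (n : ℕ) :
    lineMoment (alternatingSeq c₁ c₂) n = catalanMatrix (fun _ => c₁) (fun _ => c₂) n 0 := by
  simp [lineMoment]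

/-- For alternating parameters the contracted coefficients are constant: `x μ(dx) / c₁` has the
moments of a semicircle law with mean `c₁ + c₂` and variance `c₁ c₂`. -/
lemma halfLineMoment_alternatingSeq_succ (c₁ c₂ : ℝ) (n : ℕ) :
    halfLineMoment (alternatingSeq c₁ c₂) (n + 1) =
      c₁ * catalanMatrix (fun _ => c₁ + c₂) (fun _ => c₁ * c₂) n 0 := by
  rw [halfLineMoment_succ]
  simp only [alternatingSeq_even, alternatingSeq_odd, alternatingSeq_even_add_two, mul_comm c₂]
  simp [alternatingSeq]

/-- Changing the first diagonal coefficient by `r` changes the orthogonal polynomials into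
`U_n - r U_{n-1}`. -/
lemma catalanMatrix_perturb {a : ℕ → ℝ} {A B r : ℝ} (h0 : a 0 = A + r) (h : ∀ j, a (j + 1) = A)
    (n j : ℕ) :
    catalanMatrix (fun _ => A) (fun _ => B) n j =
      catalanMatrix a (fun _ => B) n j - r * catalanMatrix a (fun _ => B) n (j + 1) := by
  induction n generalizing j with
  | zero => rcases j with _ | j <;> simp [catalanMatrix]
  | succ n ih =>
    rcases j with _ | j
    · simp only [catalanMatrix, ih, h0, h]; ring
    · simp only [catalanMatrix, ih, h]; ring

/-- The contracted coefficients are constant except that the first diagonal one exceeds the others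
by `p₁ p₂`. Multiplying by `1 - x` repairs this: as `1 - a 0 = (1 - p₁)(1 - p₂)`, the difference of
consecutive moments is a multiple of the combination in `catalanMatrix_perturb`. -/
lemma halfLineMoment_chainParam_alternatingSeq (p₁ p₂ : ℝ) (n : ℕ) :
    halfLineMoment (chainParam (alternatingSeq p₁ p₂)) (n + 1) -
      halfLineMoment (chainParam (alternatingSeq p₁ p₂)) (n + 2) =
      p₁ * (1 - p₁) * (1 - p₂) * catalanMatrix (fun _ => p₁ * (1 - p₂) + p₂ * (1 - p₁))
        (fun _ => p₁ * (1 - p₂) * (p₂ * (1 - p₁))) n 0 := by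
  have z0 : chainParam (alternatingSeq p₁ p₂) 0 = p₁ := by
    simp [chainParam, chainCompl, alternatingSeq]
  have zo : ∀ j, chainParam (alternatingSeq p₁ p₂) (2 * j + 1) = (1 - p₁) * p₂ := fun j => by
    simp [chainParam]
  have ze : ∀ j, chainParam (alternatingSeq p₁ p₂) (2 * j + 2) = (1 - p₂) * p₁ := fun j => by
    rw [chainParam, alternatingSeq_even_add_two, show 2 * j + 2 = 2 * j + 1 + 1 by rfl,
      chainCompl_succ, alternatingSeq_odd]
  rw [halfLineMoment_succ, halfLineMoment_succ]
  have hb : (fun j => chainParam (alternatingSeq p₁ p₂) (2 * j + 1) *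
      chainParam (alternatingSeq p₁ p₂) (2 * j + 2)) =
      fun _ => p₁ * (1 - p₂) * (p₂ * (1 - p₁)) := by
    ext j; rw [zo, ze]; ring
  rw [hb]
  set a := fun j => chainParam (alternatingSeq p₁ p₂) (2 * j) +
    chainParam (alternatingSeq p₁ p₂) (2 * j + 1) with ha
  have ha0 : a 0 = p₁ * (1 - p₂) + p₂ * (1 - p₁) + p₁ * p₂ := by
    have := zo 0
    simp only [mul_zero, zero_add] at this
    simp only [ha, mul_zero, zero_add, z0, this]
    ring
  have haj : ∀ j, a (j + 1) = p₁ * (1 - p₂) + p₂ * (1 - p₁) := fun j => by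
    simp only [ha, zo, show 2 * (j + 1) = 2 * j + 2 by ring, ze]
    ring
  rw [catalanMatrix_perturb ha0 haj, z0, catalanMatrix, ha0]
  ring

/-! # The moments of the semicircle law -/

/-- A criterion to recognize moments: if each `P_j` with `j > 0` integrates to 0, then
multiplication by `X` through the recurrence determines the rest. -/
lemma map_X_pow_mul_jacobiPoly_of_orthogonal {a b : ℕ → ℝ} {L : ℝ[X] →ₗ[ℝ] ℝ}
    (hL : ∀ j, L (jacobiPoly a b j) = if j = 0 then 1 else 0) (m j : ℕ) :
    L (Polynomial.X ^ m * jacobiPoly a b j) =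
      (∏ l ∈ Finset.range j, b l) * catalanMatrix a b m j := by
  induction m generalizing j with
  | zero => rcases j with _ | j <;> simp [hL, catalanMatrix]
  | succ m ih =>
    rcases j with _ | j
    · have e : Polynomial.X ^ (m + 1) * jacobiPoly a b 0 =
          Polynomial.X ^ m * jacobiPoly a b 1 +
            Polynomial.C (a 0) * (Polynomial.X ^ m * jacobiPoly a b 0) := by
        simp only [jacobiPoly]; ring
      rw [e, map_add, map_C_mul, ih, ih]
      simp [catalanMatrix]
      ring
    · have e : Polynomial.X ^ (m + 1) * jacobiPoly a b (j + 1) =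
          Polynomial.X ^ m * jacobiPoly a b (j + 2) +
            Polynomial.C (a (j + 1)) * (Polynomial.X ^ m * jacobiPoly a b (j + 1)) +
            Polynomial.C (b j) * (Polynomial.X ^ m * jacobiPoly a b j) := by
        rw [jacobiPoly]; ring
      rw [e, map_add, map_add, map_C_mul, map_C_mul, ih, ih, ih]
      simp only [catalanMatrix, Finset.prod_range_succ]
      ring

/-- Constant coefficients give rescaled Chebyshev polynomials of the second kind, `s ^ n U_n(cos
θ)`. -/
lemma eval_jacobiPoly_const (α s θ : ℝ) (n : ℕ) :
    (jacobiPoly (fun _ => α) (fun _ => s ^ 2) n).eval (α + 2 * s * Real.cos θ) * Real.sin θ =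
      s ^ n * Real.sin ((n + 1) * θ) := by
  induction n using Nat.twoStepInduction with
  | zero => simp [jacobiPoly]
  | one =>
    rw [show ((1 : ℕ) + 1 : ℝ) * θ = 2 * θ by norm_num, Real.sin_two_mul]
    simp [jacobiPoly]
    ring
  | more n h0 h1 =>
    have h2 : Real.sin (((n + 2 : ℕ) + 1 : ℝ) * θ) =
        2 * Real.cos θ * Real.sin (((n + 1 : ℕ) + 1 : ℝ) * θ) - Real.sin ((n + 1) * θ) := by
      have e1 : ((n + 2 : ℕ) + 1 : ℝ) * θ = ((n + 1 : ℕ) + 1 : ℝ) * θ + θ := by push_cast; ring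
      have e2 : (n + 1 : ℝ) * θ = ((n + 1 : ℕ) + 1 : ℝ) * θ - θ := by push_cast; ring
      rw [e1, e2, Real.sin_add, Real.sin_sub]
      ring
    rw [h2, jacobiPoly]
    simp only [Polynomial.eval_sub, Polynomial.eval_mul, Polynomial.eval_X, Polynomial.eval_C,
      sub_mul]
    linear_combination (2 * s * Real.cos θ) * h1 - s ^ 2 * h0

/-- Integration against the semicircle law with mean `α` and variance `s²`, in the angular
variable. -/
def semicircleFunctional (α s : ℝ) : ℝ[X] →ₗ[ℝ] ℝ where
  toFun q := 2 / Real.pi * ∫ θ in (0)..Real.pi, Real.sin θ ^ 2 * q.eval (α + 2 * s * Real.cos θ)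
  map_add' p q := by
    rw [← mul_add, ← intervalIntegral.integral_add]
    · simp only [Polynomial.eval_add, mul_add]
    · exact (by fun_prop : Continuous _).intervalIntegrable _ _
    · exact (by fun_prop : Continuous _).intervalIntegrable _ _
  map_smul' c q := by
    have h : ∀ θ, Real.sin θ ^ 2 * (c • q).eval (α + 2 * s * Real.cos θ) =
        c * (Real.sin θ ^ 2 * q.eval (α + 2 * s * Real.cos θ)) := fun θ => by
      rw [Polynomial.eval_smul, smul_eq_mul]; ring
    simp_rw [h]
    rw [intervalIntegral.integral_const_mul, RingHom.id_apply, smul_eq_mul, mul_left_comm]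

lemma integral_sin_mul_sin (n : ℕ) :
    ∫ θ in (0)..Real.pi, Real.sin ((n + 1) * θ) * Real.sin θ =
      if n = 0 then Real.pi / 2 else 0 := by
  split_ifs with h
  · subst h
    simp only [Nat.cast_zero, zero_add, one_mul, ← sq, integral_sin_sq]
    simp
  · have hn : (n : ℝ) ≠ 0 := Nat.cast_ne_zero.2 h
    have hn2 : (n : ℝ) + 2 ≠ 0 := by positivity
    have hd : ∀ θ ∈ uIcc 0 Real.pi, HasDerivAt
        (fun θ => Real.sin (n * θ) / (2 * n) - Real.sin ((n + 2) * θ) / (2 * (n + 2)))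
        (Real.sin ((n + 1) * θ) * Real.sin θ) θ := by
      intro θ _
      have h1 := ((hasDerivAt_id θ).const_mul (n : ℝ)).sin.div_const (2 * n)
      have h2 := ((hasDerivAt_id θ).const_mul ((n : ℝ) + 2)).sin.div_const (2 * (n + 2))
      refine (h1.sub h2).congr_deriv ?_
      have e1 : (n : ℝ) * θ = (n + 1) * θ - θ := by ring
      have e2 : ((n : ℝ) + 2) * θ = (n + 1) * θ + θ := by ring
      rw [id, e1, e2, Real.cos_sub, Real.cos_add]
      field_simp
      ring
    rw [intervalIntegral.integral_eq_sub_of_hasDerivAt hd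
      ((by fun_prop : Continuous _).intervalIntegrable _ _)]
    have e1 : Real.sin (((n : ℝ) + 2) * Real.pi) = 0 := by
      exact_mod_cast Real.sin_nat_mul_pi (n + 2)
    simp [Real.sin_nat_mul_pi, e1]

/-- In the angular variable `P_j` times `sin² θ` is `s ^ j sin((j + 1) θ) sin θ`, so orthogonality
of sines supplies the criterion above. -/
lemma semicircleFunctional_X_pow (α s : ℝ) (m : ℕ) :
    semicircleFunctional α s (Polynomial.X ^ m) =
      catalanMatrix (fun _ => α) (fun _ => s ^ 2) m 0 := by
  have := map_X_pow_mul_jacobiPoly_of_orthogonal (a := fun _ => α) (b := fun _ => s ^ 2)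
    (L := semicircleFunctional α s) (fun j => ?_) m 0
  · simpa [jacobiPoly] using this
  · have e : ∀ θ, Real.sin θ ^ 2 * (jacobiPoly (fun _ => α) (fun _ => s ^ 2) j).eval
        (α + 2 * s * Real.cos θ) = s ^ j * (Real.sin ((j + 1) * θ) * Real.sin θ) := fun θ => by
      rw [← mul_assoc, ← eval_jacobiPoly_const α]; ring
    simp only [semicircleFunctional, LinearMap.coe_mk, AddHom.coe_mk]
    simp_rw [e]
    rw [intervalIntegral.integral_const_mul, integral_sin_mul_sin]
    split_ifs with h
    · subst h
      have := Real.pi_ne_zero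
      field_simp
    · simp

/-- Substitute `x = α + 2 s cos θ`; square root and differential each contribute a factor `2 s sin
θ`, and the reversed orientation accounts for the sign. -/
lemma integral_sqrt_mul (α : ℝ) {s : ℝ} (hs : 0 ≤ s) {f : ℝ → ℝ} (hf : Continuous f) :
    ∫ x in (α - 2 * s)..(α + 2 * s), √((x - (α - 2 * s)) * ((α + 2 * s) - x)) * f x =
      4 * s ^ 2 * ∫ θ in (0)..Real.pi, Real.sin θ ^ 2 * f (α + 2 * s * Real.cos θ) := by
  have h := intervalIntegral.integral_comp_mul_deriv (a := 0) (b := Real.pi)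
    (f := fun θ => α + 2 * s * Real.cos θ) (f' := fun θ => 2 * s * (-Real.sin θ))
    (g := fun x => √((x - (α - 2 * s)) * ((α + 2 * s) - x)) * f x)
    (fun θ _ => ((Real.hasDerivAt_cos θ).const_mul (2 * s)).const_add α)
    (by fun_prop) (by fun_prop)
  simp only [Real.cos_zero, Real.cos_pi, mul_one, mul_neg, ← sub_eq_add_neg] at h
  rw [intervalIntegral.integral_symm, ← h, ← intervalIntegral.integral_neg,
    ← intervalIntegral.integral_const_mul]
  refine intervalIntegral.integral_congr fun θ hθ => ?_
  rw [uIcc_of_le Real.pi_pos.le] at hθ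
  have hsin := Real.sin_nonneg_of_mem_Icc hθ
  have e : (α + 2 * s * Real.cos θ - (α - 2 * s)) * (α + 2 * s - (α + 2 * s * Real.cos θ)) =
      (2 * s * Real.sin θ) ^ 2 := by
    have := Real.sin_sq_add_cos_sq θ
    linear_combination (-(2 * s) ^ 2) * this
  simp only [Function.comp_apply, e]
  rw [Real.sqrt_sq (by positivity)]
  ring

/-! # The integral of `√((x - lo) (hi - x)) / x` -/

lemma sqrt_div_primitive {lo hi : ℝ} (hlo : 0 ≤ lo) (hlt : lo < hi) :
    IntervalIntegrable (fun x => √((x - lo) * (hi - x)) / x) volume lo hi ∧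
      ∫ x in lo..hi, √((x - lo) * (hi - x)) / x =
        Real.pi * ((lo + hi) / 2 - √(lo * hi)) := by
  set M := (lo + hi) / 2 with hM
  set R := (hi - lo) / 2 with hR
  set g := √(lo * hi) with hg
  have hRpos : 0 < R := by rw [hR]; linarith
  have hhi : 0 < hi := by linarith
  have hg2 : g ^ 2 = lo * hi := Real.sq_sqrt (by positivity)
  have hg0 : 0 ≤ g := Real.sqrt_nonneg _
  clear_value M R g
  -- A primitive. With `S² = 2 M x - x² - g²` the three terms have derivatives `(M - x) / S`, `M /
  -- S` and `g² / (x S)`; the first two minus the third add up to `S / x`.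
  let F : ℝ → ℝ := fun x => √((x - lo) * (hi - x)) + M * Real.arcsin ((x - M) / R) -
    g * Real.arcsin (M / R - g ^ 2 / R * x⁻¹)
  have hcont : ContinuousOn F (Icc lo hi) := by
    refine ContinuousOn.sub (by fun_prop) ?_
    -- If `lo = 0` the argument of the second arcsine is singular at 0, but its factor `g` vanishes.
    rcases hlo.eq_or_lt with h | h
    · have : g = 0 := by rw [hg, ← h]; simp
      simp only [this, zero_mul]
      exact continuousOn_const
    · refine continuousOn_const.mul (Real.continuous_arcsin.comp_continuousOn ?_)
      refine continuousOn_const.sub (continuousOn_const.mul ?_)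
      exact continuousOn_id.inv₀ fun x hx => by have := hx.1; simp only [id]; linarith
  have hderiv : ∀ x ∈ Ioo lo hi, HasDerivAt F (√((x - lo) * (hi - x)) / x) x := by
    intro x hx
    have hx0 : 0 < x := by linarith [hx.1]
    have hQ : 0 < (x - lo) * (hi - x) := mul_pos (by linarith [hx.1]) (by linarith [hx.2])
    set S := √((x - lo) * (hi - x)) with hS
    have hSpos : 0 < S := Real.sqrt_pos.2 hQ
    have hS2 : S ^ 2 = (x - lo) * (hi - x) := Real.sq_sqrt hQ.le
    clear_value S
    have hQ' : S ^ 2 = 2 * M * x - x ^ 2 - g ^ 2 := by rw [hS2, hg2, hM]; ring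
    have hR2 : R ^ 2 = M ^ 2 - g ^ 2 := by rw [hg2, hM, hR]; ring
    have h1 : HasDerivAt (fun x => √((x - lo) * (hi - x))) ((M - x) / S) x := by
      have := (((hasDerivAt_id x).sub_const lo).mul ((hasDerivAt_id x).const_sub hi)).sqrt hQ.ne'
      refine this.congr_deriv ?_
      simp only [id, Pi.mul_apply]
      rw [← hS, hM]
      field_simp
      ring
    have h2 : HasDerivAt (fun x => Real.arcsin ((x - M) / R)) (1 / S) x := by
      have e : 1 - ((x - M) / R) ^ 2 = (S / R) ^ 2 := by
        rw [div_pow, div_pow, hQ', eq_div_iff (by positivity), sub_mul,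
          div_mul_cancel₀ _ (by positivity), hR2]
        ring
      have hlt1 : ((x - M) / R) ^ 2 < 1 := by
        have : 0 < (S / R) ^ 2 := by positivity
        linarith
      have hne1 : (x - M) / R ≠ -1 := by intro h; rw [h] at hlt1; norm_num at hlt1
      have hne2 : (x - M) / R ≠ 1 := by intro h; rw [h] at hlt1; norm_num at hlt1
      have := (Real.hasDerivAt_arcsin hne1 hne2).comp x
        (((hasDerivAt_id x).sub_const M).div_const R)
      refine this.congr_deriv ?_
      rw [e, Real.sqrt_sq (by positivity)]
      field_simp
    have h3 : HasDerivAt (fun x => g * Real.arcsin (M / R - g ^ 2 / R * x⁻¹))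
        (g ^ 2 / (x * S)) x := by
      rcases hg0.eq_or_lt with h | hgpos
      · rw [← h]
        simpa using hasDerivAt_const x (0 : ℝ)
      · have e : 1 - (M / R - g ^ 2 / R * x⁻¹) ^ 2 = (g * S / (R * x)) ^ 2 := by
          rw [div_pow, mul_pow, hQ', mul_pow, eq_div_iff (by positivity)]
          field_simp
          rw [hR2]
          ring
        have hlt1 : (M / R - g ^ 2 / R * x⁻¹) ^ 2 < 1 := by
          have : 0 < (g * S / (R * x)) ^ 2 := by positivity
          linarith
        have hne1 : M / R - g ^ 2 / R * x⁻¹ ≠ -1 := by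
          intro h; rw [h] at hlt1; norm_num at hlt1
        have hne2 : M / R - g ^ 2 / R * x⁻¹ ≠ 1 := by
          intro h; rw [h] at hlt1; norm_num at hlt1
        have := ((Real.hasDerivAt_arcsin hne1 hne2).comp x
          (((hasDerivAt_inv hx0.ne').const_mul (g ^ 2 / R)).const_sub (M / R))).const_mul g
        refine this.congr_deriv ?_
        rw [e, Real.sqrt_sq (by positivity)]
        field_simp
    refine ((h1.add (h2.const_mul M)).sub h3).congr_deriv ?_
    rw [div_add' _ _ _ hSpos.ne', div_sub_div _ _ hSpos.ne' (by positivity),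
      div_eq_div_iff (by positivity) hx0.ne']
    field_simp
    linear_combination -hQ'
  -- The integrand may be unbounded when `lo = 0`; it is integrable as the nonnegative derivative of
  -- a function continuous up to the end points.
  have hint : IntervalIntegrable (fun x => √((x - lo) * (hi - x)) / x) volume lo hi := by
    refine intervalIntegral.intervalIntegrable_deriv_of_nonneg (g := F) (by rwa [uIcc_of_le hlt.le])
      ?_ ?_
    · rwa [min_eq_left hlt.le, max_eq_right hlt.le]
    · rw [min_eq_left hlt.le, max_eq_right hlt.le]
      intro x hx
      exact div_nonneg (Real.sqrt_nonneg _) (by linarith [hx.1])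
  refine ⟨hint, ?_⟩
  rw [intervalIntegral.integral_eq_sub_of_hasDerivAt_of_le hlt.le hcont hderiv hint]
  have a1 : (hi - M) / R = 1 := by rw [div_eq_one_iff_eq hRpos.ne', hM, hR]; ring
  have a2 : (lo - M) / R = -1 := by rw [div_eq_iff hRpos.ne', hM, hR]; ring
  have a3 : M / R - g ^ 2 / R * hi⁻¹ = 1 := by
    rw [hg2]; field_simp; rw [hM, hR]; ring
  simp only [F, a1, a2, a3, sub_self, zero_mul, mul_zero, Real.sqrt_zero, Real.arcsin_one,
    Real.arcsin_neg_one]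
  rcases hlo.eq_or_lt with h | h
  · have : g = 0 := by rw [hg, ← h]; simp
    rw [this]; ring
  · have a4 : M / R - g ^ 2 / R * lo⁻¹ = -1 := by
      rw [hg2]; field_simp; rw [hM, hR]; ring
    rw [a4, Real.arcsin_neg_one]
    ring

lemma integral_sqrt_div_sub {a lo hi : ℝ} (hlo : a ≤ lo) (hlt : lo < hi) :
    IntervalIntegrable (fun x => √((x - lo) * (hi - x)) / (x - a)) volume lo hi ∧
      ∫ x in lo..hi, √((x - lo) * (hi - x)) / (x - a) =
        Real.pi * ((lo + hi) / 2 - a - √((lo - a) * (hi - a))) := by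
  obtain ⟨h1, h2⟩ := sqrt_div_primitive (sub_nonneg.2 hlo) (sub_lt_sub_right hlt a)
  have e : ∀ x, √((x - a - (lo - a)) * (hi - a - (x - a))) / (x - a) =
      √((x - lo) * (hi - x)) / (x - a) := fun x => by ring_nf
  have h3 := h1.comp_sub_right a
  simp only [sub_add_cancel, e] at h3
  refine ⟨h3, ?_⟩
  have h4 := intervalIntegral.integral_comp_sub_right (a := lo) (b := hi)
    (fun x => √((x - (lo - a)) * (hi - a - x)) / x) a
  simp only [e] at h4
  rw [h4, h2]
  ring

lemma integral_sqrt_div_sub' {b lo hi : ℝ} (hhi : hi ≤ b) (hlt : lo < hi) :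
    IntervalIntegrable (fun x => √((x - lo) * (hi - x)) / (b - x)) volume lo hi ∧
      ∫ x in lo..hi, √((x - lo) * (hi - x)) / (b - x) =
        Real.pi * (b - (lo + hi) / 2 - √((b - lo) * (b - hi))) := by
  obtain ⟨h1, h2⟩ := sqrt_div_primitive (sub_nonneg.2 hhi) (sub_lt_sub_left hlt b)
  have e : ∀ x, √((b - x - (b - hi)) * (b - lo - (b - x))) / (b - x) =
      √((x - lo) * (hi - x)) / (b - x) := fun x => by ring_nf
  have h3 := (h1.comp_sub_left b).symm
  simp only [sub_sub_cancel, e] at h3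
  refine ⟨h3, ?_⟩
  have h4 := intervalIntegral.integral_comp_sub_left (a := lo) (b := hi)
    (fun x => √((x - (b - hi)) * (b - lo - x)) / x) b
  simp only [e] at h4
  rw [h4, h2]
  ring_nf

/-! # Measures with a density on a compact interval -/

section Density

variable {lo hi : ℝ} {ρ : ℝ → ℝ}

lemma integral_withDensity_Icc (hle : lo ≤ hi) (hρ : IntervalIntegrable ρ volume lo hi)
    (h0 : ∀ x ∈ Icc lo hi, 0 ≤ ρ x) {f : ℝ → ℝ} (hf : Continuous f) :
    Integrable f ((volume.restrict (Icc lo hi)).withDensity fun x => ENNReal.ofReal (ρ x)) ∧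
      ∫ x, f x ∂((volume.restrict (Icc lo hi)).withDensity fun x => ENNReal.ofReal (ρ x)) =
        ∫ x in lo..hi, ρ x * f x := by
  have hρ' : IntegrableOn ρ (Icc lo hi) := (intervalIntegrable_iff_integrableOn_Icc_of_le hle).1 hρ
  have hm : AEMeasurable (fun x => ENNReal.ofReal (ρ x)) (volume.restrict (Icc lo hi)) :=
    hρ'.aemeasurable.ennreal_ofReal
  have hlt : ∀ᵐ x ∂(volume.restrict (Icc lo hi)), ENNReal.ofReal (ρ x) < ⊤ :=
    ae_of_all _ fun x => ENNReal.ofReal_lt_top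
  have hae : (fun x => (ENNReal.ofReal (ρ x)).toReal • f x) =ᵐ[volume.restrict (Icc lo hi)]
      fun x => ρ x * f x := by
    filter_upwards [ae_restrict_mem measurableSet_Icc] with x hx
    rw [ENNReal.toReal_ofReal (h0 x hx), smul_eq_mul]
  have hint : IntegrableOn (fun x => ρ x * f x) (Icc lo hi) :=
    hρ'.mul_continuousOn hf.continuousOn isCompact_Icc
  constructor
  · rw [integrable_withDensity_iff_integrable_smul₀' hm hlt]
    exact hint.congr hae.symm
  · rw [integral_withDensity_eq_integral_toReal_smul₀ hm hlt, integral_congr_ae hae,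
      intervalIntegral.integral_of_le hle, integral_Icc_eq_integral_Ioc]

lemma withDensity_Icc_compl {s : Set ℝ} (hs : Icc lo hi ⊆ s) :
    ((volume.restrict (Icc lo hi)).withDensity fun x => ENNReal.ofReal (ρ x)) sᶜ = 0 := by
  refine withDensity_absolutelyContinuous _ _ ?_
  rw [Measure.restrict_apply' measurableSet_Icc]
  convert measure_empty (μ := (volume : Measure ℝ))
  ext x
  simp only [mem_inter_iff, mem_compl_iff, mem_empty_iff_false, iff_false, not_and]
  exact fun h h' => h (hs h')

end Density

lemma isProbabilityMeasure_of_integral_one {μ : Measure ℝ} (h : Integrable (fun _ => (1 : ℝ)) μ)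
    (h1 : ∫ _, (1 : ℝ) ∂μ = 1) : IsProbabilityMeasure μ := by
  have : IsFiniteMeasure μ := by simpa [integrable_const_iff] using h
  constructor
  simp only [integral_const, smul_eq_mul, mul_one, measureReal_def] at h1
  exact (ENNReal.toReal_eq_one_iff _).1 h1

/-! # The limit measures -/

lemma alternatingSeq_mem_range {E : MomentDomain} {y₁ y₂ : ℝ} (h₁ : y₁ ∈ E.range₁)
    (h₂ : y₂ ∈ E.range₂) (l : ℕ) : alternatingSeq y₁ y₂ l ∈ E.range l := by
  rw [alternatingSeq, MomentDomain.range]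
  split_ifs
  exacts [h₁, h₂]

lemma semicircle_moments (α : ℝ) {β : ℝ} (hβ : 0 < β) :
    semicircle α β ∈ momentMeasures univ ∧
      ∀ m, rawMoment (semicircle α β) m = lineMoment (alternatingSeq α β) m := by
  set s := √β with hs
  have hs0 : 0 < s := Real.sqrt_pos.2 hβ
  have hs2 : s ^ 2 = β := Real.sq_sqrt hβ.le
  set ρ : ℝ → ℝ := fun x => 1 / (2 * Real.pi * β) * √((x - (α - 2 * s)) * ((α + 2 * s) - x))
  have hρ : Continuous ρ := by fun_prop
  have hρ0 : ∀ x, 0 ≤ ρ x := fun x => by positivity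
  have hμ : semicircle α β = (volume.restrict (Icc (α - 2 * s) (α + 2 * s))).withDensity
    fun x => ENNReal.ofReal (ρ x) := rfl
  have key := fun m : ℕ => integral_withDensity_Icc (lo := α - 2 * s) (hi := α + 2 * s) (ρ := ρ)
    (by linarith) (hρ.intervalIntegrable _ _) (fun x _ => hρ0 x) (continuous_pow m)
  rw [← hμ] at key
  have hm : ∀ m, rawMoment (semicircle α β) m = lineMoment (alternatingSeq α β) m := by
    intro m
    rw [rawMoment, (key m).2, lineMoment_alternatingSeq, ← hs2, ← semicircleFunctional_X_pow]
    simp only [ρ, mul_assoc (1 / (2 * Real.pi * β))]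
    rw [intervalIntegral.integral_const_mul, integral_sqrt_mul α hs0.le (continuous_pow m)]
    simp only [semicircleFunctional, LinearMap.coe_mk, AddHom.coe_mk, Polynomial.eval_pow,
      Polynomial.eval_X]
    rw [← mul_assoc, hs2]
    congr 1
    field_simp
    norm_num
  refine ⟨⟨?_, by simp, fun j => (key j).1⟩, hm⟩
  have h0 := hm 0
  have h1 := (key 0).1
  simp only [rawMoment, pow_zero] at h0 h1
  refine isProbabilityMeasure_of_integral_one h1 ?_
  rw [h0]
  simp [lineMoment, catalanMatrix]

/-- Writes the mass of an atom, a positive part, with an absolute value, so that it combines with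
the `|z₁ - z₂|`-type term of the absolutely continuous mass. -/
lemma two_mul_ofReal_toReal (x : ℝ) : 2 * (ENNReal.ofReal x).toReal = x + |x| := by
  rcases le_total 0 x with h | h
  · rw [ENNReal.toReal_ofReal h, abs_of_nonneg h]; ring
  · rw [ENNReal.ofReal_of_nonpos h, abs_of_nonpos h]; simp

/-- For orders at least 1 the atom at 0 drops out and a factor `x` cancels the denominator, leaving
a semicircle density. Order 0 is the explicit integral plus the atom, and gives total mass 1. -/
lemma marchenkoPastur_moments {z₁ z₂ : ℝ} (h₁ : 0 < z₁) (h₂ : 0 < z₂) :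
    marchenkoPastur z₁ z₂ ∈ momentMeasures (Ici 0) ∧
      ∀ m, rawMoment (marchenkoPastur z₁ z₂) m = halfLineMoment (alternatingSeq z₁ z₂) m := by
  set u := √z₁ with hu
  set v := √z₂ with hv
  have hu0 : 0 < u := Real.sqrt_pos.2 h₁
  have hv0 : 0 < v := Real.sqrt_pos.2 h₂
  have hu2 : u ^ 2 = z₁ := Real.sq_sqrt h₁.le
  have hv2 : v ^ 2 = z₂ := Real.sq_sqrt h₂.le
  have huv : 0 < u * v := mul_pos hu0 hv0
  set lo := (u - v) ^ 2 with hlo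
  set hi := (u + v) ^ 2 with hhi
  have hlo0 : 0 ≤ lo := sq_nonneg _
  have hlt : lo < hi := by rw [hlo, hhi]; nlinarith
  have elo : lo = z₁ + z₂ - 2 * (u * v) := by rw [hlo, ← hu2, ← hv2]; ring
  have ehi : hi = z₁ + z₂ + 2 * (u * v) := by rw [hhi, ← hu2, ← hv2]; ring
  set ρ : ℝ → ℝ := fun x => 1 / (2 * Real.pi * z₂) * (√((x - lo) * (hi - x)) / x) with hρdef
  obtain ⟨hI, hIval⟩ := sqrt_div_primitive hlo0 hlt
  have hρ : IntervalIntegrable ρ volume lo hi := hI.const_mul _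
  have hρ0 : ∀ x ∈ Icc lo hi, 0 ≤ ρ x := fun x hx => by
    have : 0 ≤ x := hlo0.trans hx.1
    positivity
  set ν := (volume.restrict (Icc lo hi)).withDensity fun x => ENNReal.ofReal (ρ x)
  set w := ENNReal.ofReal (1 - z₁ / z₂) with hw
  have hμ : marchenkoPastur z₁ z₂ = w • Measure.dirac 0 + ν := rfl
  have key := fun m : ℕ => integral_withDensity_Icc hlt.le hρ hρ0 (continuous_pow m)
  have hdirac : ∀ m : ℕ, Integrable (fun x : ℝ => x ^ m) (w • Measure.dirac 0) := fun m =>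
    (integrable_dirac (by simp)).smul_measure ENNReal.ofReal_ne_top
  have hmom : ∀ m, rawMoment (marchenkoPastur z₁ z₂) m =
      w.toReal * 0 ^ m + ∫ x in lo..hi, ρ x * x ^ m := by
    intro m
    rw [rawMoment, hμ, integral_add_measure (hdirac m) (key m).1, (key m).2, integral_smul_measure,
      integral_dirac, smul_eq_mul]
  have hm : ∀ m, rawMoment (marchenkoPastur z₁ z₂) m =
      halfLineMoment (alternatingSeq z₁ z₂) m := by
    intro m
    rw [hmom]
    rcases m with _ | m
    · simp only [pow_zero, mul_one, hρdef]
      rw [intervalIntegral.integral_const_mul, hIval]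
      have e1 : √(lo * hi) = |z₁ - z₂| := by
        rw [← Real.sqrt_sq_eq_abs]
        congr 1
        rw [hlo, hhi, ← hu2, ← hv2]; ring
      have e2 := two_mul_ofReal_toReal (1 - z₁ / z₂)
      have e3 : |1 - z₁ / z₂| = |z₁ - z₂| / z₂ := by
        rw [← abs_of_pos h₂, ← abs_div, abs_of_pos h₂, sub_div, div_self h₂.ne', abs_sub_comm]
      rw [e3] at e2
      rw [e1, elo, ehi]
      have e4 : w.toReal = (1 - z₁ / z₂ + |z₁ - z₂| / z₂) / 2 := by rw [hw]; linarith
      rw [e4]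
      simp only [halfLineMoment, lineMoment, catalanMatrix, if_true]
      have := Real.pi_pos
      field_simp
      ring
    · rw [halfLineMoment_alternatingSeq_succ, pow_succ, mul_zero, mul_zero, zero_add]
      have e : ∀ x ∈ uIcc lo hi, ρ x * x ^ (m + 1) =
          1 / (2 * Real.pi * z₂) * (√((x - (z₁ + z₂ - 2 * (u * v))) *
            (z₁ + z₂ + 2 * (u * v) - x)) * x ^ m) := by
        intro x hx
        rw [uIcc_of_le hlt.le] at hx
        rw [← elo, ← ehi]
        -- Cancelling `x` fails only at `x = 0`, which lies in the support only if `lo = 0`; there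
        -- both sides are 0.
        rcases eq_or_ne x 0 with h | h
        · have : lo = 0 := le_antisymm (by rw [← h]; exact hx.1) hlo0
          simp [hρdef, h, this]
        · simp only [hρdef]
          field_simp
          ring
      rw [intervalIntegral.integral_congr e, intervalIntegral.integral_const_mul, elo, ehi,
        integral_sqrt_mul _ huv.le (continuous_pow m), show z₁ * z₂ = (u * v) ^ 2 by
          rw [← hu2, ← hv2]; ring, ← semicircleFunctional_X_pow]
      simp only [semicircleFunctional, LinearMap.coe_mk, AddHom.coe_mk, Polynomial.eval_pow,
        Polynomial.eval_X]
      generalize (∫ θ in (0)..Real.pi,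
        Real.sin θ ^ 2 * (z₁ + z₂ + 2 * (u * v) * Real.cos θ) ^ m) = I
      have := Real.pi_pos
      rw [← hu2, ← hv2]
      field_simp
      ring
  refine ⟨⟨?_, ?_, fun j => ?_⟩, hm⟩
  · refine isProbabilityMeasure_of_integral_one ?_ ?_
    · have h1 := (key 0).1
      have h2 := hdirac 0
      simp only [pow_zero] at h1 h2
      exact hμ ▸ h2.add_measure h1
    · have h0 := hm 0
      simp only [rawMoment, pow_zero] at h0
      rw [h0]
      simp [halfLineMoment, lineMoment, catalanMatrix]
  · have hsub : Icc lo hi ⊆ Ici 0 := fun x hx => hlo0.trans hx.1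
    rw [hμ, Measure.add_apply, withDensity_Icc_compl hsub]
    simp
  · exact hμ ▸ (hdirac j).add_measure (key j).1

/-- In the variable `(x - a) / c`, with moments `T n`, the factor `x (1 - x)` kills both atoms and
the denominator, so `T (n + 1) - T (n + 2)` is a multiple of a semicircle moment. Together with `T
0` and `T 1`, from partial fractions and the explicit integrals, this determines all moments. -/
lemma freeBinomial_moments {a b : ℝ} (hab : a < b) {p₁ p₂ : ℝ} (h₁ : p₁ ∈ Ioo (0 : ℝ) 1)
    (h₂ : p₂ ∈ Ioo (0 : ℝ) 1) :
    freeBinomial a b p₁ p₂ ∈ momentMeasures (Icc a b) ∧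
      ∀ m, rawMoment (freeBinomial a b p₁ p₂) m =
        binomialTransform a (b - a) (halfLineMoment (chainParam (alternatingSeq p₁ p₂))) m := by
  obtain ⟨hp₁, hp₁'⟩ := h₁
  obtain ⟨hp₂, hp₂'⟩ := h₂
  have hq₁ : 0 < 1 - p₁ := by linarith
  have hq₂ : 0 < 1 - p₂ := by linarith
  set c := b - a with hc
  have hc0 : 0 < c := sub_pos.2 hab
  set u := √(p₁ * (1 - p₂)) with hu
  set v := √(p₂ * (1 - p₁)) with hv
  have hu0 : 0 < u := Real.sqrt_pos.2 (by positivity)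
  have hv0 : 0 < v := Real.sqrt_pos.2 (by positivity)
  have hu2 : u ^ 2 = p₁ * (1 - p₂) := Real.sq_sqrt (by positivity)
  have hv2 : v ^ 2 = p₂ * (1 - p₁) := Real.sq_sqrt (by positivity)
  have huv : 0 < u * v := mul_pos hu0 hv0
  -- The arithmetic-geometric mean inequality for `p₁ p₂` and `q₁ q₂`; it yields `(u + v)² ≤ 1`,
  -- that is `hi ≤ b`.
  have huv2 : 2 * (u * v) ≤ p₁ * p₂ + (1 - p₁) * (1 - p₂) := by
    refine abs_le_of_sq_le_sq' ?_ (by positivity) |>.2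
    have : (2 * (u * v)) ^ 2 = 4 * (u ^ 2 * v ^ 2) := by ring
    rw [this, hu2, hv2]
    nlinarith [sq_nonneg (p₁ * p₂ - (1 - p₁) * (1 - p₂))]
  set lo := a + c * (u - v) ^ 2 with hlo
  set hi := a + c * (u + v) ^ 2 with hhi
  have hloa : a ≤ lo := by rw [hlo]; have := mul_nonneg hc0.le (sq_nonneg (u - v)); linarith
  have hlt : lo < hi := by
    have := mul_pos hc0 huv
    rw [hlo, hhi]; nlinarith
  have hhib : hi ≤ b := by
    have : (u + v) ^ 2 ≤ 1 := by
      have : (u + v) ^ 2 = u ^ 2 + v ^ 2 + 2 * (u * v) := by ring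
      rw [this, hu2, hv2]; linarith
    have := mul_le_mul_of_nonneg_left this hc0.le
    rw [hhi]; linarith
  set A := p₁ * (1 - p₂) + p₂ * (1 - p₁) with hA
  have elo : lo = a + c * A - 2 * (c * (u * v)) := by rw [hlo, hA, ← hu2, ← hv2]; ring
  have ehi : hi = a + c * A + 2 * (c * (u * v)) := by rw [hhi, hA, ← hu2, ← hv2]; ring
  have hdet1 : √((lo - a) * (hi - a)) = c * |p₁ - p₂| := by
    rw [← abs_of_pos hc0, ← abs_mul, ← Real.sqrt_sq_eq_abs]
    congr 1
    have : (lo - a) * (hi - a) = (c * (u ^ 2 - v ^ 2)) ^ 2 := by rw [hlo, hhi]; ring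
    rw [this, hu2, hv2]; ring
  have hdet2 : √((b - lo) * (b - hi)) = c * |p₁ + p₂ - 1| := by
    rw [← abs_of_pos hc0, ← abs_mul, ← Real.sqrt_sq_eq_abs]
    congr 1
    have : (b - lo) * (b - hi) = c ^ 2 * (1 - 2 * (u ^ 2 + v ^ 2) + (u ^ 2 - v ^ 2) ^ 2) := by
      rw [hlo, hhi, show b = a + c by rw [hc]; ring]; ring
    rw [this, hu2, hv2]; ring
  set ρ : ℝ → ℝ := fun x => √((x - lo) * (hi - x)) / (2 * Real.pi * p₂ * (x - a) * (b - x))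
    with hρdef
  set wa := ENNReal.ofReal (1 - p₁ / p₂) with hwa
  set wb := ENNReal.ofReal ((p₁ + p₂ - 1) / p₂) with hwb
  clear_value c u v lo hi
  have hpi := Real.pi_pos
  obtain ⟨hI, hIval⟩ := integral_sqrt_div_sub hloa hlt
  obtain ⟨hJ, hJval⟩ := integral_sqrt_div_sub' hhib hlt
  rw [hdet1] at hIval
  rw [hdet2] at hJval
  -- A zero of the denominator lies in the support only as one of its end points, where the square
  -- root vanishes as well.
  have hcases : ∀ x ∈ Icc lo hi, √((x - lo) * (hi - x)) = 0 ∨ (x - a ≠ 0 ∧ b - x ≠ 0) := by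
    intro x hx
    by_cases hx1 : x = a
    · left
      rw [hx1, show a - lo = 0 by rw [hx1] at hx; linarith [hx.1]]
      simp
    by_cases hx2 : x = b
    · left
      rw [hx2, show hi - b = 0 by rw [hx2] at hx; linarith [hx.2]]
      simp
    exact Or.inr ⟨sub_ne_zero.2 hx1, sub_ne_zero.2 (Ne.symm hx2)⟩
  have hbx : ∀ x, b - x = c - (x - a) := fun x => by rw [hc]; ring
  have hρeq : ∀ x ∈ Icc lo hi, 1 / (2 * Real.pi * p₂ * c) * (√((x - lo) * (hi - x)) / (x - a) +
      √((x - lo) * (hi - x)) / (b - x)) = ρ x := by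
    intro x hx
    simp only [hρdef]
    rcases hcases x hx with h | ⟨h, h'⟩
    · rw [h]; simp
    · rw [div_add_div _ _ h h', mul_comm (x - a) (√_), ← mul_add,
        show b - x + (x - a) = c by rw [hc]; ring]
      field_simp
  have hρ : IntervalIntegrable ρ volume lo hi := by
    refine ((hI.add hJ).const_mul (1 / (2 * Real.pi * p₂ * c))).congr ?_
    intro x hx
    rw [uIoc_of_le hlt.le] at hx
    exact hρeq x (Ioc_subset_Icc_self hx)
  have hρ0 : ∀ x ∈ Icc lo hi, 0 ≤ ρ x := fun x hx => by
    have h1 : 0 ≤ x - a := by linarith [hx.1]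
    have h2 : 0 ≤ b - x := by linarith [hx.2]
    simp only [hρdef]
    positivity
  set ν := (volume.restrict (Icc lo hi)).withDensity fun x => ENNReal.ofReal (ρ x)
  have hμ : freeBinomial a b p₁ p₂ = ν + wa • Measure.dirac a + wb • Measure.dirac b := by
    simp only [ν, hρdef, hlo, hhi, hwa, hwb, hc, hu, hv]
    rfl
  have key : ∀ f : ℝ → ℝ, Continuous f → Integrable f (freeBinomial a b p₁ p₂) ∧
      ∫ x, f x ∂(freeBinomial a b p₁ p₂) =
        (∫ x in lo..hi, ρ x * f x) + wa.toReal * f a + wb.toReal * f b := by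
    intro f hf
    obtain ⟨k1, k2⟩ := integral_withDensity_Icc hlt.le hρ hρ0 hf
    have ka : Integrable f (wa • Measure.dirac a) :=
      (integrable_dirac (by simp)).smul_measure ENNReal.ofReal_ne_top
    have kb : Integrable f (wb • Measure.dirac b) :=
      (integrable_dirac (by simp)).smul_measure ENNReal.ofReal_ne_top
    rw [hμ]
    refine ⟨(k1.add_measure ka).add_measure kb, ?_⟩
    rw [integral_add_measure (k1.add_measure ka) kb, integral_add_measure k1 ka, k2,
      integral_smul_measure, integral_smul_measure, integral_dirac, integral_dirac, smul_eq_mul,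
      smul_eq_mul]
  set T : ℕ → ℝ := fun n => ∫ x, ((x - a) / c) ^ n ∂(freeBinomial a b p₁ p₂) with hT
  have hTcont : ∀ n : ℕ, Continuous fun x : ℝ => ((x - a) / c) ^ n := fun n => by fun_prop
  have hTval : ∀ n, T n = (∫ x in lo..hi, ρ x * ((x - a) / c) ^ n) + wa.toReal * 0 ^ n +
      wb.toReal := fun n => by
    simp only [hT]
    rw [(key _ (hTcont n)).2, sub_self, zero_div, ← hc, div_self hc0.ne', one_pow, mul_one]
  have hwb' : wb.toReal = ((p₁ + p₂ - 1) / p₂ + |p₁ + p₂ - 1| / p₂) / 2 := by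
    have := two_mul_ofReal_toReal ((p₁ + p₂ - 1) / p₂)
    rw [abs_div, abs_of_pos hp₂] at this
    rw [hwb]; linarith
  have hwa' : wa.toReal = (1 - p₁ / p₂ + |p₁ - p₂| / p₂) / 2 := by
    have := two_mul_ofReal_toReal (1 - p₁ / p₂)
    have e : |1 - p₁ / p₂| = |p₁ - p₂| / p₂ := by
      rw [show 1 - p₁ / p₂ = -((p₁ - p₂) / p₂) by field_simp; ring, abs_neg, abs_div,
        abs_of_pos hp₂]
    rw [e] at this
    rw [hwa]; linarith
  have hT0 : T 0 = 1 := by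
    rw [hTval]
    simp only [pow_zero, mul_one]
    have e : ∫ x in lo..hi, ρ x = ∫ x in lo..hi, 1 / (2 * Real.pi * p₂ * c) *
        (√((x - lo) * (hi - x)) / (x - a) + √((x - lo) * (hi - x)) / (b - x)) :=
      intervalIntegral.integral_congr fun x hx => by
        rw [uIcc_of_le hlt.le] at hx
        exact (hρeq x hx).symm
    rw [e, intervalIntegral.integral_const_mul, intervalIntegral.integral_add hI hJ, hIval, hJval,
      hwa', hwb', show b = a + c by rw [hc]; ring]
    field_simp
    ring
  have hT1 : T 1 = p₁ := by
    rw [hTval]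
    have e : ∫ x in lo..hi, ρ x * ((x - a) / c) ^ 1 = ∫ x in lo..hi, 1 / (2 * Real.pi * p₂ * c) *
        (√((x - lo) * (hi - x)) / (b - x)) :=
      intervalIntegral.integral_congr fun x hx => by
        rw [uIcc_of_le hlt.le] at hx
        simp only [hρdef]
        rcases hcases x hx with h | ⟨h, h'⟩
        · rw [h]; simp
        · field_simp
    rw [e, intervalIntegral.integral_const_mul, hJval, hwb', elo, ehi, hA,
      show b = a + c by rw [hc]; ring]
    field_simp
    ring
  have hTsucc : ∀ n, T (n + 1) - T (n + 2) = p₁ * (1 - p₁) * (1 - p₂) *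
      catalanMatrix (fun _ => p₁ * (1 - p₂) + p₂ * (1 - p₁))
        (fun _ => p₁ * (1 - p₂) * (p₂ * (1 - p₁))) n 0 := by
    intro n
    have hi1 : ∀ m : ℕ, IntervalIntegrable (fun x => ρ x * ((x - a) / c) ^ m) volume lo hi :=
      fun m => hρ.mul_continuousOn (hTcont m).continuousOn
    have e0 : T (n + 1) - T (n + 2) =
        ∫ x in lo..hi, ρ x * ((x - a) / c) ^ (n + 1) - ρ x * ((x - a) / c) ^ (n + 2) := by
      rw [hTval, hTval, intervalIntegral.integral_sub (hi1 _) (hi1 _)]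
      simp
    have e : ∀ x ∈ uIcc lo hi, ρ x * ((x - a) / c) ^ (n + 1) - ρ x * ((x - a) / c) ^ (n + 2) =
        1 / (2 * Real.pi * p₂ * c ^ 2) * (√((x - (a + c * A - 2 * (c * (u * v)))) *
            (a + c * A + 2 * (c * (u * v)) - x)) * ((x - a) / c) ^ n) := by
      intro x hx
      rw [uIcc_of_le hlt.le] at hx
      rw [← elo, ← ehi]
      simp only [hρdef]
      rcases hcases x hx with h | ⟨h, h'⟩
      · rw [h]; simp
      · rw [show √((x - lo) * (hi - x)) / (2 * Real.pi * p₂ * (x - a) * (b - x)) *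
            ((x - a) / c) ^ (n + 1) - √((x - lo) * (hi - x)) /
            (2 * Real.pi * p₂ * (x - a) * (b - x)) * ((x - a) / c) ^ (n + 2) =
            √((x - lo) * (hi - x)) / (2 * Real.pi * p₂ * (x - a) * (b - x)) *
            ((x - a) / c * (1 - (x - a) / c)) * ((x - a) / c) ^ n by ring,
          show 1 - (x - a) / c = (b - x) / c by
            rw [hbx, sub_div c, div_self hc0.ne']]
        generalize ((x - a) / c) ^ n = y
        field_simp
    rw [e0, intervalIntegral.integral_congr e, intervalIntegral.integral_const_mul,
      elo, ehi, integral_sqrt_mul _ (mul_pos hc0 huv).le (hTcont n), ← hA,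
      show p₁ * (1 - p₂) * (p₂ * (1 - p₁)) = (u * v) ^ 2 by rw [mul_pow, hu2, hv2],
      ← semicircleFunctional_X_pow]
    simp only [semicircleFunctional, LinearMap.coe_mk, AddHom.coe_mk, Polynomial.eval_pow,
      Polynomial.eval_X]
    have e3 : ∀ θ, (a + c * A + 2 * (c * (u * v)) * Real.cos θ - a) / c =
        A + 2 * (u * v) * Real.cos θ := fun θ => by field_simp; ring
    simp_rw [e3]
    generalize (∫ θ in (0)..Real.pi,
      Real.sin θ ^ 2 * (A + 2 * (u * v) * Real.cos θ) ^ n) = I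
    have e4 : 1 / (2 * Real.pi * p₂ * c ^ 2) * (4 * (c * (u * v)) ^ 2 * I) =
        1 / (2 * Real.pi * p₂ * c ^ 2) * (4 * c ^ 2 * (u ^ 2 * v ^ 2) * I) := by ring
    rw [e4, hu2, hv2]
    field_simp
    ring
  have hTall : ∀ n, T n = halfLineMoment (chainParam (alternatingSeq p₁ p₂)) n := by
    have h0 : halfLineMoment (chainParam (alternatingSeq p₁ p₂)) 0 = 1 := by
      simp [halfLineMoment, lineMoment, catalanMatrix]
    have h1 : halfLineMoment (chainParam (alternatingSeq p₁ p₂)) 1 = p₁ := by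
      rw [halfLineMoment_succ]
      simp [catalanMatrix, chainParam, chainCompl, alternatingSeq]
    intro n
    induction n using Nat.twoStepInduction with
    | zero => rw [hT0, h0]
    | one => rw [hT1, h1]
    | more n _ ih =>
      have h2 := hTsucc n
      have h3 := halfLineMoment_chainParam_alternatingSeq p₁ p₂ n
      linarith
  have hm : ∀ m, rawMoment (freeBinomial a b p₁ p₂) m =
      binomialTransform a c (halfLineMoment (chainParam (alternatingSeq p₁ p₂))) m := by
    intro m
    have hpow : ∀ x : ℝ, x ^ m = ∑ k ∈ Finset.range (m + 1),
        ((m.choose k : ℝ) * a ^ (m - k) * c ^ k) * ((x - a) / c) ^ k := by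
      intro x
      conv_lhs => rw [show x = c * ((x - a) / c) + a by field_simp; ring, add_pow]
      exact Finset.sum_congr rfl fun k _ => by rw [mul_pow]; ring
    rw [rawMoment]
    simp_rw [hpow]
    rw [integral_finsetSum _ fun k _ => ((key _ (hTcont k)).1).const_mul _, binomialTransform]
    exact Finset.sum_congr rfl fun k _ => by rw [integral_const_mul, ← hTall k]
  refine ⟨⟨?_, ?_, fun j => (key _ (continuous_pow j)).1⟩, hm⟩
  · refine isProbabilityMeasure_of_integral_one (key _ continuous_const).1 ?_
    have h := hT0
    simp only [hT, pow_zero] at h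
    exact h
  · have hsub : Icc lo hi ⊆ Icc a b := Icc_subset_Icc hloa hhib
    rw [hμ, Measure.add_apply, Measure.add_apply, withDensity_Icc_compl hsub]
    simp [hab.le]

/-- The limit measure belongs to `𝒫(E)`, and its coordinates are `(y₁, y₂, y₁, y₂, …)`. -/
lemma MomentDomain.limitMeasure_moments (E : MomentDomain) {y₁ y₂ : ℝ} (h₁ : y₁ ∈ E.range₁)
    (h₂ : y₂ ∈ E.range₂) : E.limitMeasure y₁ y₂ ∈ momentMeasures E.carrier ∧
      ∀ m, rawMoment (E.limitMeasure y₁ y₂) m = E.moment (alternatingSeq y₁ y₂) m := by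
  cases E with
  | interval a b hab => exact freeBinomial_moments hab h₁ h₂
  | halfLine => exact marchenkoPastur_moments h₁ h₂
  | line => exact semicircle_moments y₁ h₂

/-! # The Jacobian on the half-line at constant coordinates -/

lemma binomInt_succ (n : ℕ) (r : ℤ) :
    binomInt (n + 1) r = binomInt n r + binomInt n (r - 1) := by
  rcases lt_trichotomy r 0 with h | rfl | h
  · simp [binomInt, not_le.2 h, show ¬ (1 : ℤ) ≤ r by omega]
  · simp [binomInt]
  · obtain ⟨m, rfl⟩ : ∃ m : ℕ, r = m + 1 := ⟨(r - 1).toNat, by omega⟩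
    have h1 : ((m : ℤ) + 1).toNat = m + 1 := by omega
    rw [binomInt, binomInt, binomInt, if_pos (by omega), if_pos (by omega), if_pos (by omega), h1,
      add_sub_cancel_right, Int.toNat_natCast, Nat.choose_succ_succ]
    push_cast
    ring

lemma binomInt_of_neg (n : ℕ) {r : ℤ} (h : r < 0) : binomInt n r = 0 := if_neg (not_le.2 h)

lemma binomInt_symm (k : ℕ) : binomInt (2 * k + 1) (k + 1 : ℤ) = binomInt (2 * k + 1) (k : ℤ) := by
  rw [binomInt, binomInt, if_pos (by omega), if_pos (by omega), Int.toNat_natCast,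
    show ((k : ℤ) + 1).toNat = k + 1 by omega, Nat.choose_symm_half]

section Const

variable (z : ℝ)

/-- Weighted Dyck path counts: the ballot numbers. -/
lemma catalanMatrix_const (n h k : ℕ) (hn : n = h + 2 * k) :
    catalanMatrix (fun _ => 0) (fun _ => z) n h =
      z ^ k * (binomInt n k - binomInt n (k - 1 : ℤ)) := by
  induction n generalizing h k with
  | zero =>
    obtain rfl : h = 0 := by omega
    obtain rfl : k = 0 := by omega
    simp [catalanMatrix, binomInt]
  | succ n ih =>
    rw [binomInt_succ, binomInt_succ]
    rcases h with _ | h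
    · obtain ⟨k, rfl⟩ : ∃ m, k = m + 1 := ⟨k - 1, by omega⟩
      obtain rfl : n = 2 * k + 1 := by omega
      rw [catalanMatrix, ih 1 k (by omega)]
      push_cast
      rw [binomInt_symm, show (k : ℤ) + 1 - 1 = k by ring]
      ring
    · rw [catalanMatrix, ih h k (by omega)]
      rcases k with _ | k
      · rw [catalanMatrix_of_lt (show n < h + 2 by omega)]
        simp [binomInt_of_neg]
      · rw [ih (h + 2) k (by omega)]
        push_cast
        rw [show (k : ℤ) + 1 - 1 = k by ring]
        ring

/-- The derivative of the weighted path counts with respect to the weight of level `j`. -/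
def catalanDeriv (j n h : ℕ) : ℝ :=
  if h ≤ j then ∑ l ∈ Finset.range (h + 1),
    z ^ (j - h + l) * catalanMatrix (fun _ => 0) (fun _ => z) n (2 * j + 2 - h + 2 * l)
  else ∑ l ∈ Finset.range (j + 1),
    z ^ l * catalanMatrix (fun _ => 0) (fun _ => z) n (h + 2 + 2 * l)

lemma catalanDeriv_zero (j h : ℕ) : catalanDeriv z j 0 h = 0 := by
  rw [catalanDeriv]
  split_ifs with hj
  · exact Finset.sum_eq_zero fun l _ => by rw [catalanMatrix_of_lt (by omega), mul_zero]
  · exact Finset.sum_eq_zero fun l _ => by rw [catalanMatrix_of_lt (by omega), mul_zero]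

lemma catalanDeriv_of_ge {j n h : ℕ} (hj : j ≤ h) : catalanDeriv z j n h =
    ∑ l ∈ Finset.range (j + 1),
      z ^ l * catalanMatrix (fun _ => 0) (fun _ => z) n (h + 2 + 2 * l) := by
  rw [catalanDeriv]
  split_ifs with h1
  · obtain rfl : h = j := le_antisymm h1 hj
    refine Finset.sum_congr rfl fun l _ => ?_
    rw [show h - h + l = l by omega, show 2 * h + 2 - h + 2 * l = h + 2 + 2 * l by omega]
  · rfl

lemma catalanMatrix_const_succ (n : ℕ) {k : ℕ} (hk : 0 < k) :
    catalanMatrix (fun _ => 0) (fun _ => z) (n + 1) k =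
      catalanMatrix (fun _ => 0) (fun _ => z) n (k - 1) +
        z * catalanMatrix (fun _ => 0) (fun _ => z) n (k + 1) := by
  obtain ⟨k, rfl⟩ : ∃ m, k = m + 1 := ⟨k - 1, by omega⟩
  simp [catalanMatrix]

/-- Differentiating the path recursion reproduces it with a source term at level `j`. This lemma and
`catalanDeriv_succ_succ` check that the closed form solves that recursion; its two branches agree at
`h = j`. -/
lemma catalanDeriv_succ_zero (j n : ℕ) : catalanDeriv z j (n + 1) 0 =
    z * catalanDeriv z j n 1 +
      if j = 0 then catalanMatrix (fun _ => 0) (fun _ => z) n 1 else 0 := by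
  rcases j with _ | j
  · rw [catalanDeriv_of_ge z le_rfl, catalanDeriv_of_ge z (by omega)]
    simp [catalanMatrix]
    ring
  · rw [catalanDeriv, if_pos (by omega), catalanDeriv, if_pos (by omega), if_neg (by omega)]
    simp only [Finset.sum_range_succ, Finset.range_zero, Finset.sum_empty]
    rw [catalanMatrix_const_succ z n (by omega)]
    simp only [mul_zero, add_zero, zero_add, Nat.sub_zero, Nat.add_sub_cancel]
    rw [show 2 * (j + 1) + 2 - 1 + 2 * 1 = 2 * (j + 1) + 2 + 1 by omega]
    ring

lemma catalanDeriv_succ_succ (j n h : ℕ) : catalanDeriv z j (n + 1) (h + 1) =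
    catalanDeriv z j n h + z * catalanDeriv z j n (h + 2) +
      if j = h + 1 then catalanMatrix (fun _ => 0) (fun _ => z) n (h + 2) else 0 := by
  rcases lt_trichotomy (h + 1) j with hj | rfl | hj
  · obtain ⟨r, rfl⟩ : ∃ r, j = h + 2 + r := ⟨j - (h + 2), by omega⟩
    rw [catalanDeriv, if_pos (by omega), catalanDeriv, if_pos (by omega), catalanDeriv,
      if_pos (by omega), if_neg (by omega), add_zero]
    have e1 : ∀ l ∈ Finset.range (h + 1 + 1), z ^ (h + 2 + r - (h + 1) + l) *
        catalanMatrix (fun _ => 0) (fun _ => z) (n + 1) (2 * (h + 2 + r) + 2 - (h + 1) + 2 * l) =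
        z * (z ^ (r + l) * catalanMatrix (fun _ => 0) (fun _ => z) n (h + 4 + 2 * r + 2 * l)) +
        z ^ (r + 2 + l) * catalanMatrix (fun _ => 0) (fun _ => z) n (h + 6 + 2 * r + 2 * l) := by
      intro l _
      rw [catalanMatrix_const_succ z n (by omega), show h + 2 + r - (h + 1) + l = r + l + 1 by omega,
        show 2 * (h + 2 + r) + 2 - (h + 1) + 2 * l - 1 = h + 4 + 2 * r + 2 * l by omega,
        show 2 * (h + 2 + r) + 2 - (h + 1) + 2 * l + 1 = h + 6 + 2 * r + 2 * l by omega]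
      ring
    have e2 : ∀ l ∈ Finset.range (h + 1), z ^ (h + 2 + r - h + l) *
        catalanMatrix (fun _ => 0) (fun _ => z) n (2 * (h + 2 + r) + 2 - h + 2 * l) =
        z ^ (r + 2 + l) * catalanMatrix (fun _ => 0) (fun _ => z) n (h + 6 + 2 * r + 2 * l) := by
      intro l _
      rw [show h + 2 + r - h + l = r + 2 + l by omega,
        show 2 * (h + 2 + r) + 2 - h + 2 * l = h + 6 + 2 * r + 2 * l by omega]
    have e3 : ∀ l ∈ Finset.range (h + 2 + 1), z ^ (h + 2 + r - (h + 2) + l) *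
        catalanMatrix (fun _ => 0) (fun _ => z) n (2 * (h + 2 + r) + 2 - (h + 2) + 2 * l) =
        z ^ (r + l) * catalanMatrix (fun _ => 0) (fun _ => z) n (h + 4 + 2 * r + 2 * l) := by
      intro l _
      rw [show h + 2 + r - (h + 2) + l = r + l by omega,
        show 2 * (h + 2 + r) + 2 - (h + 2) + 2 * l = h + 4 + 2 * r + 2 * l by omega]
    rw [Finset.sum_congr rfl e1, Finset.sum_congr rfl e2, Finset.sum_congr rfl e3,
      Finset.sum_add_distrib, ← Finset.mul_sum, Finset.sum_range_succ _ (h + 2),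
      Finset.sum_range_succ (fun l => z ^ (r + 2 + l) *
        catalanMatrix (fun _ => 0) (fun _ => z) n (h + 6 + 2 * r + 2 * l)) (h + 1),
      show h + 4 + 2 * r + 2 * (h + 2) = h + 6 + 2 * r + 2 * (h + 1) by ring]
    ring
  · rw [catalanDeriv_of_ge z le_rfl, catalanDeriv_of_ge z (h := h + 2) (by omega), catalanDeriv,
      if_pos (by omega), if_pos rfl]
    have e1 : ∀ l ∈ Finset.range (h + 1 + 1), z ^ l *
        catalanMatrix (fun _ => 0) (fun _ => z) (n + 1) (h + 1 + 2 + 2 * l) =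
        z ^ l * catalanMatrix (fun _ => 0) (fun _ => z) n (h + 2 + 2 * l) +
        z * (z ^ l * catalanMatrix (fun _ => 0) (fun _ => z) n (h + 2 + 2 + 2 * l)) := by
      intro l _
      rw [catalanMatrix_const_succ z n (by omega),
        show h + 1 + 2 + 2 * l - 1 = h + 2 + 2 * l by omega,
        show h + 1 + 2 + 2 * l + 1 = h + 2 + 2 + 2 * l by omega]
      ring
    rw [Finset.sum_congr rfl e1, Finset.sum_add_distrib, ← Finset.mul_sum, Finset.sum_range_succ']
    have e2 : ∀ l ∈ Finset.range (h + 1), z ^ (l + 1) *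
        catalanMatrix (fun _ => 0) (fun _ => z) n (h + 2 + 2 * (l + 1)) =
        z ^ (h + 1 - h + l) *
        catalanMatrix (fun _ => 0) (fun _ => z) n (2 * (h + 1) + 2 - h + 2 * l) := by
      intro l _
      rw [show h + 1 - h + l = l + 1 by omega,
        show 2 * (h + 1) + 2 - h + 2 * l = h + 2 + 2 * (l + 1) by omega]
    rw [Finset.sum_congr rfl e2]
    simp only [pow_zero, mul_zero, add_zero, one_mul]
    ring
  · rw [catalanDeriv_of_ge z (by omega), catalanDeriv_of_ge z (by omega),
      catalanDeriv_of_ge z (by omega), if_neg (by omega), add_zero, Finset.mul_sum,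
      ← Finset.sum_add_distrib]
    refine Finset.sum_congr rfl fun l _ => ?_
    rw [catalanMatrix_const_succ z n (by omega),
      show h + 1 + 2 + 2 * l - 1 = h + 2 + 2 * l by omega,
      show h + 1 + 2 + 2 * l + 1 = h + 2 + 2 + 2 * l by omega]
    ring

lemma hasDerivAt_catalanMatrix_update (j n h : ℕ) :
    HasDerivAt (fun t => catalanMatrix (fun _ => 0) (Function.update (fun _ => z) j t) n h)
      (catalanDeriv z j n h) z := by
  have hup : ∀ k, HasDerivAt (fun t => Function.update (fun _ : ℕ => z) j t k)
      (if j = k then 1 else 0) z := by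
    intro k
    split_ifs with hk
    · subst hk; simpa using hasDerivAt_id' z
    · simpa [Function.update_of_ne (Ne.symm hk)] using hasDerivAt_const z z
  have hz : Function.update (fun _ : ℕ => z) j z = fun _ => z :=
    Function.update_eq_self j fun _ : ℕ => z
  induction n generalizing h with
  | zero =>
    rw [catalanDeriv_zero]
    exact hasDerivAt_const _ _
  | succ n ih =>
    rcases h with _ | h
    · rw [catalanDeriv_succ_zero]
      simp only [catalanMatrix, zero_mul, zero_add]
      refine ((hup 0).mul (ih 1)).congr_deriv ?_
      simp only [hz, ite_mul, one_mul, zero_mul]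
      ring
    · rw [catalanDeriv_succ_succ]
      simp only [catalanMatrix, zero_mul, add_zero]
      refine ((ih h).add ((hup (h + 1)).mul (ih (h + 2)))).congr_deriv ?_
      simp only [hz, ite_mul, one_mul, zero_mul]
      ring

end Const

/-- At level 0 the closed form of the derivative is the single term `z ^ j` times the count of paths
of length `2i + 2` ending at level `2j + 2`: a ballot number with `i - j` down steps, or zero if `j
> i`. -/
lemma MomentDomain.jacobian_momentMap_halfLine {k : ℕ} (z : ℝ) (i j : Fin k) :
    jacobian (halfLine.momentMap k) (fun _ => z) i j = z ^ (i : ℕ) *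
      (binomInt (2 * (i + 1)) ((i : ℤ) - j) - binomInt (2 * (i + 1)) ((i : ℤ) - j - 1)) := by
  have h1 := halfLine.hasDerivAt_momentMap_update (fun _ : Fin k => z) i j
  have e : (fun t => halfLine.momentMap k (Function.update (fun _ => z) j t) i) = fun t =>
      catalanMatrix (fun _ => 0) (Function.update (fun _ => z) (j : ℕ) t) (2 * (i + 1)) 0 := by
    ext t
    rw [← lineMoment_halfLineParam]
    refine halfLine.momentMap_eq (fun l => ?_) i
    rcases eq_or_ne l j with rfl | hl
    · simp
    · rw [Function.update_of_ne hl, Function.update_of_ne fun h => hl (Fin.ext h)]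
  rw [e] at h1
  rw [h1.unique (hasDerivAt_catalanMatrix_update z j (2 * (i + 1)) 0), catalanDeriv,
    if_pos (by omega)]
  simp only [zero_add, Finset.range_one, Finset.sum_singleton, Nat.sub_zero, mul_zero, add_zero]
  rcases le_or_gt (j : ℕ) i with hji | hji
  · rw [catalanMatrix_const z _ _ (i - j : ℕ) (by omega), ← mul_assoc, ← pow_add,
      show (j : ℕ) + (i - j) = i by omega, Nat.cast_sub hji]
  · rw [catalanMatrix_of_lt (by omega), binomInt_of_neg _ (by omega), binomInt_of_neg _ (by omega)]
    simp

/-! # Laplace's method -/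

/-- Second order Taylor expansion at a local minimum. -/
lemma isLittleO_sub_sq_of_isLocalMin {W : ℝ → ℝ} {R : Set ℝ} {y : ℝ} (hR : IsOpen R) (hy : y ∈ R)
    (hW : ContDiffOn ℝ 2 W R) (hmin : IsLocalMin W y) :
    (fun x => W x - W y - iteratedDeriv 2 W y / 2 * (x - y) ^ 2) =o[𝓝 y]
      fun x => (x - y) ^ 2 := by
  obtain ⟨δ, hδ, hsub⟩ := Metric.isOpen_iff.1 hR y hy
  have hyb : y ∈ Metric.ball y δ := Metric.mem_ball_self hδ
  have h := taylor_isLittleO (f := W) (n := 2) (convex_ball y δ) hyb (hW.mono hsub)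
  rw [Metric.isOpen_ball.nhdsWithin_eq hyb] at h
  refine h.congr' (Eventually.of_forall fun x => ?_) EventuallyEq.rfl
  have h1 : iteratedDerivWithin 1 W (Metric.ball y δ) y = 0 := by
    rw [iteratedDerivWithin_of_isOpen Metric.isOpen_ball hyb, iteratedDeriv_one]
    exact hmin.deriv_eq_zero
  have h2 : iteratedDerivWithin 2 W (Metric.ball y δ) y = iteratedDeriv 2 W y :=
    iteratedDerivWithin_of_isOpen Metric.isOpen_ball hyb
  have h3 : taylorWithinEval W 2 (Metric.ball y δ) y x =
      W y + iteratedDeriv 2 W y / 2 * (x - y) ^ 2 := by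
    rw [taylorWithinEval_succ, taylorWithinEval_succ, taylor_within_zero_eval]
    simp only [zero_add, Nat.reduceAdd, h1, h2]
    norm_num
    ring
  simp only [h3]
  ring

/-- The second derivative at a minimum is positive if it does not vanish. -/
lemma iteratedDeriv_two_pos_of_isLocalMin {W : ℝ → ℝ} {R : Set ℝ} {y : ℝ} (hR : IsOpen R)
    (hy : y ∈ R) (hW : ContDiffOn ℝ 2 W R) (hmin : IsLocalMin W y)
    (hκ : iteratedDeriv 2 W y ≠ 0) : 0 < iteratedDeriv 2 W y := by
  by_contra hneg
  have hlt : iteratedDeriv 2 W y < 0 := lt_of_le_of_ne (not_lt.1 hneg) hκ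
  -- With second derivative `κ < 0` this error bound gives `W x ≤ W y + κ / 4 * (x - y) ^ 2 < W y`
  -- for `x ≠ y` near `y`, against minimality.
  have h := (isLittleO_sub_sq_of_isLocalMin hR hy hW hmin).def
    (c := -iteratedDeriv 2 W y / 4) (by linarith)
  obtain ⟨δ, hδ, hb⟩ := Metric.eventually_nhds_iff.1 (h.and hmin)
  obtain ⟨h1, h2⟩ := hb (y := y + δ / 2) (by
    rw [Real.dist_eq, add_sub_cancel_left, abs_of_pos] <;> linarith)
  rw [Real.norm_eq_abs, Real.norm_eq_abs, add_sub_cancel_left, abs_of_nonneg (sq_nonneg (δ / 2))]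
    at h1
  have h3 := (abs_le.1 h1).2
  have h4 : 0 < (δ / 2) ^ 2 := by positivity
  nlinarith [mul_pos_of_neg_of_neg hlt (neg_lt_zero.2 h4)]

/-- The data of Laplace's method: the exponent `W` has a nondegenerate unique minimizer `y` on the
open set `R` and tends to infinity at its boundary, and `h` is a positive amplitude. -/
structure LaplaceData (R : Set ℝ) (W h : ℝ → ℝ) (y : ℝ) (n₀ : ℕ) : Prop where
  isOpen : IsOpen R
  contDiffOn : ContDiffOn ℝ 2 W R
  isMin : IsUniqueMinimizerOn W R y
  deriv_ne_zero : iteratedDeriv 2 W y ≠ 0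
  continuousOn : ContinuousOn h R
  pos : ∀ x ∈ R, 0 < h x
  integrableOn : IntegrableOn (fun x => Real.exp (-(n₀ : ℝ) * W x) * h x) R
  coercive : ∀ C : ℝ, ∃ K ⊆ R, IsCompact K ∧ ∀ x ∈ R \ K, C ≤ W x

namespace LaplaceData

variable {R : Set ℝ} {W h : ℝ → ℝ} {y : ℝ} {n₀ : ℕ}

lemma isLocalMin (H : LaplaceData R W h y n₀) : IsLocalMin W y := by
  filter_upwards [H.isOpen.mem_nhds H.isMin.1] with x hx
  rcases eq_or_ne x y with rfl | hne
  · exact le_rfl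
  · exact (H.isMin.2 x hx hne).le

lemma deriv_pos (H : LaplaceData R W h y n₀) : 0 < iteratedDeriv 2 W y :=
  iteratedDeriv_two_pos_of_isLocalMin H.isOpen H.isMin.1 H.contDiffOn H.isLocalMin H.deriv_ne_zero

lemma le_of_mem (H : LaplaceData R W h y n₀) {x : ℝ} (hx : x ∈ R) : W y ≤ W x := by
  rcases eq_or_ne x y with rfl | hne
  · exact le_rfl
  · exact (H.isMin.2 x hx hne).le

/-- Away from the minimizer the exponent exceeds its minimum by a fixed amount. -/
lemma exists_gap (H : LaplaceData R W h y n₀) {δ : ℝ} (hδ : 0 < δ) :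
    ∃ η > 0, ∀ x ∈ R \ Metric.ball y δ, η ≤ W x - W y := by
  obtain ⟨K, hKR, hK, hKW⟩ := H.coercive (W y + 1)
  have hcomp : IsCompact (K \ Metric.ball y δ) := hK.diff Metric.isOpen_ball
  have hcont : ContinuousOn W (K \ Metric.ball y δ) :=
    H.contDiffOn.continuousOn.mono (sdiff_subset.trans hKR)
  rcases (K \ Metric.ball y δ).eq_empty_or_nonempty with he | hne
  · refine ⟨1, one_pos, fun x hx => ?_⟩
    have hxK : x ∉ K := fun hxK => by
      have : x ∈ K \ Metric.ball y δ := ⟨hxK, hx.2⟩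
      rw [he] at this
      exact this
    linarith [hKW x ⟨hx.1, hxK⟩]
  · obtain ⟨z, hz, hzmin⟩ := hcomp.exists_isMinOn hne hcont
    have hzy : z ≠ y := fun he => hz.2 (he ▸ Metric.mem_ball_self hδ)
    have hpos : 0 < W z - W y := sub_pos.2 (H.isMin.2 z (hKR hz.1) hzy)
    refine ⟨min 1 (W z - W y), lt_min one_pos hpos, fun x hx => ?_⟩
    by_cases hxK : x ∈ K
    · exact (min_le_right _ _).trans (sub_le_sub_right (hzmin ⟨hxK, hx.2⟩) _)
    · exact (min_le_left _ _).trans (by linarith [hKW x ⟨hx.1, hxK⟩])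

/-- Near the minimizer the exponent is bounded below by a parabola and the amplitude is bounded. -/
lemma exists_ball (H : LaplaceData R W h y n₀) :
    ∃ δ > 0, Metric.ball y δ ⊆ R ∧ ∀ x ∈ Metric.ball y δ,
      iteratedDeriv 2 W y / 4 * (x - y) ^ 2 ≤ W x - W y ∧ h x ≤ h y + 1 := by
  have hκ := H.deriv_pos
  have h1 := (isLittleO_sub_sq_of_isLocalMin H.isOpen H.isMin.1 H.contDiffOn H.isLocalMin).def
    (c := iteratedDeriv 2 W y / 4) (by linarith)
  have h2 : ∀ᶠ x in 𝓝 y, h x < h y + 1 :=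
    (H.continuousOn.continuousAt (H.isOpen.mem_nhds H.isMin.1)).eventually_lt_const (by linarith)
  obtain ⟨δ, hδ, hb⟩ := Metric.eventually_nhds_iff.1
    ((h1.and h2).and (H.isOpen.mem_nhds H.isMin.1))
  refine ⟨δ, hδ, fun x hx => (hb hx).2, fun x hx => ⟨?_, (hb hx).1.2.le⟩⟩
  have h3 := (hb hx).1.1
  rw [Real.norm_eq_abs, Real.norm_eq_abs, abs_of_nonneg (sq_nonneg (x - y))] at h3
  linarith [(abs_le.1 h3).1]

lemma integrableOn_exp (H : LaplaceData R W h y n₀) {n : ℕ} (hn : n₀ ≤ n) :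
    IntegrableOn (fun x => Real.exp (-(n : ℝ) * (W x - W y)) * h x) R := by
  have hint := H.integrableOn.const_mul (Real.exp (n₀ * W y))
  have hcont : ContinuousOn (fun x => Real.exp (-(n : ℝ) * (W x - W y)) * h x) R :=
    ((H.contDiffOn.continuousOn.sub continuousOn_const).const_smul (-(n : ℝ))).rexp.mul
      H.continuousOn
  refine Integrable.mono' hint (hcont.aestronglyMeasurable H.isOpen.measurableSet) ?_
  refine (ae_restrict_iff' H.isOpen.measurableSet).2 (Eventually.of_forall fun x hx => ?_)
  have hpos := H.pos x hx
  rw [Real.norm_eq_abs, abs_of_pos (by positivity), ← mul_assoc, ← Real.exp_add]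
  refine mul_le_mul_of_nonneg_right (Real.exp_le_exp.2 ?_) hpos.le
  have h1 : (n₀ : ℝ) ≤ n := by exact_mod_cast hn
  nlinarith [H.le_of_mem hx]

lemma exp_mul_le (H : LaplaceData R W h y n₀) {n : ℕ} (hn : n₀ ≤ n) {η x : ℝ} (hx : x ∈ R)
    (hη : η ≤ W x - W y) :
    Real.exp (-(n : ℝ) * (W x - W y)) * h x ≤
      Real.exp (-((n : ℝ) - n₀) * η) * (Real.exp (-(n₀ : ℝ) * (W x - W y)) * h x) := by
  rw [← mul_assoc, ← Real.exp_add]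
  refine mul_le_mul_of_nonneg_right (Real.exp_le_exp.2 ?_) (H.pos x hx).le
  have h1 : (n₀ : ℝ) ≤ n := by exact_mod_cast hn
  nlinarith [H.le_of_mem hx]

/-- The contribution away from the minimizer is negligible. -/
lemma tendsto_integral_far (H : LaplaceData R W h y n₀) {f : ℝ → ℝ} {C : ℝ}
    (hC : ∀ x, |f x| ≤ C) {δ : ℝ} (hδ : 0 < δ) :
    Tendsto (fun n : ℕ => √n * ∫ x in R \ Metric.ball y δ,
      f (√n * (x - y)) * (Real.exp (-(n : ℝ) * (W x - W y)) * h x)) atTop (𝓝 0) := by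
  obtain ⟨η, hη, hgap⟩ := H.exists_gap hδ
  have hC0 : 0 ≤ C := (abs_nonneg _).trans (hC 0)
  have hmeas : MeasurableSet (R \ Metric.ball y δ) :=
    H.isOpen.measurableSet.diff Metric.isOpen_ball.measurableSet
  set I := ∫ x in R \ Metric.ball y δ, Real.exp (-(n₀ : ℝ) * (W x - W y)) * h x with hI
  have hlim : Tendsto (fun n : ℕ => (C * I * Real.exp (n₀ * η)) *
      (√n * Real.exp (-(n : ℝ) * η))) atTop (𝓝 0) := by
    rw [← mul_zero (C * I * Real.exp (n₀ * η))]
    refine Tendsto.const_mul _ ?_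
    have h1 := (tendsto_rpow_mul_exp_neg_mul_atTop_nhds_zero (1 / 2) η hη).comp
      tendsto_natCast_atTop_atTop
    refine h1.congr fun n => ?_
    simp only [Function.comp, Real.sqrt_eq_rpow]
    congr 2
    ring
  refine squeeze_zero_norm' ?_ hlim
  filter_upwards [eventually_ge_atTop n₀] with n hn
  -- Split `n = (n - n₀) + n₀`: the first part gains `exp(-(n - n₀) η)` from the gap, the second
  -- keeps the integral finite.
  have hb : ‖∫ x in R \ Metric.ball y δ,
      f (√n * (x - y)) * (Real.exp (-(n : ℝ) * (W x - W y)) * h x)‖ ≤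
      ∫ x in R \ Metric.ball y δ, C * Real.exp (-((n : ℝ) - n₀) * η) *
        (Real.exp (-(n₀ : ℝ) * (W x - W y)) * h x) := by
    refine norm_integral_le_of_norm_le
      (((H.integrableOn_exp le_rfl).mono_set sdiff_subset).const_mul _) ?_
    refine (ae_restrict_iff' hmeas).2 (Eventually.of_forall fun x hx => ?_)
    have hpos := H.pos x hx.1
    rw [norm_mul, Real.norm_eq_abs, Real.norm_eq_abs, abs_of_pos (a := _ * h x) (by positivity),
      mul_assoc C]
    exact mul_le_mul (hC _) (H.exp_mul_le hn hx.1 (hgap x hx)) (by positivity) hC0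
  rw [integral_const_mul, ← hI] at hb
  rw [norm_mul, Real.norm_of_nonneg (Real.sqrt_nonneg _)]
  refine (mul_le_mul_of_nonneg_left hb (Real.sqrt_nonneg _)).trans (le_of_eq ?_)
  rw [show -((n : ℝ) - n₀) * η = n₀ * η + -(n : ℝ) * η by ring, Real.exp_add]
  ring

/-- The contribution near the minimizer. -/
lemma tendsto_integral_near (H : LaplaceData R W h y n₀) {f : ℝ → ℝ} (hf : Continuous f) {C : ℝ}
    (hC : ∀ x, |f x| ≤ C) {δ : ℝ} (hδ : 0 < δ) (hδR : Metric.ball y δ ⊆ R)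
    (hb : ∀ x ∈ Metric.ball y δ,
      iteratedDeriv 2 W y / 4 * (x - y) ^ 2 ≤ W x - W y ∧ h x ≤ h y + 1) :
    Tendsto (fun n : ℕ => √n * ∫ x in Metric.ball y δ,
      f (√n * (x - y)) * (Real.exp (-(n : ℝ) * (W x - W y)) * h x)) atTop
      (𝓝 (∫ u, f u * (Real.exp (-(iteratedDeriv 2 W y / 2) * u ^ 2) * h y))) := by
  have hC0 : 0 ≤ C := (abs_nonneg _).trans (hC 0)
  have hκ := H.deriv_pos
  set κ := iteratedDeriv 2 W y with hκdef
  set G : ℕ → ℝ → ℝ := fun n => (Metric.ball y δ).indicator fun x =>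
    f (√n * (x - y)) * (Real.exp (-(n : ℝ) * (W x - W y)) * h x) with hG
  have hrescale : ∀ᶠ n : ℕ in atTop, ∫ u, G n (y + u / √n) = √n * ∫ x in Metric.ball y δ,
      f (√n * (x - y)) * (Real.exp (-(n : ℝ) * (W x - W y)) * h x) := by
    filter_upwards [eventually_ge_atTop 1] with n hn
    rw [Measure.integral_comp_div (fun v => G n (y + v)) √n, integral_add_left_eq_self (G n) y,
      hG, integral_indicator Metric.isOpen_ball.measurableSet,
      abs_of_nonneg (Real.sqrt_nonneg _), smul_eq_mul]
  refine Tendsto.congr' hrescale ?_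
  -- After the substitution `x = y + u / √n`, which absorbs the factor `√n`, the parabola below `W`
  -- supplies a Gaussian bound uniform in `n`.
  refine tendsto_integral_filter_of_dominated_convergence
    (fun u => C * (h y + 1) * Real.exp (-(κ / 4) * u ^ 2)) ?_ ?_ ?_ ?_
  · filter_upwards with n
    have hcont : ContinuousOn (fun x => f (√n * (x - y)) *
        (Real.exp (-(n : ℝ) * (W x - W y)) * h x)) (Metric.ball y δ) := by
      refine ContinuousOn.mul (by fun_prop) (ContinuousOn.mul ?_ (H.continuousOn.mono hδR))
      exact (((H.contDiffOn.continuousOn.mono hδR).sub continuousOn_const).const_smul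
        (-(n : ℝ))).rexp
    have hmeas : Measurable (G n) := by
      classical
      simp only [hG, ← piecewise_eq_indicator]
      exact hcont.measurable_piecewise continuousOn_const Metric.isOpen_ball.measurableSet
    exact (hmeas.comp (by fun_prop)).aestronglyMeasurable
  · filter_upwards [eventually_ge_atTop 1] with n hn
    refine Eventually.of_forall fun u => ?_
    have hn0 : (0 : ℝ) < n := by exact_mod_cast hn
    have hh1 : 0 < h y := H.pos y H.isMin.1
    by_cases hu : y + u / √n ∈ Metric.ball y δ
    · obtain ⟨h1, h2⟩ := hb _ hu
      have hpos := H.pos _ (hδR hu)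
      simp only [hG, indicator_of_mem hu]
      rw [norm_mul, Real.norm_eq_abs, Real.norm_eq_abs, abs_of_pos (a := _ * h _) (by positivity),
        mul_assoc C, mul_comm (h y + 1)]
      refine mul_le_mul (hC _) (mul_le_mul (Real.exp_le_exp.2 ?_) h2 hpos.le (by positivity))
        (by positivity) hC0
      rw [add_sub_cancel_left, div_pow, Real.sq_sqrt hn0.le] at h1
      have h3 := mul_le_mul_of_nonneg_left h1 hn0.le
      have h4 : (n : ℝ) * (κ / 4 * (u ^ 2 / n)) = κ / 4 * u ^ 2 := by field_simp
      linarith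
    · simp only [hG, indicator_of_notMem hu, norm_zero]
      positivity
  · exact (integrable_exp_neg_mul_sq (by linarith)).const_mul _
  · refine Eventually.of_forall fun u => ?_
    have hlim : Tendsto (fun n : ℕ => y + u / √n) atTop (𝓝 y) := by
      have : Tendsto (fun n : ℕ => u / √(n : ℝ)) atTop (𝓝 0) :=
        tendsto_const_nhds.div_atTop (Real.tendsto_sqrt_atTop.comp tendsto_natCast_atTop_atTop)
      simpa using this.const_add y
    have hexp : Tendsto (fun n : ℕ => -(n : ℝ) * (W (y + u / √n) - W y)) atTop
        (𝓝 (-(κ / 2) * u ^ 2)) := by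
      have ho := (isLittleO_sub_sq_of_isLocalMin H.isOpen H.isMin.1 H.contDiffOn
        H.isLocalMin).comp_tendsto hlim
      have ho2 : (fun n : ℕ => (n : ℝ) * (W (y + u / √n) - W y - κ / 2 * (u / √n) ^ 2)) =o[atTop]
          fun _ : ℕ => u ^ 2 := by
        refine ((Asymptotics.isBigO_refl (fun n : ℕ => (n : ℝ)) atTop).mul_isLittleO ho).congr'
          ?_ ?_
        · filter_upwards with n
          simp only [Function.comp, add_sub_cancel_left, hκdef]
        · filter_upwards [eventually_ge_atTop 1] with n hn
          have hn0 : (0 : ℝ) < n := by exact_mod_cast hn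
          simp only [Function.comp, add_sub_cancel_left, div_pow, Real.sq_sqrt hn0.le]
          field_simp
      have ho3 := ho2.trans_isBigO
        (Asymptotics.isBigO_const_const (u ^ 2) (one_ne_zero (α := ℝ)) atTop)
      rw [Asymptotics.isLittleO_one_iff] at ho3
      have ho4 := (ho3.const_add (κ / 2 * u ^ 2)).neg
      rw [add_zero, ← neg_mul] at ho4
      refine ho4.congr' ?_
      filter_upwards [eventually_ge_atTop 1] with n hn
      have hn0 : (0 : ℝ) < n := by exact_mod_cast hn
      rw [div_pow, Real.sq_sqrt hn0.le]
      field_simp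
      ring
    have hh : Tendsto (fun n : ℕ => h (y + u / √n)) atTop (𝓝 (h y)) :=
      (H.continuousOn.continuousAt (H.isOpen.mem_nhds H.isMin.1)).tendsto.comp hlim
    refine (((Real.continuous_exp.tendsto _).comp hexp).mul hh).const_mul (f u) |>.congr' ?_
    filter_upwards [eventually_ge_atTop 1, hlim (Metric.ball_mem_nhds y hδ)] with n hn hmem
    have hn0 : (0 : ℝ) < n := by exact_mod_cast hn
    have hs : √(n : ℝ) ≠ 0 := (Real.sqrt_pos.2 hn0).ne'
    simp only [hG, indicator_of_mem (show y + u / √n ∈ Metric.ball y δ from hmem), Function.comp,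
      add_sub_cancel_left, mul_div_cancel₀ u hs]

/-- **Laplace's method** with a bounded test function on the scale of the fluctuations. -/
theorem tendsto_integral (H : LaplaceData R W h y n₀) {f : ℝ → ℝ} (hf : Continuous f) {C : ℝ}
    (hC : ∀ x, |f x| ≤ C) :
    Tendsto (fun n : ℕ => √n * ∫ x in R,
      f (√n * (x - y)) * (Real.exp (-(n : ℝ) * (W x - W y)) * h x)) atTop
      (𝓝 (∫ u, f u * (Real.exp (-(iteratedDeriv 2 W y / 2) * u ^ 2) * h y))) := by
  obtain ⟨δ, hδ, hδR, hb⟩ := H.exists_ball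
  have hsum := (H.tendsto_integral_near hf hC hδ hδR hb).add (H.tendsto_integral_far hC hδ)
  rw [add_zero] at hsum
  refine hsum.congr' ?_
  filter_upwards [eventually_ge_atTop n₀] with n hn
  have hint : IntegrableOn (fun x => f (√n * (x - y)) *
      (Real.exp (-(n : ℝ) * (W x - W y)) * h x)) R := by
    refine (H.integrableOn_exp hn).bdd_mul (c := C) ?_ (Eventually.of_forall fun x => hC _)
    exact Continuous.aestronglyMeasurable (by fun_prop)
  rw [← mul_add, ← setIntegral_union disjoint_sdiff_right
    (H.isOpen.measurableSet.diff Metric.isOpen_ball.measurableSet) (hint.mono_set hδR)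
    (hint.mono_set sdiff_subset), union_sdiff_cancel hδR]

end LaplaceData

/-! # Normalized densities -/

/-- The measure with density proportional to `g` on `R`. -/
def gibbsMeasure {α : Type*} [MeasureSpace α] (R : Set α) (g : α → ℝ) : Measure α :=
  let ν : Measure α := (volume.restrict R).withDensity fun x => ENNReal.ofReal (g x)
  (ν univ)⁻¹ • ν

section GibbsMeasure

variable {R : Set ℝ} {g : ℝ → ℝ}

lemma gibbsMeasure_congr {α : Type*} [MeasureSpace α] {R : Set α} {g g' : α → ℝ}
    (hR : MeasurableSet R) (h : EqOn g g' R) : gibbsMeasure R g = gibbsMeasure R g' := by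
  have : (volume.restrict R).withDensity (fun x => ENNReal.ofReal (g x)) =
      (volume.restrict R).withDensity fun x => ENNReal.ofReal (g' x) := by
    refine withDensity_congr_ae ?_
    filter_upwards [ae_restrict_mem hR] with x hx
    rw [h hx]
  simp only [gibbsMeasure, this]

lemma setIntegral_pos_of_continuousOn (hR : IsOpen R) (hne : R.Nonempty) (hpos : ∀ x ∈ R, 0 < g x)
    (hint : IntegrableOn g R) : 0 < ∫ x in R, g x := by
  rw [setIntegral_pos_iff_support_of_nonneg_ae
    ((ae_restrict_iff' hR.measurableSet).2 (Eventually.of_forall fun x hx => (hpos x hx).le)) hint]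
  refine (hR.measure_pos volume hne).trans_le (measure_mono fun x hx => ⟨(hpos x hx).ne', hx⟩)

lemma withDensity_univ_eq_ofReal (hR : IsOpen R) (hpos : ∀ x ∈ R, 0 < g x)
    (hint : IntegrableOn g R) :
    (volume.restrict R).withDensity (fun x => ENNReal.ofReal (g x)) univ =
      ENNReal.ofReal (∫ x in R, g x) := by
  rw [withDensity_apply _ MeasurableSet.univ, Measure.restrict_univ,
    ofReal_integral_eq_lintegral_ofReal hint]
  exact (ae_restrict_iff' hR.measurableSet).2 (Eventually.of_forall fun x hx => (hpos x hx).le)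

lemma isProbabilityMeasure_gibbsMeasure (hR : IsOpen R) (hne : R.Nonempty)
    (hpos : ∀ x ∈ R, 0 < g x) (hint : IntegrableOn g R) :
    IsProbabilityMeasure (gibbsMeasure R g) := by
  constructor
  have hI := setIntegral_pos_of_continuousOn hR hne hpos hint
  simp only [gibbsMeasure, Measure.smul_apply, smul_eq_mul, withDensity_univ_eq_ofReal hR hpos hint]
  exact ENNReal.inv_mul_cancel (by simpa using hI) ENNReal.ofReal_ne_top

lemma integral_gibbsMeasure (hR : IsOpen R) (hpos : ∀ x ∈ R, 0 < g x) (hint : IntegrableOn g R)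
    (f : ℝ → ℝ) :
    ∫ x, f x ∂gibbsMeasure R g = (∫ x in R, f x * g x) / ∫ x in R, g x := by
  have hI : 0 ≤ ∫ x in R, g x :=
    setIntegral_nonneg hR.measurableSet fun x hx => (hpos x hx).le
  simp only [gibbsMeasure]
  rw [integral_smul_measure, withDensity_univ_eq_ofReal hR hpos hint, ENNReal.toReal_inv,
    ENNReal.toReal_ofReal hI, smul_eq_mul, div_eq_inv_mul,
    integral_withDensity_eq_integral_toReal_smul₀ hint.aestronglyMeasurable.aemeasurable.ennreal_ofReal
      (Eventually.of_forall fun x => ENNReal.ofReal_lt_top)]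
  congr 1
  refine setIntegral_congr_fun hR.measurableSet fun x hx => ?_
  simp only [ENNReal.toReal_ofReal (hpos x hx).le, smul_eq_mul, mul_comm]

end GibbsMeasure

lemma gaussianPDFReal_zero_inv {κ : ℝ} (hκ : 0 < κ) (u : ℝ) :
    gaussianPDFReal 0 κ⁻¹.toNNReal u =
      (√(2 * Real.pi * κ⁻¹))⁻¹ * Real.exp (-(κ / 2) * u ^ 2) := by
  rw [gaussianPDFReal, Real.coe_toNNReal _ (inv_nonneg.2 hκ.le), sub_zero]
  congr 2
  field_simp

lemma integral_mul_exp_div {κ : ℝ} (hκ : 0 < κ) {c : ℝ} (hc : 0 < c) (f : ℝ → ℝ) :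
    (∫ u, f u * (Real.exp (-(κ / 2) * u ^ 2) * c)) / (∫ u, Real.exp (-(κ / 2) * u ^ 2) * c) =
      ∫ u, f u ∂gaussianReal 0 κ⁻¹.toNNReal := by
  have hv : κ⁻¹.toNNReal ≠ 0 := by simpa using hκ
  have h1 := integral_gaussianPDFReal_eq_one 0 hv
  rw [integral_gaussianReal_eq_integral_smul hv]
  simp only [gaussianPDFReal_zero_inv hκ, smul_eq_mul, integral_const_mul] at h1 ⊢
  set s := (√(2 * Real.pi * κ⁻¹))⁻¹ with hs
  have hI : ∫ u, Real.exp (-(κ / 2) * u ^ 2) ≠ 0 := fun h => by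
    rw [h, mul_zero] at h1
    exact zero_ne_one h1
  simp only [← mul_assoc, integral_mul_const]
  simp only [mul_assoc, integral_const_mul]
  rw [mul_div_mul_right _ _ hc.ne', div_eq_iff hI]
  simp only [mul_comm (f _)]
  linear_combination (-∫ u, Real.exp (-(κ / 2) * u ^ 2) * f u) * h1

/-- The centered Gaussian law of variance `v`, as a probability measure. -/
def centeredGaussian (v : NNReal) : ProbabilityMeasure ℝ := ⟨gaussianReal 0 v, inferInstance⟩

lemma toMeasure_centeredGaussian (v : NNReal) :
    (centeredGaussian v : Measure ℝ) = gaussianReal 0 v := rfl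

/-- **Laplace's method**: convergence in law of the rescaled deviation from the minimizer. -/
theorem LaplaceData.tendsto_map {R : Set ℝ} {W h : ℝ → ℝ} {y : ℝ} {n₀ : ℕ}
    (H : LaplaceData R W h y n₀) (ρ : ℕ → ProbabilityMeasure ℝ)
    (hρ : ∀ᶠ n in atTop, (ρ n : Measure ℝ) =
      gibbsMeasure R fun x => Real.exp (-(n : ℝ) * W x) * h x) :
    Tendsto (fun n => (ρ n).map (f := fun x => √n * (x - y)) (by fun_prop)) atTop
      (𝓝 (centeredGaussian (iteratedDeriv 2 W y)⁻¹.toNNReal)) := by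
  rw [ProbabilityMeasure.tendsto_iff_forall_integral_tendsto]
  intro f
  -- Divide the asymptotics for `f` by those for the constant 1; the factors `√n`, `exp(-n W(y))`
  -- and `h y` cancel.
  have hlim := (H.tendsto_integral f.continuous f.norm_coe_le_norm).div
    (H.tendsto_integral (f := fun _ => 1) (C := 1) continuous_const (by simp)) ?_
  · simp only [one_mul] at hlim
    rw [integral_mul_exp_div H.deriv_pos (H.pos y H.isMin.1)] at hlim
    simp only [toMeasure_centeredGaussian]
    refine hlim.congr' ?_
    filter_upwards [hρ, eventually_ge_atTop (n₀ + 1)] with n hn hn1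
    have hn0 : (0 : ℝ) < n := by exact_mod_cast (by omega : 0 < n)
    have hexp : ∀ x, Real.exp (-(n : ℝ) * W x) * h x =
        Real.exp (-(n : ℝ) * W y) * (Real.exp (-(n : ℝ) * (W x - W y)) * h x) := fun x => by
      rw [← mul_assoc, ← Real.exp_add]
      ring_nf
    have hint : IntegrableOn (fun x => Real.exp (-(n : ℝ) * W x) * h x) R := by
      simp only [hexp]
      exact (H.integrableOn_exp (by omega)).const_mul _
    have hpos : ∀ x ∈ R, 0 < Real.exp (-(n : ℝ) * W x) * h x := fun x hx =>
      mul_pos (Real.exp_pos _) (H.pos x hx)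
    simp only [ProbabilityMeasure.toMeasure_map, hn]
    rw [integral_map (by fun_prop) f.continuous.aestronglyMeasurable,
      integral_gibbsMeasure H.isOpen hpos hint]
    simp only [hexp, mul_left_comm _ (Real.exp (-(n : ℝ) * W y)), integral_const_mul]
    rw [Pi.div_apply, mul_div_mul_left _ _ (Real.sqrt_pos.2 hn0).ne', mul_div_mul_left _ _ (Real.exp_pos _).ne']
  · simp only [one_mul, integral_mul_const]
    refine mul_ne_zero ?_ (H.pos y H.isMin.1).ne'
    rw [integral_gaussian]
    have := H.deriv_pos
    positivity

/-! # Integrability and coercivity of the potentials -/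

lemma mul_log_le_of_le_div_log {V : ℝ → ℝ} {c R x : ℝ} (hV : ∀ z ≥ R, c ≤ V z / Real.log z)
    (hx : max R 2 ≤ x) : c * Real.log x ≤ V x := by
  have hlog : 0 < Real.log x := Real.log_pos (by linarith [le_max_right R 2])
  exact (le_div_iff₀ hlog).1 (hV x ((le_max_left _ _).trans hx))

/-- At infinity the growth of `V` bounds the integrand by `x ^ (j - n c)`, which is integrable
exactly because `1 + j < n c`. -/
lemma integrableOn_Ioi_exp_mul_pow {V : ℝ → ℝ} (hcont : ContinuousOn V (Ici 0)) {c R : ℝ}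
    (hV : ∀ z ≥ R, c ≤ V z / Real.log z) {n j : ℕ} (hc : 1 + (j : ℝ) < n * c) :
    IntegrableOn (fun x => Real.exp (-(n : ℝ) * V x) * x ^ j) (Ioi 0) := by
  set A := max R 2 with hA
  have hA0 : 0 < A := lt_of_lt_of_le two_pos (le_max_right _ _)
  have hf : ContinuousOn (fun x => Real.exp (-(n : ℝ) * V x) * x ^ j) (Ici 0) :=
    (hcont.const_smul (-(n : ℝ))).rexp.mul (by fun_prop)
  rw [← Ioc_union_Ioi_eq_Ioi hA0.le]
  refine IntegrableOn.union ?_ ?_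
  · exact ((hf.mono Icc_subset_Ici_self).integrableOn_compact isCompact_Icc).mono_set
      Ioc_subset_Icc_self
  · refine Integrable.mono' (integrableOn_Ioi_rpow_of_lt (a := (j : ℝ) - n * c) (by linarith) hA0)
      ((hf.mono (Ioi_subset_Ici hA0.le)).aestronglyMeasurable measurableSet_Ioi) ?_
    refine (ae_restrict_iff' measurableSet_Ioi).2 (Eventually.of_forall fun x hx => ?_)
    have hx0 : 0 < x := hA0.trans hx
    have h1 := mul_log_le_of_le_div_log hV (le_of_lt hx)
    rw [Real.norm_eq_abs, abs_of_pos (by positivity), Real.rpow_def_of_pos hx0,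
      ← Real.rpow_natCast, Real.rpow_def_of_pos hx0, ← Real.exp_add]
    refine Real.exp_le_exp.2 ?_
    have h2 := mul_le_mul_of_nonneg_left h1 (Nat.cast_nonneg (α := ℝ) n)
    linarith

/-- Near 0 the potential is bounded and `-log x` blows up; at infinity `V x ≥ 2 log x` leaves at
least `log x`. -/
lemma exists_isCompact_Ioi_le_sub_log {V : ℝ → ℝ} (hcont : ContinuousOn V (Ici 0)) {c R : ℝ}
    (hc : 2 ≤ c) (hV : ∀ z ≥ R, c ≤ V z / Real.log z) (C : ℝ) :
    ∃ K ⊆ Ioi 0, IsCompact K ∧ ∀ x ∈ Ioi 0 \ K, C ≤ V x - Real.log x := by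
  obtain ⟨B, hB⟩ := (isCompact_Icc (a := (0 : ℝ)) (b := 1)).exists_bound_of_continuousOn
    (hcont.mono Icc_subset_Ici_self)
  refine ⟨Icc (min 1 (Real.exp (-(C + B)))) (max (max R 2) (Real.exp C)), fun x hx => ?_,
    isCompact_Icc, fun x ⟨hx0, hxK⟩ => ?_⟩
  · exact lt_of_lt_of_le (lt_min one_pos (Real.exp_pos _)) hx.1
  · have hx0 : 0 < x := hx0
    rcases not_and_or.1 hxK with h | h
    · have h1 := not_le.1 h
      have hx1 : x < 1 := h1.trans_le (min_le_left _ _)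
      have h2 := (abs_le.1 (hB x ⟨hx0.le, hx1.le⟩)).1
      have h3 : Real.log x ≤ -(C + B) :=
        (Real.log_le_iff_le_exp hx0).2 (h1.le.trans (min_le_right _ _))
      linarith
    · have h1 := not_le.1 h
      have h2 := mul_log_le_of_le_div_log hV ((le_max_left _ _).trans h1.le)
      have h3 : C ≤ Real.log x := (Real.le_log_iff_exp_le hx0).2 ((le_max_right _ _).trans h1.le)
      have h4 : 0 ≤ Real.log x :=
        Real.log_nonneg (by linarith [le_max_right R 2, le_max_left (max R 2) (Real.exp C)])
      nlinarith

lemma integrableOn_Ioo_exp_mul_pow {V : ℝ → ℝ} (hcont : ContinuousOn V (Icc 0 1)) (n j : ℕ) :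
    IntegrableOn (fun x => Real.exp (-(n : ℝ) * V x) * (x * (1 - x)) ^ j) (Ioo 0 1) := by
  have hf : ContinuousOn (fun x => Real.exp (-(n : ℝ) * V x) * (x * (1 - x)) ^ j) (Icc 0 1) :=
    (hcont.const_smul (-(n : ℝ))).rexp.mul (by fun_prop)
  exact (hf.integrableOn_compact isCompact_Icc).mono_set Ioo_subset_Icc_self

lemma exists_isCompact_Ioo_le_sub_log {V : ℝ → ℝ} (hcont : ContinuousOn V (Icc 0 1)) (C : ℝ) :
    ∃ K ⊆ Ioo 0 1, IsCompact K ∧ ∀ x ∈ Ioo 0 1 \ K, C ≤ V x - Real.log (x * (1 - x)) := by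
  obtain ⟨B, hB⟩ := (isCompact_Icc (a := (0 : ℝ)) (b := 1)).exists_bound_of_continuousOn hcont
  refine ⟨Icc 0 1 ∩ {x | Real.exp (-(C + B)) ≤ x * (1 - x)}, fun x hx => ?_,
    isCompact_Icc.inter_right (isClosed_le continuous_const (by fun_prop)),
    fun x ⟨hx0, hxK⟩ => ?_⟩
  · have h : 0 < x * (1 - x) := (Real.exp_pos _).trans_le hx.2
    exact ⟨lt_of_le_of_ne hx.1.1 fun h0 => by simp [← h0] at h,
      lt_of_le_of_ne hx.1.2 fun h0 => by simp [h0] at h⟩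
  · have h1 : x * (1 - x) < Real.exp (-(C + B)) :=
      not_le.1 fun h => hxK ⟨Ioo_subset_Icc_self hx0, h⟩
    have h2 := (abs_le.1 (hB x (Ioo_subset_Icc_self hx0))).1
    have h3 := (Real.log_le_iff_le_exp (mul_pos hx0.1 (by linarith [hx0.2]))).2 h1.le
    linarith

lemma integrable_exp_of_le_div_log {V : ℝ → ℝ} (hcont : Continuous V) {ε R : ℝ} (hε : 0 < ε)
    (hV : ∀ α : ℝ, R ≤ |α| → 1 + ε ≤ V α / Real.log |α|) {n : ℕ} (hn : 1 ≤ n) :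
    Integrable (fun x => Real.exp (-(n : ℝ) * V x)) := by
  have hg : Integrable (fun x : ℝ => (1 + ‖x‖) ^ (-(1 + ε))) :=
    integrable_one_add_norm (by simpa using hε)
  refine Continuous.locallyIntegrable (by fun_prop) |>.integrable_of_isBigO_cocompact
    (g := fun x : ℝ => (1 + ‖x‖) ^ (-(1 + ε))) ?_ (hg.integrableAtFilter _)
  -- The constant comes from `1 + |x| ≤ 2 |x|`.
  refine Asymptotics.IsBigO.of_bound (2 ^ (1 + ε)) ?_
  filter_upwards [tendsto_norm_cocompact_atTop.eventually_ge_atTop (max R 2)] with x hx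
  rw [Real.norm_eq_abs] at hx
  have hx2 : 2 ≤ |x| := (le_max_right _ _).trans hx
  have hlog : 0 < Real.log |x| := Real.log_pos (by linarith)
  have h1 := (le_div_iff₀ hlog).1 (hV x ((le_max_left _ _).trans hx))
  have h2 : (1 : ℝ) ≤ n := by exact_mod_cast hn
  rw [Real.norm_of_nonneg (Real.exp_pos _).le, Real.norm_eq_abs x,
    Real.norm_of_nonneg (by positivity), Real.rpow_neg (by positivity), ← div_eq_mul_inv,
    ← Real.div_rpow two_pos.le (by positivity), Real.rpow_def_of_pos (by positivity)]
  refine Real.exp_le_exp.2 ?_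
  have h3 : -Real.log |x| ≤ Real.log (2 / (1 + |x|)) := by
    rw [← Real.log_inv]
    refine Real.log_le_log (by positivity) ?_
    rw [inv_eq_one_div, div_le_div_iff₀ (by positivity) (by positivity)]
    linarith
  have h4 := mul_le_mul_of_nonneg_right h3 (by linarith : 0 ≤ 1 + ε)
  have h5 : 0 ≤ V x := le_trans (by positivity) h1
  nlinarith

lemma exists_isCompact_le_of_le_div_log {V : ℝ → ℝ} {ε R : ℝ} (hε : 0 < ε)
    (hV : ∀ α : ℝ, R ≤ |α| → 1 + ε ≤ V α / Real.log |α|) (C : ℝ) :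
    ∃ K, IsCompact K ∧ ∀ x ∉ K, C ≤ V x := by
  set A := max (max R 2) (Real.exp C) with hA
  refine ⟨Icc (-A) A, isCompact_Icc, fun x hx => ?_⟩
  have hxA : A < |x| := not_le.1 fun h => hx (abs_le.1 h)
  have hx2 : 2 < |x| := ((le_max_right R 2).trans (le_max_left _ _)).trans_lt hxA
  have hlog : 0 < Real.log |x| := Real.log_pos (by linarith)
  have h1 := (le_div_iff₀ hlog).1
    (hV x (((le_max_left R 2).trans (le_max_left _ _)).trans hxA.le))
  have h2 : C ≤ Real.log |x| :=
    (Real.le_log_iff_exp_le (by linarith)).2 ((le_max_right _ _).trans hxA.le)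
  nlinarith

/-! ### The potentials of the coordinates as data for Laplace's method -/

namespace MomentDomain

/-- The potential of the coordinate with index `l`. -/
def potential (V₁ V₂ : ℝ → ℝ) (l : ℕ) : ℝ → ℝ := if Even l then V₁ else V₂

/-- The function `W₁` or `W₂` of the coordinate with index `l`. -/
def exponent (E : MomentDomain) (V₁ V₂ : ℝ → ℝ) (l : ℕ) : ℝ → ℝ :=
  if Even l then E.W₁ V₁ else E.W₂ V₂

/-- Explains the logarithm in `W₁` and `W₂`: it is the contribution of the Jacobian weight,
uniformly in the three cases. -/
lemma exponent_eq (E : MomentDomain) (V₁ V₂ : ℝ → ℝ) (l : ℕ) (x : ℝ) :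
    E.exponent V₁ V₂ l x = potential V₁ V₂ l x - Real.log (E.weight l x) := by
  cases E <;> by_cases hl : Even l <;> simp [exponent, potential, weight, W₁, W₂, hl]

lemma contDiff_weight (E : MomentDomain) (l : ℕ) : ContDiff ℝ 2 (E.weight l) := by
  cases E
  · exact contDiff_id.mul (contDiff_const.sub contDiff_id)
  · exact contDiff_id
  · by_cases hl : Even l
    · rw [show line.weight l = fun _ => 1 by ext x; simp [weight, hl]]
      exact contDiff_const
    · rw [show line.weight l = id by ext x; simp [weight, hl]]
      exact contDiff_id

variable {E : MomentDomain} {V₁ V₂ : ℝ → ℝ}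

lemma Admissible.contDiffOn_potential (hV : E.Admissible V₁ V₂) (l : ℕ) :
    ContDiffOn ℝ 2 (potential V₁ V₂ l) (E.range l) := by
  cases E <;> by_cases hl : Even l <;> simp only [potential, range, hl, if_true, if_false]
  · exact hV.1.2
  · exact hV.2.2
  · exact hV.1.2
  · exact hV.2.1.2
  · exact hV.1.contDiffOn
  · exact hV.2.1.2

lemma Admissible.integrableOn (hV : E.Admissible V₁ V₂) (l : ℕ) {n j : ℕ} (hj : j < n) :
    IntegrableOn (fun x => Real.exp (-(n : ℝ) * potential V₁ V₂ l x) * E.weight l x ^ j)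
      (E.range l) := by
  have hjn : (j : ℝ) + 1 ≤ n := by exact_mod_cast hj
  have hj0 : (0 : ℝ) ≤ j := Nat.cast_nonneg j
  cases E <;> by_cases hl : Even l <;> simp only [potential, range, weight, hl, if_true, if_false]
  · exact integrableOn_Ioo_exp_mul_pow hV.1.1 n j
  · exact integrableOn_Ioo_exp_mul_pow hV.2.1 n j
  · obtain ⟨ε, hε, R, hR⟩ := hV.2.2
    exact integrableOn_Ioi_exp_mul_pow hV.1.1 (fun z hz => (hR z hz).1) (by nlinarith)
  · obtain ⟨ε, hε, R, hR⟩ := hV.2.2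
    exact integrableOn_Ioi_exp_mul_pow hV.2.1.1 (fun z hz => (hR z hz).2) (by nlinarith)
  · obtain ⟨ε, hε, R, hR, -⟩ := hV.2.2
    simpa [range₁] using integrable_exp_of_le_div_log hV.1.continuous hε hR (by omega)
  · obtain ⟨ε, hε, R, -, hR⟩ := hV.2.2
    exact integrableOn_Ioi_exp_mul_pow hV.2.1.1 hR (by nlinarith)

lemma Admissible.coercive (hV : E.Admissible V₁ V₂) (l : ℕ) (C : ℝ) :
    ∃ K ⊆ E.range l, IsCompact K ∧ ∀ x ∈ E.range l \ K, C ≤ E.exponent V₁ V₂ l x := by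
  cases E <;> by_cases hl : Even l <;> simp only [exponent, W₁, W₂, range, hl, if_true, if_false]
  · exact exists_isCompact_Ioo_le_sub_log hV.1.1 C
  · exact exists_isCompact_Ioo_le_sub_log hV.2.1 C
  · obtain ⟨ε, hε, R, hR⟩ := hV.2.2
    exact exists_isCompact_Ioi_le_sub_log hV.1.1 (by linarith) (fun z hz => (hR z hz).1) C
  · obtain ⟨ε, hε, R, hR⟩ := hV.2.2
    exact exists_isCompact_Ioi_le_sub_log hV.2.1.1 (by linarith) (fun z hz => (hR z hz).2) C
  · obtain ⟨ε, hε, R, hR, -⟩ := hV.2.2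
    obtain ⟨K, hK, hKV⟩ := exists_isCompact_le_of_le_div_log hε hR C
    exact ⟨K, subset_univ _, hK, fun x hx => hKV x hx.2⟩
  · obtain ⟨ε, hε, R, -, hR⟩ := hV.2.2
    exact exists_isCompact_Ioi_le_sub_log hV.2.1.1 (by linarith) hR C

lemma isUniqueMinimizerOn_exponent {y₁ y₂ : ℝ} (hy₁ : IsUniqueMinimizerOn (E.W₁ V₁) E.range₁ y₁)
    (hy₂ : IsUniqueMinimizerOn (E.W₂ V₂) E.range₂ y₂) (l : ℕ) :
    IsUniqueMinimizerOn (E.exponent V₁ V₂ l) (E.range l) (alternatingSeq y₁ y₂ l) := by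
  by_cases hl : Even l <;> simpa [exponent, range, alternatingSeq, hl]

lemma iteratedDeriv_exponent (E : MomentDomain) (V₁ V₂ : ℝ → ℝ) (y₁ y₂ : ℝ) (l : ℕ) :
    iteratedDeriv 2 (E.exponent V₁ V₂ l) (alternatingSeq y₁ y₂ l) =
      alternatingSeq (iteratedDeriv 2 (E.W₁ V₁) y₁) (iteratedDeriv 2 (E.W₂ V₂) y₂) l := by
  by_cases hl : Even l <;> simp [exponent, alternatingSeq, hl]

/-- Of the Jacobian power `w ^ (n - 1 - l)`, the part `w ^ n` goes into the exponent, leaving the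
amplitude `w ^ (-(l + 1))`, which does not depend on `n`. -/
lemma exp_exponent_mul (E : MomentDomain) (V₁ V₂ : ℝ → ℝ) {l n : ℕ} (hl : l < n) {x : ℝ}
    (hx : x ∈ E.range l) :
    Real.exp (-(n : ℝ) * E.exponent V₁ V₂ l x) * (E.weight l x ^ (l + 1))⁻¹ =
      Real.exp (-(n : ℝ) * potential V₁ V₂ l x) * E.weight l x ^ (n - 1 - l) := by
  have hw := E.weight_pos hx
  rw [exponent_eq, show -(n : ℝ) * (potential V₁ V₂ l x - Real.log (E.weight l x)) =
    -(n : ℝ) * potential V₁ V₂ l x + n * Real.log (E.weight l x) by ring, Real.exp_add,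
    Real.exp_nat_mul, Real.exp_log hw, mul_assoc]
  congr 1
  rw [← div_eq_mul_inv, div_eq_iff (by positivity), ← pow_add]
  congr 1
  omega

lemma Admissible.laplaceData (hV : E.Admissible V₁ V₂) {y₁ y₂ : ℝ}
    (hy₁ : IsUniqueMinimizerOn (E.W₁ V₁) E.range₁ y₁)
    (hy₂ : IsUniqueMinimizerOn (E.W₂ V₂) E.range₂ y₂)
    (hW₁ : iteratedDeriv 2 (E.W₁ V₁) y₁ ≠ 0) (hW₂ : iteratedDeriv 2 (E.W₂ V₂) y₂ ≠ 0) (l : ℕ) :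
    LaplaceData (E.range l) (E.exponent V₁ V₂ l) (fun x => (E.weight l x ^ (l + 1))⁻¹)
      (alternatingSeq y₁ y₂ l) (l + 1) where
  isOpen := E.isOpen_range l
  contDiffOn := by
    have h := (hV.contDiffOn_potential l).sub
      ((E.contDiff_weight l).contDiffOn.log fun x hx => (E.weight_pos hx).ne')
    exact h.congr fun x _ => E.exponent_eq V₁ V₂ l x
  isMin := isUniqueMinimizerOn_exponent hy₁ hy₂ l
  deriv_ne_zero := by
    rw [iteratedDeriv_exponent]
    by_cases hl : Even l <;> simpa [alternatingSeq, hl]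
  continuousOn := by
    refine ContinuousOn.inv₀ ((E.contDiff_weight l).continuous.pow _).continuousOn fun x hx => ?_
    exact (pow_pos (E.weight_pos hx) _).ne'
  pos x hx := inv_pos.2 (pow_pos (E.weight_pos hx) _)
  integrableOn := by
    -- At `n = l + 1` the power `n - 1 - l` of the weight is 0; this is the reason for the choice
    -- `n₀ = l + 1`.
    refine (hV.integrableOn l (n := l + 1) (j := 0) (by omega)).congr_fun (fun x hx => ?_)
      (E.isOpen_range l).measurableSet
    rw [exp_exponent_mul E V₁ V₂ (Nat.lt_succ_self l) hx]
    simp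
  coercive := hV.coercive l

end MomentDomain

/-! # The law of the coordinates -/

section Pi

variable {ι : Type*} [Fintype ι]

lemma lintegral_pi_ofReal_prod {α : ι → Type*} [∀ i, MeasurableSpace (α i)]
    {μ : ∀ i, Measure (α i)} [∀ i, SigmaFinite (μ i)] {f : ∀ i, α i → ℝ}
    (hint : ∀ i, Integrable (f i) (μ i)) (hf : ∀ i, 0 ≤ᵐ[μ i] f i) :
    ∫⁻ y, ENNReal.ofReal (∏ i, f i (y i)) ∂Measure.pi μ =
      ∏ i, ∫⁻ x, ENNReal.ofReal (f i x) ∂μ i := by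
  have h0 : 0 ≤ᵐ[Measure.pi μ] fun y => ∏ i, f i (y i) := by
    have h : ∀ᵐ y ∂Measure.pi μ, ∀ i, 0 ≤ f i (y i) :=
      ae_all_iff.2 fun i => Measure.tendsto_eval_ae_ae (hf i)
    filter_upwards [h] with y hy
    exact Finset.prod_nonneg fun i _ => hy i
  rw [← ofReal_integral_eq_lintegral_ofReal (Integrable.fintype_prod_dep hint) h0,
    integral_fintype_prod_eq_prod, ENNReal.ofReal_prod_of_nonneg fun i _ =>
      integral_nonneg_of_ae (hf i)]
  exact Finset.prod_congr rfl fun i _ => ofReal_integral_eq_lintegral_ofReal (hint i) (hf i)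

lemma pi_withDensity_ofReal {α : ι → Type*} [∀ i, MeasurableSpace (α i)]
    {μ : ∀ i, Measure (α i)} [∀ i, SigmaFinite (μ i)] {f : ∀ i, α i → ℝ}
    (hint : ∀ i, Integrable (f i) (μ i)) (hf : ∀ i, 0 ≤ᵐ[μ i] f i) :
    (Measure.pi μ).withDensity (fun y => ENNReal.ofReal (∏ i, f i (y i))) =
      Measure.pi fun i => (μ i).withDensity fun x => ENNReal.ofReal (f i x) := by
  have := fun i => isFiniteMeasure_withDensity_ofReal (hint i).2
  refine (Measure.pi_eq fun s hs => ?_).symm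
  rw [withDensity_apply _ (MeasurableSet.univ_pi hs), Measure.restrict_pi_pi,
    lintegral_pi_ofReal_prod (fun i => (hint i).restrict) fun i => ae_restrict_of_ae (hf i)]
  exact Finset.prod_congr rfl fun i _ => (withDensity_apply _ (hs i)).symm

lemma pi_smul_measure {α : ι → Type*} [∀ i, MeasurableSpace (α i)]
    (μ : ∀ i, Measure (α i)) [∀ i, IsFiniteMeasure (μ i)] {c : ι → ENNReal} (hc : ∀ i, c i ≠ ⊤) :
    Measure.pi (fun i => c i • μ i) = (∏ i, c i) • Measure.pi μ := by
  have := fun i => Measure.smul_finite (μ i) (hc i)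
  refine Measure.pi_eq fun s hs => ?_
  simp [Finset.prod_mul_distrib]

end Pi

/-- The weight with index `l` occurs in the slopes with `l < i < n`, hence `n - 1 - l` times. -/
lemma prod_range_prod_range (w : ℕ → ℝ) (n : ℕ) :
    ∏ i ∈ Finset.range n, ∏ l ∈ Finset.range i, w l =
      ∏ l ∈ Finset.range n, w l ^ (n - 1 - l) := by
  induction n with
  | zero => simp
  | succ n ih =>
    rw [Finset.prod_range_succ, ih, Finset.prod_range_succ, ← Finset.prod_mul_distrib]
    simp only [Nat.add_sub_cancel, Nat.sub_self, pow_zero, mul_one]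
    refine Finset.prod_congr rfl fun l hl => ?_
    rw [← pow_succ]
    congr 1
    have := Finset.mem_range.1 hl
    omega

namespace MomentDomain

/-- The unnormalized density of the coordinate with index `l` in dimension `n`. -/
def coordDensity (E : MomentDomain) (V₁ V₂ : ℝ → ℝ) (n l : ℕ) (x : ℝ) : ℝ :=
  Real.exp (-(n : ℝ) * potential V₁ V₂ l x) * E.weight l x ^ (n - 1 - l)

/-- The law of the coordinate with index `l` in dimension `n`. -/
def coordLaw (E : MomentDomain) (V₁ V₂ : ℝ → ℝ) (n l : ℕ) : Measure ℝ :=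
  gibbsMeasure (E.range l) (E.coordDensity V₁ V₂ n l)

variable {E : MomentDomain} {V₁ V₂ : ℝ → ℝ}

lemma coordDensity_pos {n l : ℕ} {x : ℝ} (hx : x ∈ E.range l) :
    0 < E.coordDensity V₁ V₂ n l x :=
  mul_pos (Real.exp_pos _) (pow_pos (E.weight_pos hx) _)

lemma Admissible.integrableOn_coordDensity (hV : E.Admissible V₁ V₂) {n l : ℕ} (hn : 1 ≤ n) :
    IntegrableOn (E.coordDensity V₁ V₂ n l) (E.range l) :=
  hV.integrableOn l (by omega)

lemma Admissible.isProbabilityMeasure_coordLaw (hV : E.Admissible V₁ V₂) {n l : ℕ} (hn : 1 ≤ n) :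
    IsProbabilityMeasure (E.coordLaw V₁ V₂ n l) :=
  isProbabilityMeasure_gibbsMeasure (E.isOpen_range l) (E.range_nonempty l)
    (fun _ => coordDensity_pos) (hV.integrableOn_coordDensity hn)

/-- The source of independence: Jacobian determinant times density is a product of functions of
single coordinates. -/
lemma det_mul_exp (E : MomentDomain) (V₁ V₂ : ℝ → ℝ) {n : ℕ} (y : Fin n → ℝ) :
    (∏ i : Fin n, E.slope (extendZero y) i) * Real.exp (-(n : ℝ) * ∑ i : Fin n,
        if Even (i : ℕ) then V₁ (y i) else V₂ (y i)) =
      (∏ i : Fin n, E.scale i) * ∏ i : Fin n, E.coordDensity V₁ V₂ n i (y i) := by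
  simp only [slope, Finset.prod_mul_distrib, coordDensity, Finset.mul_sum, Real.exp_sum]
  rw [Fin.prod_univ_eq_prod_range (fun i => ∏ l ∈ Finset.range i, E.weight l (extendZero y l)),
    prod_range_prod_range,
    ← Fin.prod_univ_eq_prod_range (fun l => E.weight l (extendZero y l) ^ (n - 1 - l))]
  simp only [extendZero_coe]
  rw [mul_assoc]
  congr 1
  rw [mul_comm]
  congr 1
  refine Finset.prod_congr rfl fun i _ => ?_
  rw [potential]
  split_ifs <;> rfl

/-- The law of the moments, before normalization, is the image of a product measure. -/
lemma Admissible.withDensity_interior_momentSpace (hV : E.Admissible V₁ V₂) {n : ℕ} (hn : 1 ≤ n) :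
    ((volume.restrict (interior (momentSpace E.carrier n))).withDensity fun m =>
      ENNReal.ofReal (Real.exp
        (-(n : ℝ) * ∑ i : Fin n, if Even (i : ℕ) then V₁ (E.coord m i) else V₂ (E.coord m i)))) =
      ENNReal.ofReal (∏ i : Fin n, E.scale i) • (Measure.pi fun i : Fin n =>
        (volume.restrict (E.range i)).withDensity fun x =>
          ENNReal.ofReal (E.coordDensity V₁ V₂ n i x)).map (E.momentMap n) := by
  have hM : Measurable (E.momentMap n) := (E.contDiff_momentMap n).continuous.measurable
  have hbox := (E.isOpen_box n).measurableSet
  have hscale : 0 ≤ ∏ i : Fin n, E.scale i := Finset.prod_nonneg fun i _ => (E.scale_pos i).le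
  have hpi := pi_withDensity_ofReal (μ := fun i : Fin n => volume.restrict (E.range i))
    (f := fun i : Fin n => E.coordDensity V₁ V₂ n i)
    (fun i => hV.integrableOn_coordDensity hn) fun i =>
    (ae_restrict_iff' (E.isOpen_range i).measurableSet).2
      (Eventually.of_forall fun x hx => (coordDensity_pos hx).le)
  rw [← hpi, ← Measure.restrict_pi_pi]
  ext s hs
  rw [Measure.smul_apply, Measure.map_apply hM hs, withDensity_apply _ hs,
    withDensity_apply _ (hM hs), Measure.restrict_restrict hs, Measure.restrict_restrict (hM hs),
    interior_momentSpace, inter_comm s, ← image_inter_preimage, inter_comm _ (Set.pi _ _),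
    lintegral_image_eq_lintegral_abs_det_fderiv_mul volume (hbox.inter (hM hs))
      (fun y _ => (E.hasFDerivAt_momentMap y).hasFDerivWithinAt)
      ((E.injOn_momentMap n).mono inter_subset_left), smul_eq_mul,
    ← lintegral_const_mul' _ _ ENNReal.ofReal_ne_top]
  refine setLIntegral_congr_fun (hbox.inter (hM hs)) fun y hy => ?_
  rw [abs_of_pos (E.det_fderiv_momentMap_pos hy.1), E.coord_momentMap hy.1,
    ← ENNReal.ofReal_mul (E.det_fderiv_momentMap_pos hy.1).le, ← ENNReal.ofReal_mul hscale,
    det_fderiv_momentMap, det_mul_exp]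

/-- The coordinates are independent under the law of the moments. -/
theorem Admissible.momentLaw_eq (hV : E.Admissible V₁ V₂) {n : ℕ} (hn : 1 ≤ n) :
    E.momentLaw V₁ V₂ n =
      (Measure.pi fun i : Fin n => E.coordLaw V₁ V₂ n i).map (E.momentMap n) := by
  have hM : Measurable (E.momentMap n) := (E.contDiff_momentMap n).continuous.measurable
  have hprob : ∀ i : Fin n, IsProbabilityMeasure (E.coordLaw V₁ V₂ n i) := fun i =>
    hV.isProbabilityMeasure_coordLaw hn
  -- Each factor is a finite nonzero multiple of its normalization, so all constants, the Jacobian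
  -- scale included, merge into one total mass that normalization removes.
  have hfac : ∀ i : Fin n, ∃ a : ENNReal, a ≠ 0 ∧ a ≠ ⊤ ∧
      (volume.restrict (E.range i)).withDensity (fun x =>
        ENNReal.ofReal (E.coordDensity V₁ V₂ n i x)) = a • E.coordLaw V₁ V₂ n i := by
    intro i
    have hI := setIntegral_pos_of_continuousOn (E.isOpen_range i) (E.range_nonempty i)
      (fun _ => coordDensity_pos) (hV.integrableOn_coordDensity (l := i) hn)
    have hu := withDensity_univ_eq_ofReal (E.isOpen_range i) (fun _ => coordDensity_pos)
      (hV.integrableOn_coordDensity (l := i) hn)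
    refine ⟨ENNReal.ofReal (∫ x in E.range i, E.coordDensity V₁ V₂ n i x), by simpa using hI,
      ENNReal.ofReal_ne_top, ?_⟩
    simp only [coordLaw, gibbsMeasure]
    rw [hu, smul_smul, ENNReal.mul_inv_cancel (by simpa using hI) ENNReal.ofReal_ne_top, one_smul]
  choose a ha0 hatop ha using hfac
  have hscale : 0 < ∏ i : Fin n, E.scale i := Finset.prod_pos fun i _ => E.scale_pos i
  set P := (Measure.pi fun i : Fin n => E.coordLaw V₁ V₂ n i).map (E.momentMap n) with hP
  have hPprob : IsProbabilityMeasure P := Measure.isProbabilityMeasure_map hM.aemeasurable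
  set c := ENNReal.ofReal (∏ i : Fin n, E.scale i) * ∏ i, a i with hc
  have hc0 : c ≠ 0 := mul_ne_zero (by simpa using hscale) (Finset.prod_ne_zero_iff.2 fun i _ => ha0 i)
  have hctop : c ≠ ⊤ := ENNReal.mul_ne_top ENNReal.ofReal_ne_top
    (ENNReal.prod_ne_top fun i _ => hatop i)
  have key := hV.withDensity_interior_momentSpace hn
  simp only [ha] at key
  rw [pi_smul_measure _ hatop, Measure.map_smul, ← hP, smul_smul, ← hc] at key
  simp only [momentLaw]
  rw [key, Measure.smul_apply, measure_univ, smul_eq_mul, mul_one, smul_smul,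
    ENNReal.inv_mul_cancel hc0 hctop, one_smul]

end MomentDomain

/-! # The delta method -/

section DeltaMethod

variable {V V' : Type*} [NormedAddCommGroup V] [NormedSpace ℝ V] [NormedAddCommGroup V']
  [NormedSpace ℝ V']

/-- The difference quotient `(F (y + t u) - F y) / t`, extended by the derivative to `t = 0`. -/
def differenceQuotient (F : V → V') (F' : V →L[ℝ] V') (y : V) (p : V × ℝ) : V' :=
  F' p.1 + p.2⁻¹ • (F (y + p.2 • p.1) - F y - F' (p.2 • p.1))

lemma differenceQuotient_zero (F : V → V') (F' : V →L[ℝ] V') (y u : V) :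
    differenceQuotient F F' y (u, 0) = F' u := by
  simp [differenceQuotient]

lemma differenceQuotient_of_ne_zero (F : V → V') (F' : V →L[ℝ] V') (y u : V) {t : ℝ}
    (ht : t ≠ 0) : differenceQuotient F F' y (u, t) = t⁻¹ • (F (y + t • u) - F y) := by
  simp [differenceQuotient, smul_sub, smul_smul, inv_mul_cancel₀ ht]

/-- Only `t = 0` needs an argument: the remainder is `o(t u)` and `u` stays bounded near the limit
point. Joint continuity reduces the delta method to the continuous mapping theorem. -/
lemma continuous_differenceQuotient {F : V → V'} {F' : V →L[ℝ] V'} {y : V} (hF : Continuous F)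
    (hF' : HasFDerivAt F F' y) : Continuous (differenceQuotient F F' y) := by
  rw [continuous_iff_continuousAt]
  rintro ⟨u, t⟩
  refine ContinuousAt.add (by fun_prop) ?_
  rcases eq_or_ne t 0 with rfl | ht
  · have hlim : Tendsto (fun p : V × ℝ => p.2 • p.1) (𝓝 (u, 0)) (𝓝 0) :=
      (Continuous.tendsto' (by fun_prop) _ _ (by simp))
    have h1 := (hasFDerivAt_iff_isLittleO_nhds_zero.1 hF').comp_tendsto hlim
    have h2 : (fun p : V × ℝ => p.2 • p.1) =O[𝓝 (u, 0)] fun p => p.2 := by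
      have h3 : (fun p : V × ℝ => p.1) =O[𝓝 (u, 0)] fun _ => (1 : ℝ) :=
        (continuous_fst.tendsto (u, (0 : ℝ))).isBigO_one ℝ
      simpa using (Asymptotics.isBigO_refl (fun p : V × ℝ => p.2) (𝓝 (u, 0))).smul h3
    have h4 := h1.trans_isBigO h2
    rw [ContinuousAt]
    simp only [inv_zero, zero_smul]
    rw [← Asymptotics.isLittleO_one_iff ℝ]
    have h5 := (Asymptotics.isBigO_refl (fun p : V × ℝ => p.2⁻¹) (𝓝 (u, 0))).smul_isLittleO h4
    refine h5.trans_isBigO (Asymptotics.IsBigO.of_bound 1 (Eventually.of_forall fun p => ?_))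
    rcases eq_or_ne p.2 0 with h0 | h0
    · simp [h0]
    · simp [inv_mul_cancel₀ h0]
  · have h0 : ContinuousAt (fun p : V × ℝ => p.2⁻¹) (u, t) :=
      continuousAt_snd.inv₀ ht
    exact h0.smul (by fun_prop)

variable [MeasurableSpace V] [BorelSpace V] [SecondCountableTopology V]
  [MeasurableSpace V'] [BorelSpace V']

/-- **Delta method**: if the fluctuations of order `1 / √n` around `y` converge in law, then so do
those of the image under a map which is differentiable at `y`. -/
theorem tendsto_map_deltaMethod {F : V → V'} {F' : V →L[ℝ] V'} {y : V} (hF : Continuous F)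
    (hF' : HasFDerivAt F F' y) (ρ : ℕ → ProbabilityMeasure V) (γ : ProbabilityMeasure V)
    (h : Tendsto (fun n : ℕ => (ρ n).map (f := fun x => √(n : ℝ) • (x - y))
      (Continuous.measurable (by fun_prop)).aemeasurable) atTop (𝓝 γ)) :
    Tendsto (fun n : ℕ => (ρ n).map (f := fun x => √(n : ℝ) • (F x - F y))
      (Continuous.measurable (by fun_prop)).aemeasurable) atTop
      (𝓝 (γ.map F'.continuous.measurable.aemeasurable)) := by
  have hT := continuous_differenceQuotient hF hF'
  have ht : Tendsto (fun n : ℕ => (√(n : ℝ))⁻¹) atTop (𝓝 0) :=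
    tendsto_inv_atTop_zero.comp (Real.tendsto_sqrt_atTop.comp tendsto_natCast_atTop_atTop)
  -- The deterministic parameter `t = 1 / √n` is adjoined as a Dirac mass; a product of weakly
  -- convergent laws converges weakly, so no separate Slutsky argument is needed.
  have h1 : Tendsto (fun n : ℕ => ((ρ n).map (f := fun x => √(n : ℝ) • (x - y))
      (Continuous.measurable (by fun_prop)).aemeasurable).prod (diracProba (√(n : ℝ))⁻¹)) atTop
      (𝓝 (γ.prod (diracProba 0))) :=
    (ProbabilityMeasure.continuous_prod.tendsto (γ, diracProba 0)).comp
      (h.prodMk_nhds ((continuous_diracProba.tendsto 0).comp ht))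
  have h2 := ProbabilityMeasure.tendsto_map_of_tendsto_of_continuous _ _ h1 hT
  have hlim : (γ.prod (diracProba 0)).map hT.measurable.aemeasurable =
      γ.map F'.continuous.measurable.aemeasurable := by
    refine Subtype.ext ?_
    change ((γ : Measure V).prod (Measure.dirac (0 : ℝ))).map (differenceQuotient F F' y) =
      (γ : Measure V).map F'
    rw [Measure.prod_dirac, Measure.map_map hT.measurable (by fun_prop)]
    congr 1
    ext u
    exact differenceQuotient_zero F F' y u
  rw [hlim] at h2
  refine h2.congr' ?_
  filter_upwards [eventually_ge_atTop 1] with n hn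
  have hs : √(n : ℝ) ≠ 0 := (Real.sqrt_pos.2 (by exact_mod_cast hn)).ne'
  refine Subtype.ext ?_
  change (((ρ n : Measure V).map fun x => √(n : ℝ) • (x - y)).prod
    (Measure.dirac (√(n : ℝ))⁻¹)).map (differenceQuotient F F' y) =
      (ρ n : Measure V).map fun x => √(n : ℝ) • (F x - F y)
  have hm : Measurable fun x : V => √(n : ℝ) • (x - y) := Continuous.measurable (by fun_prop)
  rw [Measure.prod_dirac, Measure.map_map hT.measurable (by fun_prop),
    Measure.map_map (hT.measurable.comp (by fun_prop)) hm]
  congr 1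
  ext x
  simp only [Function.comp]
  rw [differenceQuotient_of_ne_zero _ _ _ _ (inv_ne_zero hs), inv_inv, smul_smul,
    inv_mul_cancel₀ hs, one_smul, add_sub_cancel]

end DeltaMethod

/-! # Linear images of Gaussian product measures -/

/-- The image of independent centered Gaussian variables of variances `v` under the matrix `J` is
the Gaussian measure with covariance matrix `J diag(v) Jᵀ`. -/
lemma map_mulVec_pi_gaussianReal {k : ℕ} (J : Matrix (Fin k) (Fin k) ℝ) (v : Fin k → NNReal)
    (hS : (J * Matrix.diagonal (fun i => (v i : ℝ)) * J.transpose).PosSemidef) :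
    (Measure.pi fun i => gaussianReal 0 (v i)).map (fun u => WithLp.toLp 2 (J.mulVec u)) =
      multivariateGaussian 0 (J * Matrix.diagonal (fun i => (v i : ℝ)) * J.transpose) := by
  have hm : Measurable fun u : Fin k → ℝ => WithLp.toLp 2 (J.mulVec u) :=
    Continuous.measurable (by fun_prop)
  have hprob := Measure.isProbabilityMeasure_map
    (μ := Measure.pi fun i => gaussianReal 0 (v i)) hm.aemeasurable
  refine Measure.ext_of_charFun (E := EuclideanSpace ℝ (Fin k)) ?_
  ext t
  have h1 : charFun ((Measure.pi fun i => gaussianReal 0 (v i)).map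
      fun u => WithLp.toLp 2 (J.mulVec u)) t =
      charFun ((Measure.pi fun i => gaussianReal 0 (v i)).map (WithLp.toLp 2))
        (WithLp.toLp 2 (J.transpose.mulVec (WithLp.ofLp t))) := by
    rw [charFun_apply, charFun_apply, integral_map hm.aemeasurable (by fun_prop),
      integral_map (by fun_prop) (by fun_prop)]
    refine integral_congr_ae (Eventually.of_forall fun u => ?_)
    simp only [EuclideanSpace.inner_eq_star_dotProduct,
      star_trivial]
    congr 3
    rw [Matrix.dotProduct_mulVec, Matrix.mulVec_transpose]
  rw [h1, charFun_pi, charFun_multivariateGaussian hS]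
  simp only [charFun_gaussianReal, ← Complex.exp_sum]
  congr 1
  simp only [inner_zero_right, Complex.ofReal_zero, zero_mul, mul_zero, zero_sub, Finset.sum_neg_distrib]
  congr 1
  rw [← Matrix.mulVec_mulVec, ← Matrix.mulVec_mulVec, Matrix.dotProduct_mulVec,
    ← Matrix.mulVec_transpose, dotProduct]
  simp only [Matrix.mulVec_diagonal]
  push_cast
  rw [Finset.sum_div]
  refine Finset.sum_congr rfl fun i _ => ?_
  ring

/-! # Marginals of product measures -/

lemma map_comp_pi_of_injective {ι κ : Type*} [Fintype ι] [Fintype κ] {f : κ → ι}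
    (hf : f.Injective) (μ : ι → Measure ℝ) [∀ i, IsProbabilityMeasure (μ i)] :
    (Measure.pi μ).map (fun y j => y (f j)) = Measure.pi fun j => μ (f j) := by
  have h1 : iIndepFun (fun (i : ι) (y : ι → ℝ) => y i) (Measure.pi μ) :=
    iIndepFun_pi (X := fun _ => id) fun _ => aemeasurable_id
  have h2 := (iIndepFun_iff_map_fun_eq_pi_map fun j => (measurable_pi_apply (f j)).aemeasurable).1
    (h1.precomp hf)
  rw [h2]
  congr 1
  ext1 j
  exact (measurePreserving_eval μ (f j)).map_eq

/-! # The central limit theorem -/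

namespace MomentDomain

variable {E : MomentDomain} {V₁ V₂ : ℝ → ℝ} {y₁ y₂ : ℝ}

/-- The law of the coordinate with index `l` in dimension `max n 1`, as a probability measure. -/
def Admissible.coordProb (hV : E.Admissible V₁ V₂) (n l : ℕ) : ProbabilityMeasure ℝ :=
  ⟨E.coordLaw V₁ V₂ (max n 1) l, hV.isProbabilityMeasure_coordLaw (le_max_right n 1)⟩

lemma Admissible.toMeasure_coordProb (hV : E.Admissible V₁ V₂) {n : ℕ} (hn : 1 ≤ n) (l : ℕ) :
    (hV.coordProb n l : Measure ℝ) = E.coordLaw V₁ V₂ n l := by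
  change E.coordLaw V₁ V₂ (max n 1) l = _
  rw [max_eq_left hn]

/-- The Gaussian limit of the fluctuations of the coordinate with index `l`. -/
def coordLimit (E : MomentDomain) (V₁ V₂ : ℝ → ℝ) (y₁ y₂ : ℝ) (l : ℕ) : ProbabilityMeasure ℝ :=
  centeredGaussian (iteratedDeriv 2 (E.exponent V₁ V₂ l) (alternatingSeq y₁ y₂ l))⁻¹.toNNReal

lemma alternating_mem_box (h₁ : y₁ ∈ E.range₁) (h₂ : y₂ ∈ E.range₂) (k : ℕ) :
    alternating k y₁ y₂ ∈ E.box k :=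
  fun i _ => alternatingSeq_mem_range h₁ h₂ i

lemma rawMoment_limitMeasure (h₁ : y₁ ∈ E.range₁) (h₂ : y₂ ∈ E.range₂) {k : ℕ} (i : Fin k) :
    rawMoment (E.limitMeasure y₁ y₂) (i + 1) = E.momentMap k (alternating k y₁ y₂) i := by
  rw [(E.limitMeasure_moments h₁ h₂).2,
    E.momentMap_eq (y := alternating k y₁ y₂) (y' := alternatingSeq y₁ y₂) fun _ => rfl]

/-- By triangularity the first `k` moments ignore all later coordinates, so their law in dimension
`n` involves only the first `k` coordinate laws. -/
lemma momentMap_castLE (E : MomentDomain) {k n : ℕ} (hkn : k ≤ n) (y : Fin n → ℝ) (i : Fin k) :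
    E.momentMap n y ⟨i, i.2.trans_le hkn⟩ = E.momentMap k (fun j => y (Fin.castLE hkn j)) i := by
  rw [E.momentMap_eq (y := fun j => y (Fin.castLE hkn j)) (y' := extendZero y) fun j =>
    extendZero_coe y (Fin.castLE hkn j)]
  rfl

lemma measurable_scaledDeviation (k : ℕ) (c : ℕ → ℝ) (n : ℕ) :
    Measurable (scaledDeviation k c : (Fin n → ℝ) → EuclideanSpace ℝ (Fin k)) := by
  unfold scaledDeviation
  refine (WithLp.measurable_toLp 2 _).comp (measurable_pi_lambda _ fun i => ?_)
  split_ifs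
  · fun_prop
  · exact measurable_const

/-- The law of the scaled deviation of the first `k` moments, in terms of the coordinates. -/
lemma Admissible.map_scaledDeviation (hV : E.Admissible V₁ V₂) (h₁ : y₁ ∈ E.range₁)
    (h₂ : y₂ ∈ E.range₂) {k n : ℕ} (hkn : k ≤ n) (hn : 1 ≤ n) :
    (E.momentLaw V₁ V₂ n).map (scaledDeviation k (rawMoment (E.limitMeasure y₁ y₂))) =
      (Measure.pi fun i : Fin k => E.coordLaw V₁ V₂ n i).map fun y => WithLp.toLp 2
        (√(n : ℝ) • (E.momentMap k y - E.momentMap k (alternating k y₁ y₂))) := by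
  have hM : ∀ m, Continuous (E.momentMap m) := fun m => (E.contDiff_momentMap m).continuous
  have hprob : ∀ l : ℕ, IsProbabilityMeasure (E.coordLaw V₁ V₂ n l) := fun l =>
    hV.isProbabilityMeasure_coordLaw hn
  have hpi := map_comp_pi_of_injective (Fin.castLE_injective hkn)
    fun i : Fin n => E.coordLaw V₁ V₂ n i
  simp only [Fin.val_castLE] at hpi
  have hk := hM k
  have hr : Measurable fun (y : Fin n → ℝ) (j : Fin k) => y (Fin.castLE hkn j) :=
    measurable_pi_lambda _ fun j => measurable_pi_apply _
  rw [hV.momentLaw_eq hn, Measure.map_map (measurable_scaledDeviation _ _ _) (hM n).measurable,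
    ← hpi, Measure.map_map (Continuous.measurable (by fun_prop)) hr]
  congr 1
  ext y i
  simp only [Function.comp, scaledDeviation, dif_pos (i.2.trans_le hkn),
    rawMoment_limitMeasure h₁ h₂, momentMap_castLE E hkn, Pi.smul_apply, Pi.sub_apply, smul_eq_mul]

lemma Admissible.tendsto_map_coordProb (hV : E.Admissible V₁ V₂)
    (hy₁ : IsUniqueMinimizerOn (E.W₁ V₁) E.range₁ y₁)
    (hy₂ : IsUniqueMinimizerOn (E.W₂ V₂) E.range₂ y₂)
    (hW₁ : iteratedDeriv 2 (E.W₁ V₁) y₁ ≠ 0) (hW₂ : iteratedDeriv 2 (E.W₂ V₂) y₂ ≠ 0) (l : ℕ) :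
    Tendsto (fun n : ℕ => (hV.coordProb n l).map
      (f := fun x => √(n : ℝ) * (x - alternatingSeq y₁ y₂ l)) (by fun_prop)) atTop
      (𝓝 (E.coordLimit V₁ V₂ y₁ y₂ l)) := by
  refine (hV.laplaceData hy₁ hy₂ hW₁ hW₂ l).tendsto_map (fun n => hV.coordProb n l) ?_
  -- For `n ≤ l` the natural subtraction in `n - 1 - l` would truncate.
  filter_upwards [eventually_ge_atTop (l + 1)] with n hn
  rw [hV.toMeasure_coordProb (by omega), coordLaw]
  exact gibbsMeasure_congr (E.isOpen_range l).measurableSet fun x hx =>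
    (exp_exponent_mul E V₁ V₂ hn hx).symm

lemma Admissible.tendsto_map_pi_coordProb (hV : E.Admissible V₁ V₂)
    (hy₁ : IsUniqueMinimizerOn (E.W₁ V₁) E.range₁ y₁)
    (hy₂ : IsUniqueMinimizerOn (E.W₂ V₂) E.range₂ y₂)
    (hW₁ : iteratedDeriv 2 (E.W₁ V₁) y₁ ≠ 0) (hW₂ : iteratedDeriv 2 (E.W₂ V₂) y₂ ≠ 0) (k : ℕ) :
    Tendsto (fun n : ℕ => (ProbabilityMeasure.pi fun i : Fin k => hV.coordProb n i).map
      (f := fun x => √(n : ℝ) • (x - alternating k y₁ y₂))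
      (Continuous.measurable (by fun_prop)).aemeasurable) atTop
      (𝓝 (ProbabilityMeasure.pi fun i : Fin k => E.coordLimit V₁ V₂ y₁ y₂ i)) := by
  refine ((ProbabilityMeasure.continuous_pi.tendsto _).comp (tendsto_pi_nhds.2 fun i : Fin k =>
    hV.tendsto_map_coordProb hy₁ hy₂ hW₁ hW₂ i)).congr fun n => Subtype.ext ?_
  have := fun i : Fin k => Measure.isProbabilityMeasure_map
    (μ := (hV.coordProb n i : Measure ℝ)) (f := fun x => √(n : ℝ) * (x - alternatingSeq y₁ y₂ i))
    (by fun_prop)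
  exact (Measure.pi_map_pi (μ := fun i : Fin k => (hV.coordProb n i : Measure ℝ))
    (f := fun (i : Fin k) x => √(n : ℝ) * (x - alternatingSeq y₁ y₂ i))
    fun i => by fun_prop).symm

/-- The second derivatives at the minimizers are positive. -/
lemma Admissible.deriv_pos (hV : E.Admissible V₁ V₂)
    (hy₁ : IsUniqueMinimizerOn (E.W₁ V₁) E.range₁ y₁)
    (hy₂ : IsUniqueMinimizerOn (E.W₂ V₂) E.range₂ y₂)
    (hW₁ : iteratedDeriv 2 (E.W₁ V₁) y₁ ≠ 0) (hW₂ : iteratedDeriv 2 (E.W₂ V₂) y₂ ≠ 0) (l : ℕ) :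
    0 < alternatingSeq (iteratedDeriv 2 (E.W₁ V₁) y₁) (iteratedDeriv 2 (E.W₂ V₂) y₂) l := by
  rw [← iteratedDeriv_exponent]
  exact (hV.laplaceData hy₁ hy₂ hW₁ hW₂ l).deriv_pos

/-- The limiting covariance matrix in terms of the polynomial map from coordinates to moments. -/
def limitCovariance (E : MomentDomain) (V₁ V₂ : ℝ → ℝ) (y₁ y₂ : ℝ) (k : ℕ) :
    Matrix (Fin k) (Fin k) ℝ :=
  jacobian (E.momentMap k) (alternating k y₁ y₂) *
    Matrix.diagonal (fun i : Fin k => (((alternatingSeq (iteratedDeriv 2 (E.W₁ V₁) y₁)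
      (iteratedDeriv 2 (E.W₂ V₂) y₂) i)⁻¹.toNNReal : NNReal) : ℝ)) *
    (jacobian (E.momentMap k) (alternating k y₁ y₂)).transpose

lemma posSemidef_limitCovariance (E : MomentDomain) (V₁ V₂ : ℝ → ℝ) (y₁ y₂ : ℝ) (k : ℕ) :
    (E.limitCovariance V₁ V₂ y₁ y₂ k).PosSemidef := by
  have h : (Matrix.diagonal (fun i : Fin k => (((alternatingSeq (iteratedDeriv 2 (E.W₁ V₁) y₁)
      (iteratedDeriv 2 (E.W₂ V₂) y₂) i)⁻¹.toNNReal : NNReal) : ℝ))).PosSemidef :=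
    Matrix.PosSemidef.diagonal fun i => NNReal.coe_nonneg _
  simpa [limitCovariance, Matrix.conjTranspose_eq_transpose_of_trivial] using
    h.mul_mul_conjTranspose_same (jacobian (E.momentMap k) (alternating k y₁ y₂))

/-- Convergence in law of the scaled deviations of the first `k` moments. -/
theorem Admissible.tendsto_map_momentMap (hV : E.Admissible V₁ V₂)
    (hy₁ : IsUniqueMinimizerOn (E.W₁ V₁) E.range₁ y₁)
    (hy₂ : IsUniqueMinimizerOn (E.W₂ V₂) E.range₂ y₂)
    (hW₁ : iteratedDeriv 2 (E.W₁ V₁) y₁ ≠ 0) (hW₂ : iteratedDeriv 2 (E.W₂ V₂) y₂ ≠ 0) (k : ℕ)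
    (L : ℕ → ProbabilityMeasure (EuclideanSpace ℝ (Fin k)))
    (hL : ∀ᶠ n in atTop, (L n : Measure (EuclideanSpace ℝ (Fin k))) =
      (E.momentLaw V₁ V₂ n).map (scaledDeviation k (rawMoment (E.limitMeasure y₁ y₂))))
    (G : ProbabilityMeasure (EuclideanSpace ℝ (Fin k)))
    (hG : (G : Measure (EuclideanSpace ℝ (Fin k))) =
      multivariateGaussian 0 (E.limitCovariance V₁ V₂ y₁ y₂ k)) :
    Tendsto L atTop (𝓝 G) := by
  have hM : Continuous (E.momentMap k) := (E.contDiff_momentMap k).continuous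
  have h1 := tendsto_map_deltaMethod hM (E.hasFDerivAt_momentMap (alternating k y₁ y₂))
    (fun n : ℕ => ProbabilityMeasure.pi fun i : Fin k => hV.coordProb n i) _
    (hV.tendsto_map_pi_coordProb hy₁ hy₂ hW₁ hW₂ k)
  have h2 := ProbabilityMeasure.tendsto_map_of_tendsto_of_continuous _ _ h1
    (PiLp.continuous_toLp 2 fun _ : Fin k => ℝ)
  have hlim : (((ProbabilityMeasure.pi fun i : Fin k => E.coordLimit V₁ V₂ y₁ y₂ i).map
      (fderiv ℝ (E.momentMap k) (alternating k y₁ y₂)).continuous.measurable.aemeasurable).map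
      (PiLp.continuous_toLp 2 fun _ : Fin k => ℝ).measurable.aemeasurable) = G := by
    refine Subtype.ext ?_
    change _ = (G : Measure (EuclideanSpace ℝ (Fin k)))
    rw [hG, limitCovariance, ← map_mulVec_pi_gaussianReal _ _
      (E.posSemidef_limitCovariance V₁ V₂ y₁ y₂ k)]
    simp only [← iteratedDeriv_exponent]
    change ((Measure.pi fun i : Fin k => gaussianReal 0 _).map _).map _ = _
    rw [Measure.map_map (PiLp.continuous_toLp 2 fun _ : Fin k => ℝ).measurable
      (fderiv ℝ (E.momentMap k) (alternating k y₁ y₂)).continuous.measurable]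
    congr 1
    ext1 u
    simp only [Function.comp]
    congr 1
    exact (LinearMap.toMatrix'_mulVec _ u).symm
  rw [hlim] at h2
  refine h2.congr' ?_
  filter_upwards [hL, eventually_ge_atTop k, eventually_ge_atTop 1] with n hn hkn hn1
  refine Subtype.ext ?_
  change _ = (L n : Measure (EuclideanSpace ℝ (Fin k)))
  rw [hn, hV.map_scaledDeviation hy₁.1 hy₂.1 hkn hn1]
  simp only [← hV.toMeasure_coordProb hn1]
  change ((Measure.pi fun i : Fin k => (hV.coordProb n i : Measure ℝ)).map _).map _ = _
  rw [Measure.map_map (PiLp.continuous_toLp 2 fun _ : Fin k => ℝ).measurable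
    (Continuous.measurable (by fun_prop))]
  rfl

end MomentDomain

theorem theorem3p1 (E : MomentDomain) (V₁ V₂ : ℝ → ℝ) (hV : E.Admissible V₁ V₂) (y₁ y₂ : ℝ)
    (hy₁ : IsUniqueMinimizerOn (E.W₁ V₁) E.range₁ y₁)
    (hy₂ : IsUniqueMinimizerOn (E.W₂ V₂) E.range₂ y₂)
    (hW₁ : iteratedDeriv 2 (E.W₁ V₁) y₁ ≠ 0) (hW₂ : iteratedDeriv 2 (E.W₂ V₂) y₂ ≠ 0) :
    -- the laws and the limiting moments are well defined
    (∀ n : ℕ, 1 ≤ n → IsProbabilityMeasure (E.momentLaw V₁ V₂ n)) ∧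
    E.limitMeasure y₁ y₂ ∈ momentMeasures E.carrier ∧
    ∀ k : ℕ, 1 ≤ k →
      let J : Matrix (Fin k) (Fin k) ℝ := jacobian (E.phi k) (alternating k y₁ y₂)
      let D : Matrix (Fin k) (Fin k) ℝ := Matrix.diagonal
        (alternating k (iteratedDeriv 2 (E.W₁ V₁) y₁) (iteratedDeriv 2 (E.W₂ V₂) y₂))
      let S : Matrix (Fin k) (Fin k) ℝ := J * D⁻¹ * J.transpose
      DifferentiableAt ℝ (E.phi k) (alternating k y₁ y₂) ∧ IsUnit D ∧ S.PosSemidef ∧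
      -- the central limit theorem
      (∀ {Ω : ℕ → Type*} [∀ n, MeasurableSpace (Ω n)] (P : ∀ n, Measure (Ω n))
        [∀ n, IsProbabilityMeasure (P n)] (M : ∀ n, Ω n → (Fin n → ℝ)),
        (∀ n : ℕ, 1 ≤ n → HasLaw (M n) (E.momentLaw V₁ V₂ n) (P n)) →
        TendstoInDistribution
          (fun n ω => scaledDeviation k (rawMoment (E.limitMeasure y₁ y₂)) (M n ω)) atTop
          (id : EuclideanSpace ℝ (Fin k) → EuclideanSpace ℝ (Fin k)) P
          (multivariateGaussian 0 S)) ∧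
      -- the explicit Jacobian on the half-line
      (E = MomentDomain.halfLine → y₁ = y₂ → ∀ i j : Fin k,
        J i j = y₁ ^ (i : ℕ) *
          (binomInt (2 * (i + 1)) ((i : ℤ) - j) - binomInt (2 * (i + 1)) ((i : ℤ) - j - 1))) := by
  have hbox : ∀ k, alternating k y₁ y₂ ∈ E.box k := E.alternating_mem_box hy₁.1 hy₂.1
  have hlim := E.limitMeasure_moments hy₁.1 hy₂.1
  have hκ := hV.deriv_pos hy₁ hy₂ hW₁ hW₂
  refine ⟨fun n hn => ?_, hlim.1, fun k hk => ?_⟩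
  · have := fun i : Fin n => hV.isProbabilityMeasure_coordLaw (l := i) hn
    rw [hV.momentLaw_eq hn]
    exact Measure.isProbabilityMeasure_map (E.contDiff_momentMap n).continuous.aemeasurable
  intro J D S
  -- The choice in `phi` is controlled only on the box; as the box is open, equality there suffices
  -- for derivatives.
  have hphi := E.phi_eventuallyEq (hbox k)
  have hJ : J = jacobian (E.momentMap k) (alternating k y₁ y₂) := by
    simp only [J, jacobian, hphi.fderiv_eq]
  have hD : D * Matrix.diagonal (fun i : Fin k => (((alternatingSeq (iteratedDeriv 2 (E.W₁ V₁) y₁)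
      (iteratedDeriv 2 (E.W₂ V₂) y₂) i)⁻¹.toNNReal : NNReal) : ℝ)) = 1 := by
    rw [Matrix.diagonal_mul_diagonal, ← Matrix.diagonal_one]
    congr 1
    ext i
    rw [Real.coe_toNNReal _ (inv_nonneg.2 (hκ i).le)]
    exact mul_inv_cancel₀ (hκ i).ne'
  have hS : S = E.limitCovariance V₁ V₂ y₁ y₂ k := by
    simp only [S, Matrix.inv_eq_right_inv hD, hJ, MomentDomain.limitCovariance]
  refine ⟨((E.hasFDerivAt_momentMap _).congr_of_eventuallyEq hphi).differentiableAt,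
    IsUnit.of_mul_eq_one _ hD, hS ▸ E.posSemidef_limitCovariance V₁ V₂ y₁ y₂ k, ?_, ?_⟩
  · intro Ω _ P _ M hM
    have hmeas : ∀ n, AEMeasurable (M n) (P n) := fun n => by
      -- No law is prescribed for `n = 0`, but a map into `Fin 0 → ℝ` is measurable anyway.
      rcases Nat.eq_zero_or_pos n with rfl | hn
      · exact (measurable_of_subsingleton_codomain _).aemeasurable
      · exact (hM n hn).aemeasurable
    have hdev := MomentDomain.measurable_scaledDeviation k (rawMoment (E.limitMeasure y₁ y₂))
    refine ⟨fun n => (hdev n).comp_aemeasurable (hmeas n), aemeasurable_id, ?_⟩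
    refine hV.tendsto_map_momentMap hy₁ hy₂ hW₁ hW₂ k _ ?_ _ ?_
    · filter_upwards [eventually_ge_atTop 1] with n hn
      rw [← (hM n hn).map_eq, AEMeasurable.map_map_of_aemeasurable (hdev n).aemeasurable (hmeas n)]
      rfl
    · rw [← hS]
      exact Measure.map_id
  · rintro rfl rfl i j
    rw [hJ, show alternating k y₁ y₁ = fun _ => y₁ by ext; simp [alternating]]
    exact MomentDomain.jacobian_momentMap_halfLine y₁ i j

end
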